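/- **Setting.** Let $w(x)=1+|x|$ and, for $1\le p\le\infty$ and $r\in\mathbb R$, let $L^p_r(\mathbb R)=\{f: w^r f\in L^p(\mathbb R)\}$ with norm $\|f\|_{L^p_r}=\|w^rf\|_{L^p}$. Let $s>s_1>\tfrac12$ and let $u\in L^2_s(\mathbb R)$ be real-valued. For $\lambda>0$ write $\boldsymbol e(\lambda)(x)=e^{i\lambda x}$, let $\overline{\boldsymbol e}(\lambda)$ be its complex conjugate, and let $$G_{\lambda\pm0i}(x)=\pm i e^{i\lambda x}\chi_{\mathbb R^{\pm}}(x)-\frac1{2\pi}\int_{-\infty}^0\frac{e^{ix\xi}}{\xi-\lambda}\,d\xi ,$$ where $\mathbb R^+=(0,\infty)$, $\mathbb R^-=(-\infty,0)$, and the integral is the limit of $\int_{-R}^0$ as $R\to\infty$ (it exists for every $x\neq0$). For every $\lambda>0$ and each choice of the sign, the integral equations $$m_1(\lambda\pm0i)=1+G_{\lambda\pm0i}*\bigl(u\,m_1(\lambda\pm0i)\bigr),\qquad m_e(\lambda\pm0i)=\boldsymbol e(\lambda)+G_{\lambda\pm0i}*\bigl(u\,m_e(\lambda\pm0i)\bigr)$$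 have unique solutions $m_1(\lambda\pm0i)$ and $m_e(\lambda\pm0i)$ in the space $L^\infty_{-(s-s_1)}(\mathbb R)$ of complex-valued functions (the Jost functions). **Lemma 4.1.** There is $\gamma$ with $0<\gamma<1$ such that, for each choice of the sign, the map $\lambda\mapsto\overline{\boldsymbol e}(\lambda)\,m_e(\lambda\pm0i)$ belongs to $C^{1,\gamma}_{loc}\bigl((0,\infty),L^\infty_{-(s-s_1)}(\mathbb R)\bigr)$, that is, it is differentiable as a map into the normed space $L^\infty_{-(s-s_1)}(\mathbb R)$ and its derivative is Hölder continuous of exponent $\gamma$ on every compact subset of $(0,\infty)$. Moreover, for every $\lambda>0$, $u\,m_e(\lambda\pm0i)$ is integrable and $$\partial_\lambda\bigl(\overline{\boldsymbol e}(\lambda)m_e(\lambda\pm0i)\bigr)=-\frac{\overline{\boldsymbol e}(\lambda)}{2\pi\lambda}\left(\int_{\mathbb R}u(y)\,m_e(y,\lambda\pm0i)\,dy\right)m_1(\lambda\pm0i).$$ -/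

import Mathlib

open MeasureTheory Filter Topology Set
open scoped ENNReal NNReal

noncomputable section

namespace BO

/-! ### Weighted Lebesgue spaces on the real line -/

/-- The weight `w(x) = 1 + |x|`. -/
def weight (x : ℝ) : ℝ := 1 + |x|

lemma weight_pos (x : ℝ) : 0 < weight x := by
  unfold weight; positivity

/-- `f ∈ L^p_s(ℝ)`, that is, `w^s f ∈ L^p(ℝ)`. -/
def MemWeightedLp {E : Type*} [NormedAddCommGroup E] [NormedSpace ℝ E]
    (f : ℝ → E) (p : ℝ≥0∞) (s : ℝ) : Prop :=
  MemLp (fun x => (weight x ^ s) • f x) p volume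

/-- The complex vector space of all classes (modulo equality almost everywhere) of complex-valued
functions that lie in `L^p_s(ℝ)`. -/
def weightedLpSubmodule (p : ℝ≥0∞) (s : ℝ) : Submodule ℂ (ℝ →ₘ[volume] ℂ) where
  carrier := {f | MemWeightedLp f p s}
  zero_mem' := by
    have h : MemLp (fun _ : ℝ => (0 : ℂ)) p volume := MemLp.zero'
    refine (memLp_congr_ae ?_).2 h
    filter_upwards [AEEqFun.coeFn_zero (α := ℝ) (β := ℂ) (μ := volume)] with x hx
    simp [hx]
  add_mem' := by
    intro f g hf hg
    refine (memLp_congr_ae ?_).2 (MemLp.add hf hg)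
    filter_upwards [AEEqFun.coeFn_add f g] with x hx
    simp [hx]
  smul_mem' := by
    intro c f hf
    refine (memLp_congr_ae ?_).2 (MemLp.const_smul hf c)
    filter_upwards [AEEqFun.coeFn_smul c f] with x hx
    simp [hx]
    ring

/-- The space `L^p_s(ℝ)` of complex-valued functions (modulo equality almost everywhere). -/
def WeightedLp (p : ℝ≥0∞) (s : ℝ) : Type := weightedLpSubmodule p s

namespace WeightedLp

variable {p : ℝ≥0∞} {s : ℝ}

instance : AddCommGroup (WeightedLp p s) :=
  inferInstanceAs (AddCommGroup (weightedLpSubmodule p s))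

instance : Module ℂ (WeightedLp p s) :=
  inferInstanceAs (Module ℂ (weightedLpSubmodule p s))

/-- The underlying class of functions. -/
def toAEEqFun (f : WeightedLp p s) : ℝ →ₘ[volume] ℂ := Subtype.val f

/-- A (measurable) representative of the class. -/
instance : CoeFun (WeightedLp p s) fun _ => ℝ → ℂ := ⟨fun f => f.toAEEqFun⟩

lemma memLp (f : WeightedLp p s) : MemLp (fun x => (weight x ^ s) • f x) p volume := f.2

/-- The linear map `f ↦ w^s f` from `L^p_s(ℝ)` to `L^p(ℝ)`. -/
def mulWeight (p : ℝ≥0∞) (s : ℝ) : WeightedLp p s →ₗ[ℂ] Lp ℂ p (volume : Measure ℝ) where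
  toFun f := f.memLp.toLp (fun x => (weight x ^ s) • f x)
  map_add' f g := by
    rw [← MemLp.toLp_add, MemLp.toLp_eq_toLp_iff]
    filter_upwards [AEEqFun.coeFn_add f.toAEEqFun g.toAEEqFun] with x hx
    have hx' : (f + g : WeightedLp p s) x = f x + g x := hx
    simp [hx']
  map_smul' c f := by
    rw [RingHom.id_apply, ← MemLp.toLp_const_smul, MemLp.toLp_eq_toLp_iff]
    filter_upwards [AEEqFun.coeFn_smul c f.toAEEqFun] with x hx
    have hx' : (c • f : WeightedLp p s) x = c • f x := hx
    simp [hx']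
    ring

lemma mulWeight_injective : Function.Injective (mulWeight p s) := by
  intro f g h
  have h' := (MemLp.toLp_eq_toLp_iff f.memLp g.memLp).1 h
  refine Subtype.ext (AEEqFun.ext ?_)
  filter_upwards [h'] with x hx
  have hw : weight x ^ s ≠ 0 := (Real.rpow_pos_of_pos (weight_pos x) s).ne'
  exact smul_right_injective ℂ hw hx

/-- The norm `‖f‖ = ‖w^s f‖_p` on `L^p_s(ℝ)`. -/
instance [Fact (1 ≤ p)] : NormedAddCommGroup (WeightedLp p s) :=
  NormedAddCommGroup.induced _ _ (mulWeight p s) mulWeight_injective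

instance [Fact (1 ≤ p)] : NormedSpace ℂ (WeightedLp p s) :=
  NormedSpace.induced ℂ _ _ (mulWeight p s)

lemma norm_eq [Fact (1 ≤ p)] (f : WeightedLp p s) :
    ‖f‖ = (eLpNorm (fun x => (weight x ^ s) • f x) p volume).toReal :=
  Lp.norm_toLp _ f.memLp

end WeightedLp

/-- The plane wave `𝐞(x, l) = e^{i l x}`. -/
def planeWave (l x : ℝ) : ℂ := Complex.exp (Complex.I * l * x)

lemma continuous_planeWave (l : ℝ) : Continuous (planeWave l) := by
  unfold planeWave; fun_prop

lemma norm_planeWave (l x : ℝ) : ‖planeWave l x‖ = 1 := by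
  have h : Complex.I * l * x = ((l * x : ℝ) : ℂ) * Complex.I := by push_cast; ring
  rw [planeWave, h, Complex.norm_exp_ofReal_mul_I]

/-- The element `x ↦ conj (𝐞(x, l)) f(x)` of `L^p_s(ℝ)`, for `f` in `L^p_s(ℝ)`. -/
def conjWaveMul {p : ℝ≥0∞} {s : ℝ} (l : ℝ) (f : WeightedLp p s) : WeightedLp p s :=
  ⟨AEEqFun.mk (fun x => (starRingEnd ℂ) (planeWave l x))
      (Complex.continuous_conj.comp (continuous_planeWave l)).aestronglyMeasurable
      * f.toAEEqFun, by
    have hc : AEStronglyMeasurable (fun x => (starRingEnd ℂ) (planeWave l x)) volume :=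
      (Complex.continuous_conj.comp (continuous_planeWave l)).aestronglyMeasurable
    have hae : (fun x => (weight x ^ s) • (AEEqFun.mk _ hc * f.toAEEqFun : ℝ →ₘ[volume] ℂ) x)
        =ᵐ[volume] fun x => (starRingEnd ℂ) (planeWave l x) * ((weight x ^ s) • f x) := by
      filter_upwards [AEEqFun.coeFn_mul (AEEqFun.mk _ hc) f.toAEEqFun,
        AEEqFun.coeFn_mk _ hc] with x hx hx'
      simp only [hx, Pi.mul_apply, hx', Complex.real_smul]
      ring
    refine (memLp_congr_ae hae).2 (f.memLp.of_le (hc.mul f.memLp.1) ?_)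
    refine Eventually.of_forall fun x => ?_
    rw [norm_mul, RCLike.norm_conj, norm_planeWave, one_mul]⟩

lemma coeFn_conjWaveMul {p : ℝ≥0∞} {s : ℝ} (l : ℝ) (f : WeightedLp p s) :
    conjWaveMul l f =ᵐ[volume] fun x => (starRingEnd ℂ) (planeWave l x) * f x := by
  have hc : AEStronglyMeasurable (fun x => (starRingEnd ℂ) (planeWave l x)) volume :=
    (Complex.continuous_conj.comp (continuous_planeWave l)).aestronglyMeasurable
  filter_upwards [AEEqFun.coeFn_mul (AEEqFun.mk _ hc) f.toAEEqFun,
    AEEqFun.coeFn_mk _ hc] with x hx hx'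
  have : conjWaveMul l f x = (AEEqFun.mk _ hc * f.toAEEqFun : ℝ →ₘ[volume] ℂ) x := rfl
  rw [this, hx, Pi.mul_apply, hx']

/-! ### The convolution kernels and the Jost solutions -/

/-- The kernel `(1 / 2π) ∫_{-∞}^0 e^{i x ξ} / (ξ - l) dξ` for `l > 0`. The integral converges only
conditionally, as the limit of `∫_{-R}^0` for `R → ∞`; the limit exists for every `x ≠ 0`. -/
def kernelTilde (l x : ℝ) : ℂ :=
  (1 / (2 * Real.pi) : ℂ) *
    limUnder atTop fun R : ℝ =>
      ∫ ξ in (-R)..0, Complex.exp (Complex.I * x * ξ) / ((ξ : ℂ) - l)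

/-- The limit in the definition of `kernelTilde` exists for every `x ≠ 0`. -/
lemma exists_tendsto_kernelTilde (l x : ℝ) (hl : 0 < l) (hx : x ≠ 0) : ∃ c : ℂ,
    Tendsto (fun R : ℝ => ∫ ξ in (-R)..0, Complex.exp (Complex.I * x * ξ) / ((ξ : ℂ) - l))
      atTop (𝓝 c) := by
  have hx' : (x : ℂ) ≠ 0 := by exact_mod_cast hx
  have hne : ∀ ξ : ℝ, ξ ≤ 0 → (ξ : ℂ) - l ≠ 0 := fun ξ h => by
    have : ξ - l ≠ 0 := by linarith
    exact_mod_cast this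
  have hexp : ∀ y : ℝ, ‖Complex.exp (Complex.I * x * y)‖ = 1 := fun y => norm_planeWave x y
  have key : ∀ R : ℝ, 0 ≤ R →
      (∫ ξ in (-R)..0, Complex.exp (Complex.I * x * ξ) / ((ξ : ℂ) - l)) =
      1 / (Complex.I * x * (-l)) - Complex.exp (Complex.I * x * (-R : ℝ)) / (Complex.I * x * ((-R : ℝ) - l))
       + ∫ ξ in (-R)..0, Complex.exp (Complex.I * x * ξ) / (Complex.I * x * ((ξ : ℂ) - l)^2) := by
    intro R hR
    have hle : ∀ ξ ∈ uIcc (-R) 0, ξ ≤ 0 := by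
      intro ξ h; rw [uIcc_of_le (by linarith)] at h; exact h.2
    have hint : ∀ f : ℝ → ℂ, ContinuousOn f (uIcc (-R) 0) → IntervalIntegrable f volume (-R) 0 :=
      fun f hf => hf.intervalIntegrable
    have c1 : ContinuousOn (fun ξ : ℝ => Complex.exp (Complex.I * x * ξ) / ((ξ : ℂ) - l)) (uIcc (-R) 0) :=
      ContinuousOn.div (by fun_prop) (by fun_prop) (fun ξ h => hne ξ (hle ξ h))
    have c2 : ContinuousOn (fun ξ : ℝ => Complex.exp (Complex.I * x * ξ) / (Complex.I * x * ((ξ : ℂ) - l)^2)) (uIcc (-R) 0) :=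
      ContinuousOn.div (by fun_prop) (by fun_prop) (fun ξ h => mul_ne_zero (mul_ne_zero Complex.I_ne_zero hx') (pow_ne_zero _ (hne ξ (hle ξ h))))
    have := intervalIntegral.integral_eq_sub_of_hasDerivAt (a := -R) (b := 0)
      (f := fun ξ : ℝ => Complex.exp (Complex.I * x * ξ) / (Complex.I * x * ((ξ:ℂ) - l)))
      (f' := fun ξ : ℝ => Complex.exp (Complex.I * x * ξ) / ((ξ : ℂ) - l) - Complex.exp (Complex.I * x * ξ) / (Complex.I * x * ((ξ : ℂ) - l)^2)) ?_ ((hint _ c1).sub (hint _ c2))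
    · rw [intervalIntegral.integral_sub (hint _ c1) (hint _ c2)] at this
      rw [sub_eq_iff_eq_add] at this
      rw [this]; simp
    · intro ξ h
      have h0 := hne ξ (hle ξ h)
      have hid : HasDerivAt (fun ξ : ℝ => (ξ : ℂ)) 1 ξ := Complex.ofRealCLM.hasDerivAt
      have h1 := ((hid.const_mul (Complex.I * x)).cexp).div ((hid.sub_const (l:ℂ)).const_mul (Complex.I * x)) (mul_ne_zero (mul_ne_zero Complex.I_ne_zero hx') h0)
      refine h1.congr_deriv (Eq.symm ?_)
      have hI := Complex.I_ne_zero
      rw [mul_one, div_sub_div _ _ h0 (mul_ne_zero (mul_ne_zero hI hx') (pow_ne_zero _ h0)),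
        div_eq_div_iff (mul_ne_zero h0 (mul_ne_zero (mul_ne_zero hI hx') (pow_ne_zero _ h0)))
          (pow_ne_zero _ (mul_ne_zero (mul_ne_zero hI hx') h0))]
      ring
  have hi : IntegrableOn (fun ξ : ℝ => Complex.exp (Complex.I * x * ξ) / (Complex.I * x * ((ξ : ℂ) - l)^2)) (Iic 0) := by
    have h0 : IntegrableOn (fun ξ : ℝ => (l - ξ) ^ (-2 : ℝ)) (Iic 0) := by
      have := (integrableOn_Ioi_rpow_of_lt (a := -2) (by norm_num) hl)
      have h2 := (MeasurePreserving.integrableOn_comp_preimage (Measure.measurePreserving_sub_left volume l) (Homeomorph.subLeft l).measurableEmbedding (f := fun t : ℝ => t ^ (-2:ℝ)) (s := Ioi l)).2 this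
      have : (fun x => l - x) ⁻¹' Ioi l = Iio 0 := by ext y; simp
      rw [this] at h2
      exact (integrableOn_Iic_iff_integrableOn_Iio (by simp)).2 h2
    refine Integrable.mono' (h0.const_mul (1/|x|)) ?_ ?_
    · refine ContinuousOn.aestronglyMeasurable ?_ measurableSet_Iic
      exact ContinuousOn.div (by fun_prop) (by fun_prop) (fun ξ h => mul_ne_zero (mul_ne_zero Complex.I_ne_zero hx') (pow_ne_zero _ (hne ξ h)))
    · refine (ae_restrict_iff' measurableSet_Iic).2 (Eventually.of_forall fun ξ h => le_of_eq ?_)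
      have hh : ‖(ξ:ℂ) - l‖ = l - ξ := by
        rw [← Complex.ofReal_sub, Complex.norm_real, Real.norm_eq_abs, abs_of_neg (by simp at h; linarith)]; ring
      have hp : 0 < l - ξ := by simp at h; linarith
      rw [norm_div, hexp, norm_mul, norm_mul, norm_pow, hh, Complex.norm_I, Complex.norm_real, Real.norm_eq_abs, one_mul, Real.rpow_neg hp.le]
      norm_num
      ring
  have hz : Tendsto (fun R : ℝ => Complex.exp (Complex.I * x * (-R : ℝ)) /
      (Complex.I * x * ((-R : ℝ) - l))) atTop (𝓝 0) := by
    rw [tendsto_zero_iff_norm_tendsto_zero]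
    have : Tendsto (fun R : ℝ => (1/|x|) * (R + l)⁻¹) atTop (𝓝 0) := by
      have := ((tendsto_atTop_add_const_right atTop l tendsto_id).inv_tendsto_atTop).const_mul (1/|x|)
      simpa using this
    refine this.congr' ?_
    filter_upwards [eventually_ge_atTop 0] with R hR
    have hh : ‖((-R:ℝ):ℂ) - l‖ = R + l := by
      rw [← Complex.ofReal_sub, Complex.norm_real, Real.norm_eq_abs, abs_of_neg (by linarith)]; ring
    rw [norm_div, hexp, norm_mul, norm_mul, hh, Complex.norm_I, Complex.norm_real, Real.norm_eq_abs, one_mul, one_div, one_div, mul_inv]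
  refine ⟨_, Tendsto.congr' ?_ ((tendsto_const_nhds (x := 1 / (Complex.I * x * (-l)))).sub hz |>.add
    (intervalIntegral_tendsto_integral_Iic 0 hi tendsto_neg_atTop_atBot))⟩
  filter_upwards [eventually_ge_atTop 0] with R hR using (key R hR).symm

/-- The kernel `G_{l ± 0i}(x) = ± i e^{i l x} χ_{ℝ^±}(x) - kernelTilde l x` for `l > 0`.
The sign `σ` is `1` for `l + 0i` and `-1` for `l - 0i`. -/
def kernel (σ : ℤˣ) (l x : ℝ) : ℂ :=
  ((σ : ℤ) : ℂ) * Complex.I * planeWave l x * indicator {y : ℝ | 0 < ((σ : ℤ) : ℝ) * y} 1 x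
    - kernelTilde l x

/-- The operator `T_{l ± 0i} φ = G_{l ± 0i} * (u φ)`. -/
def jostOp (u : ℝ → ℝ) (σ : ℤˣ) (l : ℝ) (φ : ℝ → ℂ) : ℝ → ℂ :=
  convolution (kernel σ l) (fun y => (u y : ℂ) * φ y) (ContinuousLinearMap.mul ℝ ℂ) volume

/-- `m` solves the integral equation `m = 1 + G_{l ± 0i} * (u m)` of the Jost function
`m₁(l ± 0i)`. -/
def IsJostOne {p : ℝ≥0∞} {r : ℝ} (u : ℝ → ℝ) (σ : ℤˣ) (l : ℝ) (m : WeightedLp p r) : Prop :=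
  ∀ᵐ x : ℝ, m x = 1 + jostOp u σ l m x

/-- `m` solves the integral equation `m = 𝐞(l) + G_{l ± 0i} * (u m)` of the Jost function
`m_e(l ± 0i)`. -/
def IsJostExp {p : ℝ≥0∞} {r : ℝ} (u : ℝ → ℝ) (σ : ℤˣ) (l : ℝ) (m : WeightedLp p r) : Prop :=
  ∀ᵐ x : ℝ, m x = planeWave l x + jostOp u σ l m x

/-- `F ∈ C^{1,γ}_loc(U, E)` for an open set `U` of real numbers: `F` is differentiable on `U` and
its derivative is Hölder continuous of exponent `γ` on every compact subset of `U`. -/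
def IsC1HolderLoc {E : Type*} [NormedAddCommGroup E] [NormedSpace ℝ E]
    (γ : ℝ≥0) (F : ℝ → E) (U : Set ℝ) : Prop :=
  (∀ l ∈ U, DifferentiableAt ℝ F l) ∧
    ∀ K ⊆ U, IsCompact K → ∃ C : ℝ≥0, HolderOnWith C γ (deriv F) K

end BO

end

noncomputable section

namespace BO

/-! ### The regularised kernel -/

/-! Put r = s - s₁ and n(x) = w(x)^{-r} e^{-ilx} m(x). Both Jost equations become n = p_t + S_l n on
bounded continuous functions. Here S_l multiplies by v = u w^r, convolves with the twisted kernel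
e^{-ilx} G_{l±0i}(x) and multiplies by w^{-r}. The inhomogeneity is p_t = w^{-r} e^{-itx}, with t =
0 for m_e and t = l for m_1 (`jost_equation_iff`).

Derivative. The twist turns the integral in the kernel into -(1/2π) ∫_l^∞ e^{-itx}/t dt, so l enters
only through an endpoint (`planeWave_mul_kernelTilde_sub`). The l-derivative of the twisted kernel
is -e^{-ilx}/(2πl). Evaluated at x - y it factorises, so S_l has the rank-one derivative D_l φ =
-(1/2πl) (∫ e^{ily} v φ) p_l (`hasDerivAt_twistedOperator`). Hence (1 - S_l)⁻¹ p_0 has derivative (1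
- S_l)⁻¹ D_l (1 - S_l)⁻¹ p_0, which is -(1/2πl) (∫ u m_e) times (1 - S_l)⁻¹ p_l: the stated multiple
of the conjugated m_1. Hölder continuity is inherited from D (`locHolder_deriv_resolventApply`).

Invertibility. S_l is compact by an Arzelà–Ascoli argument (`exists_compact_convolution_operator`),
so by the Fredholm alternative it suffices that m = G * (u m) forces m = 0
(`eq_zero_of_homogeneous`). Let f = u m; then conj(f) m = u |m|² is real. The kernel G is a
Hermitian kernel H plus ±(i/2) e^{ilz}, so the imaginary part of ∫ conj(f) (G * f) is ±|f̂(l)|²/2,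
and f̂(l) = 0. Thus F = e^{-ily} f has mean zero, and m = H * f = E - G̃ * f, where E is i e^{ilx}
times the decaying primitive of F. This formula lets decay of m be bootstrapped until |y| f is
integrable.

The commutator of H with multiplication by x then gives 2π ‖E‖² = J - |f̂(0)|²/l, where J is the
integral of |f̂(ξ)|²/(ξ - l)² over ξ ≤ 0 (`integral_norm_prim_sq_le`). But Ê = f̂/(ξ - l) for ξ ≤ 0,
so G̃ * f is the negative-frequency part of E, of squared norm J/2π, and m is the rest: ‖m‖² = ‖E‖²
- J/2π ≤ 0 (`hermKernel_conv_eq_zero`). A Bessel inequality and frequency truncation replace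
Plancherel's theorem in this step. -/

lemma norm_exp_I_mul_ofReal (t : ℝ) : ‖Complex.exp (Complex.I * t)‖ = 1 := by
  rw [mul_comm, Complex.norm_exp_ofReal_mul_I]

lemma norm_exp_I_mul_mul (x ξ : ℝ) : ‖Complex.exp (Complex.I * x * ξ)‖ = 1 :=
  norm_planeWave x ξ

/-- Interpolation between the bounds |t| and 2. With γ = 3/4 it controls the kernel near the origin;
with a small γ it yields the Hölder continuity in the spectral parameter. -/
lemma norm_exp_I_mul_sub_one_le_rpow {γ : ℝ} (h0 : 0 ≤ γ) (h1 : γ ≤ 1) (t : ℝ) :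
    ‖Complex.exp (Complex.I * t) - 1‖ ≤ 2 * |t| ^ γ := by
  rcases le_total |t| 1 with h | h
  · have h2 : |t| ^ (1 : ℝ) ≤ |t| ^ γ := by
      rcases (abs_nonneg t).eq_or_lt with h3 | h3
      · rw [← h3, Real.zero_rpow one_ne_zero]; positivity
      · exact Real.rpow_le_rpow_of_exponent_ge h3 h h1
    have h3 := Real.norm_exp_I_mul_ofReal_sub_one_le (x := t)
    rw [Real.rpow_one] at h2
    rw [Real.norm_eq_abs] at h3
    have : 0 ≤ |t| ^ γ := by positivity
    linarith
  · have h2 : 1 ≤ |t| ^ γ := Real.one_le_rpow h h0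
    have h3 := norm_sub_le (Complex.exp (Complex.I * t)) 1
    rw [norm_exp_I_mul_ofReal, norm_one] at h3
    linarith

lemma norm_ofReal_sub_ofReal_of_le {ξ l : ℝ} (hl : 0 < l) (h : ξ ≤ 0) : ‖(ξ : ℂ) - l‖ = l - ξ := by
  rw [← Complex.ofReal_sub, Complex.norm_real, Real.norm_eq_abs, abs_of_neg (by linarith)]; ring

lemma ofReal_sub_ofReal_ne_zero {ξ l : ℝ} (hl : 0 < l) (h : ξ ≤ 0) : (ξ : ℂ) - l ≠ 0 := by
  rw [← norm_pos_iff, norm_ofReal_sub_ofReal_of_le hl h]; linarith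

lemma integrableOn_sub_rpow {l p : ℝ} (hl : 0 < l) (hp : p < -1) :
    IntegrableOn (fun ξ : ℝ => (l - ξ) ^ p) (Iic 0) := by
  have h1 := integrableOn_Ioi_rpow_of_lt hp hl
  have h2 := (MeasurePreserving.integrableOn_comp_preimage
    (Measure.measurePreserving_sub_left volume l) (Homeomorph.subLeft l).measurableEmbedding
    (f := fun t : ℝ => t ^ p) (s := Ioi l)).2 h1
  have h3 : (fun x => l - x) ⁻¹' Ioi l = Iio 0 := by ext y; simp
  rw [h3] at h2
  exact (integrableOn_Iic_iff_integrableOn_Iio (by simp)).2 h2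

lemma integral_sub_rpow {l p : ℝ} (hl : 0 < l) (hp : p < -1) :
    ∫ ξ in Iic (0 : ℝ), (l - ξ) ^ p = -l ^ (p + 1) / (p + 1) := by
  rw [← integral_Ioi_rpow_of_lt hp hl, integral_Iic_eq_integral_Iio]
  have h3 : (fun x => l - x) ⁻¹' Ioi l = Iio 0 := by ext y; simp
  rw [← h3]
  exact (Measure.measurePreserving_sub_left volume l).setIntegral_preimage_emb
    (Homeomorph.subLeft l).measurableEmbedding (fun t : ℝ => t ^ p) (Ioi l)

/-- The truncation of `kernelTilde` to frequencies in `[-R, 0]`. -/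
def kernelTrunc (l R x : ℝ) : ℂ :=
  (1 / (2 * Real.pi) : ℂ) * ∫ ξ in (-R)..0, Complex.exp (Complex.I * x * ξ) / ((ξ : ℂ) - l)

lemma tendsto_kernelTrunc {l x : ℝ} (hl : 0 < l) (hx : x ≠ 0) :
    Tendsto (fun R => kernelTrunc l R x) atTop (𝓝 (kernelTilde l x)) :=
  (tendsto_nhds_limUnder (exists_tendsto_kernelTilde l x hl hx)).const_mul _

/-! ### Integration by parts in the frequency integral. -/

lemma intervalIntegrable_exp_div {l R : ℝ} (hl : 0 < l) (hR : 0 ≤ R) (x : ℝ) (n : ℕ) (c : ℂ) :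
    IntervalIntegrable (fun ξ : ℝ => (Complex.exp (Complex.I * x * ξ) - c) / ((ξ : ℂ) - l) ^ n)
      volume (-R) 0 := by
  refine ContinuousOn.intervalIntegrable (ContinuousOn.div (by fun_prop) (by fun_prop) ?_)
  intro ξ h
  rw [uIcc_of_le (by linarith)] at h
  exact pow_ne_zero _ (ofReal_sub_ofReal_ne_zero hl h.2)

/-- Integration by parts with e^{ixξ} - 1 as primitive of ix e^{ixξ}. The subtracted 1 removes the
boundary term at ξ = 0 and makes the right side small as x → 0, which is what bounds the local
singularity. -/
lemma mul_integral_exp_div {l R : ℝ} (hl : 0 < l) (hR : 0 ≤ R) (x : ℝ) :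
    Complex.I * x * (∫ ξ in (-R)..0, Complex.exp (Complex.I * x * ξ) / ((ξ : ℂ) - l)) =
      (∫ ξ in (-R)..0, (Complex.exp (Complex.I * x * ξ) - 1) / ((ξ : ℂ) - l) ^ 2) +
        (Complex.exp (Complex.I * x * (-R : ℝ)) - 1) / ((R : ℂ) + l) := by
  have c1 := (intervalIntegrable_exp_div hl hR x 1 0).const_mul (Complex.I * x)
  have c2 := intervalIntegrable_exp_div hl hR x 2 1
  have h := intervalIntegral.integral_eq_sub_of_hasDerivAt (a := -R) (b := 0)
    (f := fun ξ : ℝ => (Complex.exp (Complex.I * x * ξ) - 1) / ((ξ : ℂ) - l)) ?_ (c1.sub c2)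
  · rw [intervalIntegral.integral_sub c1 c2, intervalIntegral.integral_const_mul] at h
    simp only [sub_zero, pow_one] at h
    rw [sub_eq_iff_eq_add] at h
    rw [h]
    have h1 : ((-R : ℝ) : ℂ) - l = -((R : ℂ) + l) := by push_cast; ring
    rw [h1, div_neg]
    simp
    ring
  · intro ξ h
    rw [uIcc_of_le (by linarith)] at h
    have h0 := ofReal_sub_ofReal_ne_zero hl h.2
    have hid : HasDerivAt (fun ξ : ℝ => (ξ : ℂ)) 1 ξ := Complex.ofRealCLM.hasDerivAt
    have h1 := (((hid.const_mul (Complex.I * x)).cexp).sub_const 1).div (hid.sub_const (l : ℂ)) h0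
    refine h1.congr_deriv ?_
    field_simp
    ring

lemma integrableOn_one_div_sq {l : ℝ} (hl : 0 < l) :
    IntegrableOn (fun ξ : ℝ => 1 / (l - ξ) ^ 2) (Iic 0) := by
  refine (integrableOn_sub_rpow hl (p := -2) (by norm_num)).congr_fun (fun ξ hξ => ?_)
    measurableSet_Iic
  have : 0 < l - ξ := by have := mem_Iic.1 hξ; linarith
  simp only [Real.rpow_neg this.le]
  norm_num

lemma integral_one_div_sq {l : ℝ} (hl : 0 < l) :
    ∫ ξ in Iic (0 : ℝ), 1 / (l - ξ) ^ 2 = 1 / l := by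
  have := integral_sub_rpow hl (p := -2) (by norm_num)
  rw [show (-2 : ℝ) + 1 = -1 by norm_num, Real.rpow_neg hl.le, Real.rpow_one] at this
  rw [neg_div_neg_eq, div_one] at this
  rw [one_div, ← this]
  refine setIntegral_congr_fun measurableSet_Iic (fun ξ hξ => ?_)
  have : 0 < l - ξ := by have := mem_Iic.1 hξ; linarith
  simp only [Real.rpow_neg this.le]
  norm_num

lemma integrableOn_exp_div_sq {l : ℝ} (hl : 0 < l) (x : ℝ) :
    IntegrableOn (fun ξ : ℝ => Complex.exp (Complex.I * x * ξ) / ((ξ : ℂ) - l) ^ 2) (Iic 0) := by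
  refine Integrable.mono' (integrableOn_one_div_sq hl) ?_ ?_
  · refine ContinuousOn.aestronglyMeasurable ?_ measurableSet_Iic
    exact ContinuousOn.div (by fun_prop) (by fun_prop)
      (fun ξ h => pow_ne_zero _ (ofReal_sub_ofReal_ne_zero hl h))
  · refine (ae_restrict_iff' measurableSet_Iic).2 (Eventually.of_forall fun ξ h => le_of_eq ?_)
    rw [norm_div, norm_exp_I_mul_mul, norm_pow, norm_ofReal_sub_ofReal_of_le hl h]

lemma integral_one_div_sq_complex {l : ℝ} (hl : 0 < l) :
    ∫ ξ in Iic (0 : ℝ), 1 / ((ξ : ℂ) - l) ^ 2 = 1 / (l : ℂ) := by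
  have h := integral_one_div_sq hl
  have h2 : (∫ ξ in Iic (0 : ℝ), ((1 / (l - ξ) ^ 2 : ℝ) : ℂ)) = ((1 / l : ℝ) : ℂ) := by
    rw [integral_complex_ofReal, h]
  push_cast at h2
  rw [← h2]
  refine integral_congr_ae (Eventually.of_forall fun ξ => ?_)
  simp only
  rw [← neg_sub, neg_sq]

/-- `2 π i x` times the kernel is an absolutely convergent integral. -/
lemma mul_kernelTilde {l x : ℝ} (hl : 0 < l) (hx : x ≠ 0) :
    2 * Real.pi * Complex.I * x * kernelTilde l x =
      (∫ ξ in Iic (0 : ℝ), Complex.exp (Complex.I * x * ξ) / ((ξ : ℂ) - l) ^ 2) - 1 / l := by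
  have h1 : Tendsto (fun R : ℝ => 2 * Real.pi * Complex.I * x * kernelTrunc l R x) atTop
      (𝓝 (2 * Real.pi * Complex.I * x * kernelTilde l x)) :=
    (tendsto_kernelTrunc hl hx).const_mul _
  refine tendsto_nhds_unique h1 ?_
  have hi := integrableOn_exp_div_sq hl x
  have hi0 : IntegrableOn (fun ξ : ℝ => 1 / ((ξ : ℂ) - l) ^ 2) (Iic 0) := by
    simpa using integrableOn_exp_div_sq hl 0
  have h2 := intervalIntegral_tendsto_integral_Iic 0 (hi.sub hi0) tendsto_neg_atTop_atBot
  -- The boundary term at -R is O(1/R), so only the absolutely convergent integral survives the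
  -- limit.
  have h3 : Tendsto (fun R : ℝ => (Complex.exp (Complex.I * x * (-R : ℝ)) - 1) / ((R : ℂ) + l))
      atTop (𝓝 0) := by
    rw [tendsto_zero_iff_norm_tendsto_zero]
    have h4 : Tendsto (fun R : ℝ => 2 * (R + l)⁻¹) atTop (𝓝 0) := by
      simpa using ((tendsto_atTop_add_const_right atTop l tendsto_id).inv_tendsto_atTop).const_mul 2
    refine squeeze_zero' (Eventually.of_forall fun _ => norm_nonneg _) ?_ h4
    filter_upwards [eventually_ge_atTop 0] with R hR
    have h5 : ‖(R : ℂ) + l‖ = R + l := by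
      rw [← Complex.ofReal_add, Complex.norm_real, Real.norm_eq_abs, abs_of_pos (by linarith)]
    rw [norm_div, h5, div_eq_mul_inv]
    gcongr
    refine (norm_sub_le _ _).trans ?_
    rw [norm_exp_I_mul_mul, norm_one]; norm_num
  have h6 := h2.add h3
  simp only [Pi.sub_apply] at h6
  rw [integral_sub hi hi0, integral_one_div_sq_complex hl, add_zero] at h6
  refine h6.congr' ?_
  filter_upwards [eventually_ge_atTop 0] with R hR
  rw [kernelTrunc]
  have h7 := mul_integral_exp_div hl hR x
  rw [show 2 * (Real.pi : ℂ) * Complex.I * x * (1 / (2 * Real.pi) *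
    ∫ ξ in (-R)..0, Complex.exp (Complex.I * x * ξ) / ((ξ : ℂ) - l)) =
    Complex.I * x * ∫ ξ in (-R)..0, Complex.exp (Complex.I * x * ξ) / ((ξ : ℂ) - l) by
      field_simp, h7]
  congr 1
  refine intervalIntegral.integral_congr (fun ξ _ => ?_)
  simp only [sub_div]

/-- The local singularity `|x|^{-1/4}` that dominates the logarithmic one of the kernels. -/
def singularPart (x : ℝ) : ℝ := indicator (Icc (-1) 1) (fun x => |x| ^ (-(1 / 4) : ℝ)) x

lemma singularPart_nonneg (x : ℝ) : 0 ≤ singularPart x :=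
  indicator_nonneg (fun _ _ => by positivity) x

lemma integrable_singularPart_sq : Integrable (fun x => singularPart x ^ 2) := by
  have h0 : IntegrableOn (fun x : ℝ => |x| ^ (-(1 / 2) : ℝ)) (Icc (-1) 1) := by
    have h1 : IntervalIntegrable (fun x : ℝ => |x| ^ (-(1 / 2) : ℝ)) volume 0 1 := by
      refine (intervalIntegral.intervalIntegrable_rpow' (r := -(1/2)) (by norm_num)).congr ?_
      intro x hx
      rw [uIoc_of_le zero_le_one] at hx
      simp only [abs_of_pos hx.1]
    have h2 : IntervalIntegrable (fun x : ℝ => |x| ^ (-(1 / 2) : ℝ)) volume (-1) 0 := by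
      have := h1.comp_sub_left 0
      simpa using this.symm
    rw [integrableOn_Icc_iff_integrableOn_Ioc]
    exact (intervalIntegrable_iff_integrableOn_Ioc_of_le (by norm_num)).1 (h2.trans h1)
  have h3 : (fun x => singularPart x ^ 2) =
      indicator (Icc (-1) 1) (fun x : ℝ => |x| ^ (-(1 / 2) : ℝ)) := by
    ext x
    by_cases hx : x ∈ Icc (-1 : ℝ) 1
    · rw [singularPart, indicator_of_mem hx, indicator_of_mem hx, ← Real.rpow_natCast,
        ← Real.rpow_mul (abs_nonneg x)]
      norm_num
    · rw [singularPart, indicator_of_notMem hx, indicator_of_notMem hx]; norm_num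
  rw [h3]
  exact (integrable_indicator_iff measurableSet_Icc).2 h0

/-- Apply the integrated-by-parts formula twice, uniformly in R. The bound |e^{it} - 1| ≤ 2 gives
|x| T ≤ A, hence decay like 1/|x|; the bound 2|t|^{3/4} gives |x| T ≤ B |x|^{3/4}, hence a
singularity of at most |x|^{-1/4}. The exponent 3/4 leaves (l - ξ)^{-5/4} integrable, and |x|^{-1/4}
is locally square integrable. Uniformity in R serves the dominated convergence of the truncated
convolutions. -/
lemma exists_weight_mul_kernelTrunc_le {l : ℝ} (hl : 0 < l) :
    ∃ C : ℝ, 0 ≤ C ∧ ∀ R x : ℝ, 0 ≤ R → x ≠ 0 →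
      weight x * ‖kernelTrunc l R x‖ ≤ C * (1 + singularPart x) := by
  set B : ℝ := 2 * (∫ ξ in Iic (0 : ℝ), (l - ξ) ^ (-(5 / 4) : ℝ)) + 2 * l ^ (-(1 / 4) : ℝ) with hB
  set A : ℝ := 4 / l with hA
  have hB0 : 0 ≤ B := by
    have : 0 ≤ ∫ ξ in Iic (0 : ℝ), (l - ξ) ^ (-(5 / 4) : ℝ) :=
      setIntegral_nonneg measurableSet_Iic fun ξ hξ => by
        have : 0 < l - ξ := by have := mem_Iic.1 hξ; linarith
        positivity
    positivity
  have hA0 : 0 ≤ A := by positivity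
  have key : ∀ R x : ℝ, 0 ≤ R → ∀ (b : ℝ) (g : ℝ → ℝ), 0 ≤ b → IntegrableOn g (Iic 0) →
      (∀ ξ ≤ 0, 0 ≤ g ξ) → (∀ ξ : ℝ, ξ ≤ 0 → ‖(Complex.exp (Complex.I * x * ξ) - 1) / ((ξ : ℂ) - l) ^ 2‖ ≤ g ξ) →
      ‖(Complex.exp (Complex.I * x * (-R : ℝ)) - 1) / ((R : ℂ) + l)‖ ≤ b →
      |x| * ‖∫ ξ in (-R)..0, Complex.exp (Complex.I * x * ξ) / ((ξ : ℂ) - l)‖ ≤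
        (∫ ξ in Iic (0 : ℝ), g ξ) + b := by
    intro R x hR b g hb hg hg0 h1 h2
    have h3 : |x| * ‖∫ ξ in (-R)..0, Complex.exp (Complex.I * x * ξ) / ((ξ : ℂ) - l)‖ =
      ‖Complex.I * x * (∫ ξ in (-R)..0, Complex.exp (Complex.I * x * ξ) / ((ξ : ℂ) - l))‖ := by
      simp
    rw [h3, mul_integral_exp_div hl hR x]
    refine (norm_add_le _ _).trans (add_le_add ?_ h2)
    have hneg : -R ≤ 0 := by linarith
    have hgR : IntegrableOn g (Ioc (-R) 0) := hg.mono_set Ioc_subset_Iic_self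
    refine (intervalIntegral.norm_integral_le_of_norm_le hneg (g := g)
      (Eventually.of_forall fun ξ h => h1 ξ h.2)
      ((intervalIntegrable_iff_integrableOn_Ioc_of_le hneg).2 hgR)).trans ?_
    rw [intervalIntegral.integral_of_le hneg]
    refine setIntegral_mono_set hg ?_ (Eventually.of_forall Ioc_subset_Iic_self)
    exact (ae_restrict_iff' measurableSet_Iic).2 (Eventually.of_forall fun ξ h => hg0 ξ h)
  have hnl : ∀ R : ℝ, 0 ≤ R → ‖(R : ℂ) + l‖ = R + l := fun R hR => by
    rw [← Complex.ofReal_add, Complex.norm_real, Real.norm_eq_abs, abs_of_pos (by linarith)]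
  have h2' : ∀ x ξ : ℝ, ‖Complex.exp (Complex.I * x * ξ) - 1‖ ≤ 2 := fun x ξ => by
    refine (norm_sub_le _ _).trans ?_
    rw [norm_exp_I_mul_mul, norm_one]; norm_num
  have h34 : ∀ x ξ : ℝ, ‖Complex.exp (Complex.I * x * ξ) - 1‖ ≤
      2 * (|x| ^ (3 / 4 : ℝ) * |ξ| ^ (3 / 4 : ℝ)) := fun x ξ => by
    have := norm_exp_I_mul_sub_one_le_rpow (γ := 3 / 4) (by norm_num) (by norm_num) (x * ξ)
    rwa [abs_mul, Real.mul_rpow (abs_nonneg _) (abs_nonneg _), Complex.ofReal_mul,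
      ← mul_assoc Complex.I] at this
  have hbA : ∀ R x : ℝ, 0 ≤ R →
      |x| * ‖∫ ξ in (-R)..0, Complex.exp (Complex.I * x * ξ) / ((ξ : ℂ) - l)‖ ≤ A := by
    intro R x hR
    have := key R x hR (2 / l) (fun ξ => 2 * (1 / (l - ξ) ^ 2)) (by positivity)
      ((integrableOn_one_div_sq hl).const_mul 2) (fun ξ _ => by positivity) ?_ ?_
    · rw [integral_const_mul, integral_one_div_sq hl] at this
      refine this.trans (le_of_eq ?_)
      rw [hA]; ring
    · intro ξ hξ
      rw [norm_div, norm_pow, norm_ofReal_sub_ofReal_of_le hl hξ, div_eq_mul_one_div]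
      gcongr
      exact h2' x ξ
    · rw [norm_div, hnl R hR]
      exact div_le_div₀ (by norm_num) (h2' x _) hl (by linarith)
  have hbB : ∀ R x : ℝ, 0 ≤ R →
      |x| * ‖∫ ξ in (-R)..0, Complex.exp (Complex.I * x * ξ) / ((ξ : ℂ) - l)‖ ≤
        B * |x| ^ (3 / 4 : ℝ) := by
    intro R x hR
    have := key R x hR (2 * l ^ (-(1 / 4) : ℝ) * |x| ^ (3 / 4 : ℝ))
      (fun ξ => 2 * |x| ^ (3 / 4 : ℝ) * (l - ξ) ^ (-(5 / 4) : ℝ)) (by positivity)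
      ((integrableOn_sub_rpow hl (by norm_num)).const_mul _) (fun ξ h => by
        have : 0 < l - ξ := by linarith
        positivity) ?_ ?_
    · rw [integral_const_mul] at this
      refine this.trans (le_of_eq ?_)
      rw [hB]; ring
    · intro ξ hξ
      have hp : 0 < l - ξ := by linarith
      rw [norm_div, norm_pow, norm_ofReal_sub_ofReal_of_le hl hξ, div_le_iff₀ (by positivity)]
      refine (h34 x ξ).trans ?_
      have h5 : (l - ξ) ^ (-(5 / 4) : ℝ) * (l - ξ) ^ 2 = (l - ξ) ^ (3 / 4 : ℝ) := by
        rw [← Real.rpow_natCast, ← Real.rpow_add hp]; norm_num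
      rw [mul_assoc, mul_assoc, h5]
      gcongr
      rw [abs_of_nonpos hξ]; linarith
    · rw [norm_div, hnl R hR, div_le_iff₀ (by linarith)]
      refine (h34 x _).trans ?_
      have h5 : |(-R)| ^ (3 / 4 : ℝ) ≤ l ^ (-(1 / 4) : ℝ) * (R + l) := by
        rw [abs_neg, abs_of_nonneg hR]
        calc R ^ (3 / 4 : ℝ) ≤ (R + l) ^ (3 / 4 : ℝ) := by
              gcongr; linarith
          _ = (R + l) ^ (-(1 / 4) : ℝ) * (R + l) := by
              rw [← Real.rpow_add_one (by linarith)]; norm_num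
          _ ≤ _ := by
              refine mul_le_mul_of_nonneg_right ?_ (by linarith)
              exact Real.rpow_le_rpow_of_nonpos hl (by linarith) (by norm_num)
      calc _ ≤ 2 * (|x| ^ (3 / 4 : ℝ) * (l ^ (-(1 / 4) : ℝ) * (R + l))) := by gcongr
        _ = _ := by ring
  refine ⟨(1 / (2 * Real.pi)) * (2 * A + B), by positivity, fun R x hR hx => ?_⟩
  set T := ‖∫ ξ in (-R)..0, Complex.exp (Complex.I * x * ξ) / ((ξ : ℂ) - l)‖ with hT
  have hT0 : 0 ≤ T := norm_nonneg _
  have hk : ‖kernelTrunc l R x‖ = (1 / (2 * Real.pi)) * T := by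
    rw [kernelTrunc, norm_mul]
    congr 1
    simp [abs_of_pos Real.pi_pos]
  have h1 := hbA R x hR
  have h2 := hbB R x hR
  rw [← hT] at h1 h2
  have hx0 : 0 < |x| := abs_pos.2 hx
  have hs := singularPart_nonneg x
  have h3 : weight x * T ≤ (2 * A + B) * (1 + singularPart x) := by
    have hw : weight x * T = T + |x| * T := by rw [weight]; ring
    rw [hw]
    rcases le_total 1 |x| with h | h
    · have : T ≤ |x| * T := by nlinarith
      nlinarith [mul_nonneg hA0 hs, mul_nonneg hB0 hs]
    · have hs' : singularPart x = |x| ^ (-(1 / 4) : ℝ) :=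
        indicator_of_mem (mem_Icc.2 (abs_le.1 h)) _
      have h4 : |x| ^ (3 / 4 : ℝ) = |x| * singularPart x := by
        rw [hs', mul_comm, ← Real.rpow_add_one hx0.ne']; norm_num
      rw [h4] at h2
      have h5 : T ≤ B * singularPart x := by
        refine le_of_mul_le_mul_left (h2.trans (le_of_eq ?_)) hx0
        ring
      nlinarith [mul_nonneg hA0 hs, mul_nonneg hB0 hs]
  calc weight x * ‖kernelTrunc l R x‖ = (1 / (2 * Real.pi)) * (weight x * T) := by rw [hk]; ring
    _ ≤ (1 / (2 * Real.pi)) * ((2 * A + B) * (1 + singularPart x)) := by gcongr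
    _ = _ := by ring

lemma exists_weight_mul_kernelTilde_le {l : ℝ} (hl : 0 < l) :
    ∃ C : ℝ, 0 ≤ C ∧ ∀ x : ℝ, x ≠ 0 →
      weight x * ‖kernelTilde l x‖ ≤ C * (1 + singularPart x) := by
  obtain ⟨C, hC, h⟩ := exists_weight_mul_kernelTrunc_le hl
  refine ⟨C, hC, fun x hx => ?_⟩
  refine le_of_tendsto ((tendsto_kernelTrunc hl hx).norm.const_mul (weight x)) ?_
  filter_upwards [eventually_ge_atTop 0] with R hR using h R x hR hx

lemma continuous_integral_exp_div_sq {l : ℝ} (hl : 0 < l) :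
    Continuous fun x : ℝ =>
      ∫ ξ in Iic (0 : ℝ), Complex.exp (Complex.I * x * ξ) / ((ξ : ℂ) - l) ^ 2 := by
  refine continuous_of_dominated (fun x => (integrableOn_exp_div_sq hl x).1)
    (bound := fun ξ => 1 / (l - ξ) ^ 2) (fun x => ?_) (integrableOn_one_div_sq hl) ?_
  · refine (ae_restrict_iff' measurableSet_Iic).2 (Eventually.of_forall fun ξ h => le_of_eq ?_)
    rw [norm_div, norm_exp_I_mul_mul, norm_pow, norm_ofReal_sub_ofReal_of_le hl h]
  · exact Eventually.of_forall fun ξ => by fun_prop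

/-- The definition through `limUnder` is unsuited to measurability; off the origin the kernel is a
continuous function of x divided by 2πix, and its value at 0 is irrelevant. -/
lemma measurable_kernelTilde {l : ℝ} (hl : 0 < l) : Measurable (kernelTilde l) := by
  have h : kernelTilde l = fun x : ℝ => if x = 0 then kernelTilde l 0 else
      (2 * Real.pi * Complex.I * x : ℂ)⁻¹ *
        ((∫ ξ in Iic (0 : ℝ), Complex.exp (Complex.I * x * ξ) / ((ξ : ℂ) - l) ^ 2) - 1 / l) := by
    ext x
    split_ifs with hx
    · rw [hx]
    · have hpi : (Real.pi : ℂ) ≠ 0 := by exact_mod_cast Real.pi_ne_zero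
      have hx' : (x : ℂ) ≠ 0 := by exact_mod_cast hx
      rw [← mul_kernelTilde hl hx, inv_mul_cancel_left₀]
      exact mul_ne_zero (mul_ne_zero (mul_ne_zero two_ne_zero hpi) Complex.I_ne_zero) hx'
  rw [h]
  refine Measurable.ite (measurableSet_singleton 0) measurable_const (Measurable.mul ?_ ?_)
  · exact (by fun_prop : Measurable fun x : ℝ => (2 * Real.pi * Complex.I * x : ℂ)).inv
  · exact (continuous_integral_exp_div_sq hl).measurable.sub_const _

/-! ### Reflection symmetry and continuity of the truncated kernel. -/

lemma kernelTrunc_neg (l R x : ℝ) :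
    kernelTrunc l R (-x) = (starRingEnd ℂ) (kernelTrunc l R x) := by
  rw [kernelTrunc, kernelTrunc, map_mul, ← intervalIntegral.intervalIntegral_conj]
  congr 1
  · rw [map_div₀, map_mul, map_one, Complex.conj_ofReal, map_ofNat]
  · refine intervalIntegral.integral_congr (fun ξ _ => ?_)
    simp [← Complex.exp_conj]

lemma kernelTilde_neg {l x : ℝ} (hl : 0 < l) (hx : x ≠ 0) :
    kernelTilde l (-x) = (starRingEnd ℂ) (kernelTilde l x) := by
  refine tendsto_nhds_unique (tendsto_kernelTrunc hl (neg_ne_zero.2 hx)) ?_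
  simp only [kernelTrunc_neg]
  exact (Complex.continuous_conj.tendsto _).comp (tendsto_kernelTrunc hl hx)

lemma continuous_kernelTrunc {l R : ℝ} (hl : 0 < l) (hR : 0 ≤ R) : Continuous (kernelTrunc l R) := by
  refine Continuous.mul continuous_const ?_
  simp only [intervalIntegral.integral_of_le (show -R ≤ 0 by linarith)]
  refine continuous_of_dominated (bound := fun ξ => 1 / l) (fun x => ?_) (fun x => ?_)
    (integrable_const _) ?_
  · refine ContinuousOn.aestronglyMeasurable ?_ measurableSet_Ioc
    exact ContinuousOn.div (by fun_prop) (by fun_prop)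
      (fun ξ h => ofReal_sub_ofReal_ne_zero hl h.2)
  · refine (ae_restrict_iff' measurableSet_Ioc).2 (Eventually.of_forall fun ξ h => ?_)
    rw [norm_div, norm_exp_I_mul_mul, norm_ofReal_sub_ofReal_of_le hl h.2]
    have := h.2
    exact one_div_le_one_div_of_le hl (by linarith)
  · exact Eventually.of_forall fun ξ => by fun_prop

/-! ### Conjugation of the kernel by plane waves. -/

lemma planeWave_neg (l x : ℝ) : planeWave (-l) x = (starRingEnd ℂ) (planeWave l x) := by
  simp [planeWave, ← Complex.exp_conj]

lemma planeWave_add (l μ x : ℝ) : planeWave (l + μ) x = planeWave l x * planeWave μ x := by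
  simp only [planeWave, ← Complex.exp_add]
  congr 1
  push_cast
  ring

lemma planeWave_sub_right (l x y : ℝ) :
    planeWave l (x - y) = planeWave l x * planeWave (-l) y := by
  simp only [planeWave, ← Complex.exp_add]
  congr 1
  push_cast
  ring

lemma planeWave_neg_mul_self (l x : ℝ) : planeWave (-l) x * planeWave l x = 1 := by
  rw [← planeWave_add]
  simp [planeWave]

lemma continuousOn_planeWave_div (x : ℝ) :
    ContinuousOn (fun t : ℝ => planeWave (-t) x / t) (Ioi 0) := by
  unfold planeWave
  exact ContinuousOn.div (by fun_prop) (by fun_prop)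
    (fun t ht => by exact_mod_cast (mem_Ioi.1 ht).ne')

/-- Conjugated by the plane waves, the kernels depend on the spectral parameter only through a
smooth kernel. -/
lemma planeWave_mul_kernelTilde_sub {l μ x : ℝ} (hl : 0 < l) (hμ : 0 < μ) (hx : x ≠ 0) :
    planeWave (-l) x * kernelTilde l x - planeWave (-μ) x * kernelTilde μ x =
      (1 / (2 * Real.pi) : ℂ) * ∫ t in μ..l, planeWave (-t) x / t := by
  set g : ℝ → ℂ := fun t => planeWave (-t) x / t with hg
  have hgi : ∀ a b : ℝ, 0 < a → 0 < b → IntervalIntegrable g volume a b := fun a b ha hb => by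
    refine ((continuousOn_planeWave_div x).mono ?_).intervalIntegrable
    exact fun t ht => lt_of_lt_of_le (lt_min ha hb) ht.1
  -- Substitution t = l - ξ: the integrand no longer depends on l.
  have h1 : ∀ l R : ℝ, planeWave (-l) x * kernelTrunc l R x =
      (1 / (2 * Real.pi) : ℂ) * -∫ t in l..(l + R), g t := by
    intro l R
    have h2 := intervalIntegral.integral_comp_sub_left g l (a := -R) (b := 0)
    rw [sub_zero, sub_neg_eq_add] at h2
    rw [← h2, kernelTrunc, mul_left_comm, ← intervalIntegral.integral_const_mul,
      ← intervalIntegral.integral_neg]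
    congr 1
    refine intervalIntegral.integral_congr (fun ξ _ => ?_)
    simp only [hg, planeWave]
    rw [← mul_div_assoc, ← Complex.exp_add, ← neg_sub (l : ℂ) ξ, div_neg, Complex.ofReal_sub]
    congr 3
    push_cast
    ring
  -- The two far endpoints enclose an interval of fixed length |l - μ| on which the integrand is at
  -- most 1/R.
  have h3 : Tendsto (fun R : ℝ => ∫ t in (μ + R)..(l + R), g t) atTop (𝓝 0) := by
    have h4 : Tendsto (fun R : ℝ => R⁻¹ * |l - μ|) atTop (𝓝 0) := by
      simpa using tendsto_inv_atTop_zero.mul_const |l - μ|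
    refine squeeze_zero_norm' ?_ h4
    filter_upwards [eventually_gt_atTop 0] with R hR
    have h5 := intervalIntegral.norm_integral_le_of_norm_le_const (a := μ + R) (b := l + R) (f := g)
      (C := R⁻¹) fun t ht => by
        have ht' : R < t := by
          have h6 : min (μ + R) (l + R) < t := ht.1
          have h7 : R < min (μ + R) (l + R) := lt_min (by linarith) (by linarith)
          exact h7.trans h6
        rw [hg, norm_div, norm_planeWave, Complex.norm_real, Real.norm_eq_abs,
          abs_of_pos (hR.trans ht'), one_div]
        exact inv_anti₀ hR ht'.le
    simpa using h5
  have h8 : Tendsto (fun R : ℝ => planeWave (-l) x * kernelTrunc l R x -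
      planeWave (-μ) x * kernelTrunc μ R x) atTop
      (𝓝 ((1 / (2 * Real.pi) : ℂ) * ((∫ t in μ..l, g t) - 0))) := by
    refine ((tendsto_const_nhds.sub h3).const_mul _).congr' ?_
    filter_upwards [eventually_gt_atTop 0] with R hR
    rw [h1, h1, ← intervalIntegral.integral_interval_sub_interval_comm
      (hgi _ _ hμ (by linarith)) (hgi _ _ hl (by linarith)) (hgi _ _ hμ hl)]
    ring
  rw [sub_zero] at h8
  exact tendsto_nhds_unique
    (((tendsto_kernelTrunc hl hx).const_mul _).sub ((tendsto_kernelTrunc hμ hx).const_mul _)) h8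

/-! ### Weights and weighted integrability -/

lemma one_le_weight (x : ℝ) : 1 ≤ weight x := by
  unfold weight; linarith [abs_nonneg x]

lemma continuous_weight : Continuous weight := by
  unfold weight; fun_prop

lemma continuous_weight_rpow (b : ℝ) : Continuous fun x => weight x ^ b :=
  continuous_weight.rpow_const fun x => Or.inl (weight_pos x).ne'

lemma weight_rpow_pos (b x : ℝ) : 0 < weight x ^ b := Real.rpow_pos_of_pos (weight_pos x) b

lemma weight_le_mul (x y : ℝ) : weight x ≤ weight (x - y) * weight y := by
  have h : |x| ≤ |x - y| + |y| := by simpa using abs_add_le (x - y) y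
  unfold weight
  nlinarith [mul_nonneg (abs_nonneg (x - y)) (abs_nonneg y)]

lemma weight_mono {x y : ℝ} (h : |x| ≤ |y|) : weight x ≤ weight y := by
  unfold weight; linarith

lemma integrable_weight_rpow {c : ℝ} (hc : c < -1) : Integrable fun x => weight x ^ c := by
  have := integrable_one_add_norm (E := ℝ) (μ := volume) (r := -c) (by simp; linarith)
  simpa [weight] using this

lemma weight_rpow_le_rpow {b c : ℝ} (h : b ≤ c) (x : ℝ) : weight x ^ b ≤ weight x ^ c :=
  Real.rpow_le_rpow_of_exponent_le (one_le_weight x) h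

namespace MemWeightedLp

variable {E : Type*} [NormedAddCommGroup E] [NormedSpace ℝ E] {f : ℝ → E} {s b : ℝ}

lemma aestronglyMeasurable {p : ℝ≥0∞} (hf : MemWeightedLp f p s) :
    AEStronglyMeasurable f volume := by
  have h := (continuous_weight_rpow (-s)).aestronglyMeasurable (μ := volume).smul hf.1
  refine h.congr (Eventually.of_forall fun x => ?_)
  simp only [Pi.smul_apply', smul_smul]
  rw [← Real.rpow_add (weight_pos x), neg_add_cancel, Real.rpow_zero, one_smul]

lemma integrable_sq (hf : MemWeightedLp f 2 s) (hb : b ≤ s) :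
    Integrable fun x => (weight x ^ b * ‖f x‖) ^ 2 := by
  have h := (memLp_two_iff_integrable_sq_norm hf.1).1 hf
  refine Integrable.mono' h ?_ (Eventually.of_forall fun x => ?_)
  · exact ((continuous_weight_rpow b).aestronglyMeasurable.mul hf.aestronglyMeasurable.norm).pow 2
  · have h0 := weight_rpow_pos b x
    have h1 := weight_rpow_pos s x
    rw [Real.norm_eq_abs, abs_of_nonneg (by positivity), norm_smul, Real.norm_eq_abs,
      abs_of_pos h1]
    gcongr
    exact one_le_weight x

/-- Write w^b |f| = w^{b-s} · w^s |f| and bound the product by the sum of the squares; w^{2(b-s)} is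
integrable exactly because b < s - 1/2. This is the origin of the threshold 1/2. -/
lemma integrable_weight_mul (hf : MemWeightedLp f 2 s) (hb : b < s - 1 / 2) :
    Integrable fun x => weight x ^ b * ‖f x‖ := by
  have h := (hf.integrable_sq le_rfl).add (integrable_weight_rpow (c := 2 * (b - s)) (by linarith))
  refine Integrable.mono' h ?_ (Eventually.of_forall fun x => ?_)
  · exact (continuous_weight_rpow b).aestronglyMeasurable.mul hf.aestronglyMeasurable.norm
  · have h0 := weight_rpow_pos (b - s) x
    have h1 := weight_rpow_pos s x
    have h2 : weight x ^ b = weight x ^ (b - s) * weight x ^ s := by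
      rw [← Real.rpow_add (weight_pos x)]; ring_nf
    have h3 : weight x ^ (2 * (b - s)) = (weight x ^ (b - s)) ^ 2 := by
      rw [mul_comm, Real.rpow_mul (weight_pos x).le]; norm_num
    rw [Real.norm_eq_abs, abs_of_nonneg (mul_nonneg (weight_rpow_pos b x).le (norm_nonneg _)),
      Pi.add_apply, h3, h2]
    have hn := norm_nonneg (f x)
    nlinarith [sq_nonneg (weight x ^ (b - s) - weight x ^ s * ‖f x‖), mul_nonneg h1.le hn,
      mul_nonneg h0.le (mul_nonneg h1.le hn)]

end MemWeightedLp

/-! ### Convolution with kernels that have an integrable-square singularity -/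

/-- `N` is measurable and dominated by `C (1 + |x|^{-1/4} χ_{|x| ≤ 1})` away from the origin. -/
structure IsKernelBound (N : ℝ → ℂ) (C : ℝ) : Prop where
  measurable : Measurable N
  nonneg : 0 ≤ C
  norm_le : ∀ z, z ≠ 0 → ‖N z‖ ≤ C * (1 + singularPart z)

/-- The bound for the convolution of a function with a kernel satisfying `IsKernelBound N 1`. -/
def convBound (h : ℝ → ℂ) : ℝ :=
  (∫ y, ‖h y‖) + ((∫ y, singularPart y ^ 2) + ∫ y, ‖h y‖ ^ 2)

namespace IsKernelBound

variable {N : ℝ → ℂ} {C : ℝ}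

lemma aestronglyMeasurable_prod (hN : IsKernelBound N C) :
    AEStronglyMeasurable (fun p : ℝ × ℝ => N (p.1 - p.2)) (volume.prod volume) :=
  (hN.measurable.comp (measurable_fst.sub measurable_snd)).aestronglyMeasurable

lemma integrable_dom {h : ℝ → ℂ} (h1 : Integrable h) (h2 : Integrable fun y => ‖h y‖ ^ 2) (x : ℝ) :
    Integrable (fun y => ‖h y‖ + (singularPart (x - y) ^ 2 + ‖h y‖ ^ 2)) ∧
      ∫ y, (‖h y‖ + (singularPart (x - y) ^ 2 + ‖h y‖ ^ 2)) = convBound h := by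
  have h3 := integrable_singularPart_sq.comp_sub_left x
  refine ⟨h1.norm.add (h3.add h2), ?_⟩
  have e1 := integral_add h1.norm (h3.add h2)
  have e2 := integral_add h3 h2
  simp only [Pi.add_apply] at e1
  rw [e1, e2, integral_sub_left_eq_self (fun y => singularPart y ^ 2), convBound]

/-- The singular factor is split off by ab ≤ a² + b². The integral of the majorant does not depend
on x by translation invariance, so all resulting bounds are uniform in x. -/
lemma norm_mul_le (hN : IsKernelBound N C) (h : ℝ → ℂ) {x y : ℝ} (hxy : y ≠ x) :
    ‖N (x - y)‖ * ‖h y‖ ≤ C * (‖h y‖ + (singularPart (x - y) ^ 2 + ‖h y‖ ^ 2)) := by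
  have h1 := hN.norm_le (x - y) (sub_ne_zero.2 hxy.symm)
  have h2 := singularPart_nonneg (x - y)
  have h3 := norm_nonneg (h y)
  calc ‖N (x - y)‖ * ‖h y‖ ≤ C * (1 + singularPart (x - y)) * ‖h y‖ := by gcongr
    _ = C * ((1 + singularPart (x - y)) * ‖h y‖) := by ring
    _ ≤ _ := by
      refine mul_le_mul_of_nonneg_left ?_ hN.nonneg
      nlinarith [sq_nonneg (singularPart (x - y) - ‖h y‖), mul_nonneg h2 h3]

lemma ae_norm_mul_le (hN : IsKernelBound N C) (h : ℝ → ℂ) (x : ℝ) :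
    ∀ᵐ y, ‖N (x - y)‖ * ‖h y‖ ≤ C * (‖h y‖ + (singularPart (x - y) ^ 2 + ‖h y‖ ^ 2)) := by
  filter_upwards [Measure.ae_ne volume x] with y hy using hN.norm_mul_le h hy

lemma integrable (hN : IsKernelBound N C) {h : ℝ → ℂ} (h1 : Integrable h)
    (h2 : Integrable fun y => ‖h y‖ ^ 2) (x : ℝ) : Integrable fun y => N (x - y) * h y := by
  refine Integrable.mono' ((integrable_dom h1 h2 x).1.const_mul C) ?_ ?_
  · exact (hN.measurable.comp (measurable_const.sub measurable_id)).aestronglyMeasurable.mul h1.1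
  · filter_upwards [hN.ae_norm_mul_le h x] with y hy
    rwa [norm_mul]

lemma integral_norm_le (hN : IsKernelBound N C) {h : ℝ → ℂ} (h1 : Integrable h)
    (h2 : Integrable fun y => ‖h y‖ ^ 2) (x : ℝ) :
    ∫ y, ‖N (x - y)‖ * ‖h y‖ ≤ C * convBound h := by
  rw [← (integrable_dom h1 h2 x).2, ← integral_const_mul]
  refine integral_mono_ae ?_ ((integrable_dom h1 h2 x).1.const_mul C) (hN.ae_norm_mul_le h x)
  simpa only [norm_mul] using (hN.integrable h1 h2 x).norm

lemma norm_integral_le (hN : IsKernelBound N C) {h : ℝ → ℂ} (h1 : Integrable h)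
    (h2 : Integrable fun y => ‖h y‖ ^ 2) (x : ℝ) : ‖∫ y, N (x - y) * h y‖ ≤ C * convBound h := by
  refine (norm_integral_le_integral_norm _).trans ?_
  simpa only [norm_mul] using hN.integral_norm_le h1 h2 x

/-- Joint integrability of `a(x) N(x-y) h(y)`. -/
lemma integrable_prod (hN : IsKernelBound N C) {a h : ℝ → ℂ} (ha : Integrable a)
    (h1 : Integrable h) (h2 : Integrable fun y => ‖h y‖ ^ 2) :
    Integrable (fun p : ℝ × ℝ => a p.1 * (N (p.1 - p.2) * h p.2)) (volume.prod volume) := by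
  have hm : AEStronglyMeasurable (fun p : ℝ × ℝ => a p.1 * (N (p.1 - p.2) * h p.2))
      (volume.prod volume) :=
    ha.1.comp_fst.mul (hN.aestronglyMeasurable_prod.mul h1.1.comp_snd)
  refine (integrable_prod_iff hm).2 ⟨Eventually.of_forall fun x =>
    (hN.integrable h1 h2 x).const_mul (a x), ?_⟩
  refine Integrable.mono' (ha.norm.mul_const (C * convBound h)) hm.norm.integral_prod_right'
    (Eventually.of_forall fun x => ?_)
  rw [Real.norm_eq_abs, abs_of_nonneg (integral_nonneg fun _ => norm_nonneg _)]
  simp only [norm_mul]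
  rw [integral_const_mul]
  exact mul_le_mul_of_nonneg_left (hN.integral_norm_le h1 h2 x) (norm_nonneg _)

end IsKernelBound

/-! ### The kernels of the Jost equations -/

lemma norm_units_int (σ : ℤˣ) : ‖((σ : ℤ) : ℂ)‖ = 1 := by
  rcases Int.units_eq_one_or σ with h | h <;> simp [h]

lemma exists_isKernelBound_weight_mul_kernelTilde {l : ℝ} (hl : 0 < l) :
    ∃ C, IsKernelBound (fun z => (weight z : ℂ) * kernelTilde l z) C := by
  obtain ⟨C, hC, h⟩ := exists_weight_mul_kernelTilde_le hl
  refine ⟨C, ⟨?_, hC, fun z hz => ?_⟩⟩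
  · exact (Complex.measurable_ofReal.comp continuous_weight.measurable).mul
      (measurable_kernelTilde hl)
  · rw [norm_mul, Complex.norm_real, Real.norm_eq_abs, abs_of_pos (weight_pos z)]
    exact h z hz

lemma exists_isKernelBound_kernelTilde {l : ℝ} (hl : 0 < l) :
    ∃ C, IsKernelBound (kernelTilde l) C := by
  obtain ⟨C, h⟩ := exists_isKernelBound_weight_mul_kernelTilde hl
  refine ⟨C, ⟨measurable_kernelTilde hl, h.nonneg, fun z hz => le_trans ?_ (h.norm_le z hz)⟩⟩
  rw [norm_mul, Complex.norm_real, Real.norm_eq_abs, abs_of_pos (weight_pos z)]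
  exact le_mul_of_one_le_left (norm_nonneg _) (one_le_weight z)

lemma exists_isKernelBound_kernelTrunc {l : ℝ} (hl : 0 < l) :
    ∃ C, ∀ R, 0 ≤ R → IsKernelBound (kernelTrunc l R) C := by
  obtain ⟨C, hC, h⟩ := exists_weight_mul_kernelTrunc_le hl
  refine ⟨C, fun R hR => ⟨(continuous_kernelTrunc hl hR).measurable, hC, fun z hz =>
    le_trans ?_ (h R z hR hz)⟩⟩
  exact le_mul_of_one_le_left (norm_nonneg _) (one_le_weight z)

/-- The jump `± i χ_{ℝ^±}` of the kernels `G_{l ± 0i}`, conjugated by the plane wave. -/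
def kernelJump (σ : ℤˣ) (x : ℝ) : ℂ :=
  ((σ : ℤ) : ℂ) * Complex.I * indicator {y : ℝ | 0 < ((σ : ℤ) : ℝ) * y} 1 x

lemma norm_kernelJump_le (σ : ℤˣ) (x : ℝ) : ‖kernelJump σ x‖ ≤ 1 := by
  rw [kernelJump, norm_mul, norm_mul, norm_units_int, Complex.norm_I, one_mul, one_mul]
  refine (norm_indicator_le_norm_self _ _).trans ?_
  simp

lemma measurable_kernelJump (σ : ℤˣ) : Measurable (kernelJump σ) :=
  (measurable_one.indicator (measurableSet_lt measurable_const (by fun_prop))).const_mul _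

lemma kernel_eq (σ : ℤˣ) (l x : ℝ) :
    kernel σ l x = kernelJump σ x * planeWave l x - kernelTilde l x := by
  rw [kernel, kernelJump]; ring

lemma exists_isKernelBound_kernel {l : ℝ} (hl : 0 < l) :
    ∃ C, ∀ σ, IsKernelBound (kernel σ l) C := by
  obtain ⟨C, h⟩ := exists_isKernelBound_kernelTilde hl
  refine ⟨C + 1, fun σ => ⟨?_, by linarith [h.nonneg], fun z hz => ?_⟩⟩
  · have : kernel σ l = fun x => kernelJump σ x * planeWave l x - kernelTilde l x :=
      funext (kernel_eq σ l)
    rw [this]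
    exact ((measurable_kernelJump σ).mul (continuous_planeWave l).measurable).sub h.measurable
  · rw [kernel_eq]
    refine (norm_sub_le _ _).trans ?_
    rw [norm_mul, norm_planeWave, mul_one]
    have h1 := norm_kernelJump_le σ z
    have h2 := h.norm_le z hz
    nlinarith [singularPart_nonneg z]

/-! ### Fubini for bounded kernels, Hermitian kernels -/

section Fubini

variable {μ ν : Measure ℝ}

lemma integrable_prod_of_bounded {a b : ℝ → ℂ} (ha : Integrable a μ) (hb : Integrable b ν)
    {M : ℝ → ℝ → ℂ} (hM : AEStronglyMeasurable (fun p : ℝ × ℝ => M p.1 p.2) (μ.prod ν))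
    {C : ℝ} (hC : ∀ x y, ‖M x y‖ ≤ C) :
    Integrable (fun p : ℝ × ℝ => M p.1 p.2 * (a p.1 * b p.2)) (μ.prod ν) :=
  (ha.mul_prod hb).bdd_mul hM (Eventually.of_forall fun p => hC p.1 p.2)

lemma integral_mul_integral_swap [SFinite μ] [SFinite ν] {a b : ℝ → ℂ} (ha : Integrable a μ) (hb : Integrable b ν)
    {M : ℝ → ℝ → ℂ} (hM : AEStronglyMeasurable (fun p : ℝ × ℝ => M p.1 p.2) (μ.prod ν))
    {C : ℝ} (hC : ∀ x y, ‖M x y‖ ≤ C) :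
    ∫ x, a x * ∫ y, M x y * b y ∂ν ∂μ = ∫ y, (∫ x, M x y * a x ∂μ) * b y ∂ν := by
  have h := integral_integral_swap (f := fun x y => M x y * (a x * b y))
    (integrable_prod_of_bounded ha hb hM hC)
  calc _ = ∫ x, ∫ y, M x y * (a x * b y) ∂ν ∂μ := by
        refine integral_congr_ae (Eventually.of_forall fun x => ?_)
        simp only
        rw [← integral_const_mul]
        refine integral_congr_ae (Eventually.of_forall fun y => ?_)
        simp only
        ring
    _ = _ := by
        rw [h]
        refine integral_congr_ae (Eventually.of_forall fun y => ?_)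
        simp only
        rw [← integral_mul_const]
        refine integral_congr_ae (Eventually.of_forall fun x => ?_)
        simp only
        ring

end Fubini

lemma ae_prod_ne : ∀ᵐ p : ℝ × ℝ ∂(volume.prod volume), p.1 ≠ p.2 := by
  have h := (quasiMeasurePreserving_sub (volume : Measure ℝ) volume).ae
    (Measure.ae_ne (volume : Measure ℝ) 0)
  filter_upwards [h] with p hp using sub_ne_zero.1 hp

/-- The integral of a Hermitian kernel is real. -/
lemma im_integral_eq_zero_of_hermitian {P : ℝ × ℝ → ℂ}
    (h : ∀ᵐ p ∂(volume.prod volume), P p.swap = (starRingEnd ℂ) (P p)) :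
    (∫ p, P p ∂(volume.prod volume)).im = 0 := by
  rw [← Complex.conj_eq_iff_im, ← integral_conj, ← integral_prod_swap P]
  exact (integral_congr_ae h).symm

/-- The commutator of a Hermitian form with multiplication by the coordinate. -/
lemma integral_sub_mul_of_hermitian {P : ℝ × ℝ → ℂ}
    (h : ∀ᵐ p ∂(volume.prod volume), P p.swap = (starRingEnd ℂ) (P p))
    (hP : Integrable (fun p : ℝ × ℝ => (p.1 : ℂ) * P p) (volume.prod volume)) :
    Integrable (fun p : ℝ × ℝ => ((p.1 : ℂ) - p.2) * P p) (volume.prod volume) ∧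
    ∫ p : ℝ × ℝ, ((p.1 : ℂ) - p.2) * P p ∂(volume.prod volume) =
      2 * Complex.I * (∫ p : ℝ × ℝ, (p.1 : ℂ) * P p ∂(volume.prod volume)).im := by
  have e : (fun p : ℝ × ℝ => (starRingEnd ℂ) ((p.swap.1 : ℂ) * P p.swap)) =ᵐ[volume.prod volume]
      fun p => (p.2 : ℂ) * P p := by
    filter_upwards [h] with p hp
    rw [map_mul, hp, Complex.conj_conj, Complex.conj_ofReal, Prod.fst_swap]
  have hs : Integrable (fun p : ℝ × ℝ => (p.2 : ℂ) * P p) (volume.prod volume) := by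
    refine Integrable.congr ?_ e
    exact (LinearIsometryEquiv.integrable_comp_iff (Complex.conjLIE)).2 hP.swap
  have e2 : ∫ p : ℝ × ℝ, (p.2 : ℂ) * P p ∂(volume.prod volume) =
      (starRingEnd ℂ) (∫ p : ℝ × ℝ, (p.1 : ℂ) * P p ∂(volume.prod volume)) := by
    rw [← integral_congr_ae e, integral_conj,
      integral_prod_swap (fun p : ℝ × ℝ => (p.1 : ℂ) * P p)]
  refine ⟨(hP.sub hs).congr (Eventually.of_forall fun p => ?_), ?_⟩
  · simp only [Pi.sub_apply]; ring
  · simp only [sub_mul]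
    rw [integral_sub hP hs, e2, Complex.sub_conj]
    push_cast
    ring

/-! ### A Bessel inequality for the Fourier transform -/

lemma integral_gaussian_fourier {ε : ℝ} (hε : 0 < ε) (t : ℝ) :
    ∫ x : ℝ, planeWave t x * (Real.exp (-ε * x ^ 2) : ℂ) =
      ((√(Real.pi / ε) * Real.exp (-(1 / (4 * ε)) * t ^ 2) : ℝ) : ℂ) := by
  have h := fourierIntegral_gaussian (b := ε) (by simpa using hε) t
  simp only [planeWave]
  push_cast
  rw [h, Real.sqrt_eq_rpow, Complex.ofReal_cpow (by positivity)]
  push_cast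
  congr 2
  ring

/-- The mass 2π is independent of ε; it becomes the constant in the Bessel inequality. -/
lemma integral_gaussian_total {ε : ℝ} (hε : 0 < ε) :
    ∫ t : ℝ, √(Real.pi / ε) * Real.exp (-(1 / (4 * ε)) * t ^ 2) = 2 * Real.pi := by
  rw [integral_const_mul, integral_gaussian, ← Real.sqrt_mul (by positivity)]
  rw [show Real.pi / ε * (Real.pi / (1 / (4 * ε))) = (2 * Real.pi) ^ 2 by field_simp; norm_num]
  exact Real.sqrt_sq (by positivity)

lemma continuous_integral_planeWave_mul {g : ℝ → ℂ} (hg : Integrable g) :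
    Continuous fun x => ∫ ξ, planeWave ξ x * g ξ := by
  refine continuous_of_dominated (bound := fun ξ => ‖g ξ‖) (fun x => ?_) (fun x => ?_) hg.norm ?_
  · have : Continuous fun ξ => planeWave ξ x := by unfold planeWave; fun_prop
    exact this.aestronglyMeasurable.mul hg.1
  · exact Eventually.of_forall fun ξ => by rw [norm_mul, norm_planeWave, one_mul]
  · exact Eventually.of_forall fun ξ => (continuous_planeWave ξ).mul continuous_const

set_option maxHeartbeats 1000000 in
-- The Gaussian factor makes Fubini legitimate and turns the left side into ∬ G(ξ - η) g(ξ)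
-- conj(g(η)), with G ≥ 0 even of mass 2π. Then |g(ξ) g(η)| ≤ (|g(ξ)|² + |g(η)|²)/2 suffices, as in
-- the Schur test.
lemma integral_norm_sq_gaussian_le {g : ℝ → ℂ} (hg : Integrable g)
    (hg2 : Integrable fun ξ => ‖g ξ‖ ^ 2) {ε : ℝ} (hε : 0 < ε) :
    Integrable (fun x => ‖∫ ξ, planeWave ξ x * g ξ‖ ^ 2 * Real.exp (-ε * x ^ 2)) ∧
    ∫ x, ‖∫ ξ, planeWave ξ x * g ξ‖ ^ 2 * Real.exp (-ε * x ^ 2) ≤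
      2 * Real.pi * ∫ ξ, ‖g ξ‖ ^ 2 := by
  set a : ℝ → ℂ := fun x => ∫ ξ, planeWave ξ x * g ξ with ha
  set G : ℝ → ℝ := fun t => √(Real.pi / ε) * Real.exp (-(1 / (4 * ε)) * t ^ 2) with hG
  have hGc : Continuous G := by fun_prop
  have hGi : Integrable G := (integrable_exp_neg_mul_sq (by positivity)).const_mul _
  have hG0 : ∀ t, 0 ≤ G t := fun t => by positivity
  have hac : Continuous a := continuous_integral_planeWave_mul hg
  have hab : ∀ x, ‖a x‖ ≤ ∫ ξ, ‖g ξ‖ := fun x => by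
    refine (norm_integral_le_integral_norm _).trans (le_of_eq ?_)
    simp only [norm_mul, norm_planeWave, one_mul]
  have hgau : Integrable fun x : ℝ => (Real.exp (-ε * x ^ 2) : ℂ) :=
    (integrable_exp_neg_mul_sq hε).ofReal
  have hpw : AEStronglyMeasurable (fun p : ℝ × ℝ => planeWave p.2 p.1) (volume.prod volume) := by
    have : Continuous fun p : ℝ × ℝ => planeWave p.2 p.1 := by unfold planeWave; fun_prop
    exact this.aestronglyMeasurable
  have hb : Integrable fun x : ℝ => (starRingEnd ℂ) (a x) * (Real.exp (-ε * x ^ 2) : ℂ) := by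
    refine hgau.bdd_mul (c := ∫ ξ, ‖g ξ‖) ?_ ?_
    · exact (Complex.continuous_conj.comp hac).aestronglyMeasurable
    · exact Eventually.of_forall fun x => by rw [RCLike.norm_conj]; exact hab x
  have hgc : Integrable fun η => (starRingEnd ℂ) (g η) :=
    (LinearIsometryEquiv.integrable_comp_iff Complex.conjLIE).2 hg
  have hinner : ∀ ξ : ℝ, ∫ x, planeWave ξ x * ((starRingEnd ℂ) (a x) * (Real.exp (-ε * x ^ 2) : ℂ)) =
      ∫ η, (G (ξ - η) : ℂ) * (starRingEnd ℂ) (g η) := by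
    intro ξ
    have h1 : ∀ x, (starRingEnd ℂ) (a x) = ∫ η, planeWave (-η) x * (starRingEnd ℂ) (g η) := by
      intro x
      rw [ha, ← integral_conj]
      simp only [map_mul, planeWave_neg]
    have h2 := integral_mul_integral_swap (μ := volume) (ν := volume)
      (a := fun x => planeWave ξ x * (Real.exp (-ε * x ^ 2) : ℂ))
      (hgau.bdd_mul (c := 1) (continuous_planeWave ξ).aestronglyMeasurable
        (Eventually.of_forall fun x => (norm_planeWave ξ x).le)) hgc
      (M := fun x η => planeWave (-η) x) (C := 1)
      (by
        have : Continuous fun p : ℝ × ℝ => planeWave (-p.2) p.1 := by unfold planeWave; fun_prop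
        exact this.aestronglyMeasurable) (fun x y => (norm_planeWave _ _).le)
    calc _ = ∫ x, (planeWave ξ x * (Real.exp (-ε * x ^ 2) : ℂ)) *
          ∫ η, planeWave (-η) x * (starRingEnd ℂ) (g η) := by
          refine integral_congr_ae (Eventually.of_forall fun x => ?_)
          simp only
          rw [h1]; ring
      _ = _ := by
          rw [h2]
          refine integral_congr_ae (Eventually.of_forall fun η => ?_)
          simp only
          rw [← integral_gaussian_fourier hε]
          congr 1
          refine integral_congr_ae (Eventually.of_forall fun x => ?_)
          simp only
          rw [sub_eq_add_neg, planeWave_add]; ring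
  have hsq : ∀ x, ((‖a x‖ ^ 2 * Real.exp (-ε * x ^ 2) : ℝ) : ℂ) =
      ((starRingEnd ℂ) (a x) * (Real.exp (-ε * x ^ 2) : ℂ)) * a x := fun x => by
    push_cast
    rw [← Complex.conj_mul']; ring
  have hmain : ((∫ x, ‖a x‖ ^ 2 * Real.exp (-ε * x ^ 2) : ℝ) : ℂ) =
      ∫ ξ, (∫ η, (G (ξ - η) : ℂ) * (starRingEnd ℂ) (g η)) * g ξ := by
    rw [← integral_complex_ofReal]
    simp only [hsq]
    rw [integral_mul_integral_swap (M := fun x y => planeWave y x) hb hg hpw (C := 1) (fun x y => (norm_planeWave _ _).le)]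
    simp only [hinner]
  have hGp : Integrable (fun p : ℝ × ℝ => G (p.1 - p.2) * ‖g p.1‖ ^ 2) (volume.prod volume) := by
    have hm : AEStronglyMeasurable (fun p : ℝ × ℝ => G (p.1 - p.2) * ‖g p.1‖ ^ 2)
        (volume.prod volume) :=
      (hGc.comp (continuous_fst.sub continuous_snd)).aestronglyMeasurable.mul hg2.1.comp_fst
    refine (integrable_prod_iff hm).2 ⟨Eventually.of_forall fun x =>
      (hGi.comp_sub_left x).mul_const (‖g x‖ ^ 2), ?_⟩
    refine (hg2.const_mul (2 * Real.pi)).congr (Eventually.of_forall fun x => ?_)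
    simp only [norm_mul, Real.norm_eq_abs, abs_of_nonneg (hG0 _), abs_pow, abs_norm]
    rw [integral_mul_const, integral_sub_left_eq_self G, integral_gaussian_total hε]
  have hGp1 : ∫ p : ℝ × ℝ, G (p.1 - p.2) * ‖g p.1‖ ^ 2 ∂(volume.prod volume) =
      2 * Real.pi * ∫ ξ, ‖g ξ‖ ^ 2 := by
    rw [integral_prod _ hGp, ← integral_const_mul]
    refine integral_congr_ae (Eventually.of_forall fun x => ?_)
    simp only
    rw [integral_mul_const, integral_sub_left_eq_self G, integral_gaussian_total hε]
  have hGsymm : ∀ x y, G (x - y) = G (y - x) := fun x y => by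
    simp only [hG]; congr 3; ring
  have hGp' : Integrable (fun p : ℝ × ℝ => G (p.1 - p.2) * ‖g p.2‖ ^ 2) (volume.prod volume) := by
    refine hGp.swap.congr (Eventually.of_forall fun p => ?_)
    simp only [Function.comp_apply, Prod.fst_swap, Prod.snd_swap]
    rw [hGsymm]
  have hGp2 : ∫ p : ℝ × ℝ, G (p.1 - p.2) * ‖g p.2‖ ^ 2 ∂(volume.prod volume) =
      2 * Real.pi * ∫ ξ, ‖g ξ‖ ^ 2 := by
    rw [← hGp1, ← integral_prod_swap]
    refine integral_congr_ae (Eventually.of_forall fun p => ?_)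
    simp only [Prod.fst_swap, Prod.snd_swap]
    rw [hGsymm]
  have hdom : Integrable (fun p : ℝ × ℝ => (G (p.1 - p.2) : ℂ) *
      (g p.1 * (starRingEnd ℂ) (g p.2))) (volume.prod volume) := by
    refine integrable_prod_of_bounded (M := fun x y => (G (x - y) : ℂ)) hg hgc ?_
      (C := √(Real.pi / ε)) ?_
    · exact (Complex.continuous_ofReal.comp
        (hGc.comp (continuous_fst.sub continuous_snd))).aestronglyMeasurable
    · intro x y
      rw [Complex.norm_real, Real.norm_eq_abs, abs_of_nonneg (hG0 _)]
      refine mul_le_of_le_one_right (Real.sqrt_nonneg _) (Real.exp_le_one_iff.2 ?_)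
      have : 0 ≤ 1 / (4 * ε) * (x - y) ^ 2 := by positivity
      linarith
  have hmain2 : ((∫ x, ‖a x‖ ^ 2 * Real.exp (-ε * x ^ 2) : ℝ) : ℂ) =
      ∫ p : ℝ × ℝ, (G (p.1 - p.2) : ℂ) * (g p.1 * (starRingEnd ℂ) (g p.2))
        ∂(volume.prod volume) := by
    rw [hmain, integral_prod _ hdom]
    refine integral_congr_ae (Eventually.of_forall fun ξ => ?_)
    simp only
    rw [← integral_mul_const]
    refine integral_congr_ae (Eventually.of_forall fun η => ?_)
    simp only
    ring
  refine ⟨?_, ?_⟩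
  · have := hb.mul_bdd (g := a) (c := ∫ ξ, ‖g ξ‖) hac.aestronglyMeasurable
      (Eventually.of_forall hab)
    have h2 := this.re
    refine h2.congr (Eventually.of_forall fun x => ?_)
    simp only [← hsq]
    exact Complex.ofReal_re _
  · refine (le_abs_self _).trans ?_
    rw [← Real.norm_eq_abs, ← Complex.norm_real, hmain2]
    refine (norm_integral_le_of_norm_le
      (((hGp.add hGp').const_mul (1 / 2))) (Eventually.of_forall fun p => ?_)).trans (le_of_eq ?_)
    · rw [norm_mul, norm_mul, RCLike.norm_conj, Complex.norm_real, Real.norm_eq_abs,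
        abs_of_nonneg (hG0 _), Pi.add_apply]
      nlinarith [hG0 (p.1 - p.2), mul_nonneg (hG0 (p.1 - p.2)) (sq_nonneg (‖g p.1‖ - ‖g p.2‖))]
    · rw [integral_const_mul]
      have := integral_add hGp hGp'
      simp only [Pi.add_apply] at this ⊢
      rw [this, hGp1, hGp2]
      ring

/-- Fatou's lemma, with integrability of the limit included. It is used to remove the Gaussian and,
later, the frequency cut-off. -/
lemma integrable_and_integral_le_of_tendsto {F : ℕ → ℝ → ℝ} {f : ℝ → ℝ} {c : ℝ}
    (hFi : ∀ n, Integrable (F n)) (hF0 : ∀ n x, 0 ≤ F n x)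
    (hlim : ∀ᵐ x, Tendsto (fun n => F n x) atTop (𝓝 (f x))) (hc : ∀ n, ∫ x, F n x ≤ c) :
    Integrable f ∧ ∫ x, f x ≤ c := by
  have hc0 : 0 ≤ c := (integral_nonneg (hF0 0)).trans (hc 0)
  have hf0 : 0 ≤ᵐ[volume] f := by
    filter_upwards [hlim] with x hx using ge_of_tendsto' hx fun n => hF0 n x
  have hm : AEStronglyMeasurable f volume :=
    aestronglyMeasurable_of_tendsto_ae atTop (fun n => (hFi n).1) hlim
  have h1 : ∫⁻ x, ENNReal.ofReal (f x) ≤ ENNReal.ofReal c := by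
    have h2 : ∀ᵐ x, liminf (fun n => ENNReal.ofReal (F n x)) atTop = ENNReal.ofReal (f x) := by
      filter_upwards [hlim] with x hx
      exact ((ENNReal.continuous_ofReal.tendsto _).comp hx).liminf_eq
    rw [← lintegral_congr_ae h2]
    refine (lintegral_liminf_le' fun n => (hFi n).1.aemeasurable.ennreal_ofReal).trans ?_
    refine liminf_le_of_le (by isBoundedDefault) fun b hb => ?_
    obtain ⟨n, hn⟩ := hb.exists
    refine hn.trans ?_
    rw [← ofReal_integral_eq_lintegral_ofReal (hFi n) (Eventually.of_forall (hF0 n))]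
    exact ENNReal.ofReal_le_ofReal (hc n)
  have hfi : Integrable f :=
    ⟨hm, (hasFiniteIntegral_iff_ofReal hf0).2 (h1.trans_lt ENNReal.ofReal_lt_top)⟩
  refine ⟨hfi, ?_⟩
  rw [integral_eq_lintegral_of_nonneg_ae hf0 hm]
  exact ENNReal.toReal_le_of_le_ofReal hc0 h1

lemma bessel_fourier {g : ℝ → ℂ} (hg : Integrable g) (hg2 : Integrable fun ξ => ‖g ξ‖ ^ 2) :
    Integrable (fun x => ‖∫ ξ, planeWave ξ x * g ξ‖ ^ 2) ∧
    ∫ x, ‖∫ ξ, planeWave ξ x * g ξ‖ ^ 2 ≤ 2 * Real.pi * ∫ ξ, ‖g ξ‖ ^ 2 := by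
  set a : ℝ → ℂ := fun x => ∫ ξ, planeWave ξ x * g ξ with ha
  set F : ℕ → ℝ → ℝ := fun n x => ‖a x‖ ^ 2 * Real.exp (-(1 / ((n : ℝ) + 1)) * x ^ 2) with hF
  have hε : ∀ n : ℕ, 0 < 1 / ((n : ℝ) + 1) := fun n => by positivity
  have hFi : ∀ n, Integrable (F n) := fun n => (integral_norm_sq_gaussian_le hg hg2 (hε n)).1
  have hFl : ∀ n, ∫ x, F n x ≤ 2 * Real.pi * ∫ ξ, ‖g ξ‖ ^ 2 := fun n =>
    (integral_norm_sq_gaussian_le hg hg2 (hε n)).2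
  have hlim : ∀ x, Tendsto (fun n => F n x) atTop (𝓝 (‖a x‖ ^ 2)) := fun x => by
    have h1 : Tendsto (fun n : ℕ => Real.exp (-(1 / ((n : ℝ) + 1)) * x ^ 2)) atTop
        (𝓝 (Real.exp (-0 * x ^ 2))) :=
      (Real.continuous_exp.tendsto _).comp
        (tendsto_one_div_add_atTop_nhds_zero_nat.neg.mul_const _)
    have h2 := h1.const_mul (‖a x‖ ^ 2)
    rwa [neg_zero, zero_mul, Real.exp_zero, mul_one] at h2
  exact integrable_and_integral_le_of_tendsto hFi (fun n x => by positivity)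
    (Eventually.of_forall hlim) hFl

/-! ### Fourier integrals -/

/-- The Fourier transform `f ↦ ∫ e^{-iξy} f(y) dy`. -/
def fourierIntegral (f : ℝ → ℂ) (ξ : ℝ) : ℂ := ∫ y, planeWave (-ξ) y * f y

lemma norm_fourierIntegral_le (f : ℝ → ℂ) (ξ : ℝ) : ‖fourierIntegral f ξ‖ ≤ ∫ y, ‖f y‖ := by
  refine (norm_integral_le_integral_norm _).trans (le_of_eq ?_)
  simp only [norm_mul, norm_planeWave, one_mul]

lemma integrable_planeWave_mul {μ : Measure ℝ} {f : ℝ → ℂ} (hf : Integrable f μ) (l : ℝ) :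
    Integrable (fun y => planeWave l y * f y) μ :=
  hf.bdd_mul (c := 1) (continuous_planeWave l).aestronglyMeasurable
    (Eventually.of_forall fun y => (norm_planeWave l y).le)

lemma integrable_conj {μ : Measure ℝ} {f : ℝ → ℂ} (hf : Integrable f μ) :
    Integrable (fun y => (starRingEnd ℂ) (f y)) μ :=
  (LinearIsometryEquiv.integrable_comp_iff Complex.conjLIE).2 hf

lemma continuous_fourierIntegral {f : ℝ → ℂ} (hf : Integrable f) :
    Continuous (fourierIntegral f) := by
  refine continuous_of_dominated (bound := fun ξ => ‖f ξ‖) (fun x => ?_) (fun x => ?_) hf.norm ?_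
  · exact (integrable_planeWave_mul hf _).1
  · exact Eventually.of_forall fun ξ => by rw [norm_mul, norm_planeWave, one_mul]
  · refine Eventually.of_forall fun ξ => Continuous.mul ?_ continuous_const
    unfold planeWave; fun_prop

lemma conj_fourierIntegral (f : ℝ → ℂ) (ξ : ℝ) :
    (starRingEnd ℂ) (fourierIntegral f ξ) = ∫ y, planeWave ξ y * (starRingEnd ℂ) (f y) := by
  rw [fourierIntegral, ← integral_conj]
  simp only [map_mul, ← planeWave_neg, neg_neg]

lemma fourierIntegral_zero (f : ℝ → ℂ) : fourierIntegral f 0 = ∫ y, f y := by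
  simp [fourierIntegral, planeWave]

/-! ### The kernel of the primitive -/

/-- The kernel `χ_{x ≤ t < 0} - χ_{0 ≤ t < x}` of the primitive of functions of mean zero. -/
def primKernel (t x : ℝ) : ℝ :=
  (if x ≤ t ∧ t < 0 then 1 else 0) - (if 0 ≤ t ∧ t < x then 1 else 0)

lemma measurable_primKernel : Measurable fun p : ℝ × ℝ => primKernel p.1 p.2 := by
  unfold primKernel
  refine Measurable.sub (Measurable.ite ?_ measurable_const measurable_const)
    (Measurable.ite ?_ measurable_const measurable_const)
  · exact (measurableSet_le measurable_snd measurable_fst).inter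
      (measurableSet_lt measurable_fst measurable_const)
  · exact (measurableSet_le measurable_const measurable_fst).inter
      (measurableSet_lt measurable_fst measurable_snd)

lemma primKernel_of_nonneg {x : ℝ} (hx : 0 ≤ x) (t : ℝ) :
    primKernel t x = -indicator (Ico 0 x) 1 t := by
  unfold primKernel
  rw [if_neg (fun h => by linarith [h.1, h.2]), zero_sub]
  simp [indicator_apply]

lemma primKernel_of_nonpos {x : ℝ} (hx : x ≤ 0) (t : ℝ) :
    primKernel t x = indicator (Ico x 0) 1 t := by
  unfold primKernel
  rw [if_neg (c := 0 ≤ t ∧ t < x) (fun h => by linarith [h.1, h.2]), sub_zero]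
  simp [indicator_apply]

lemma abs_primKernel_le (t x : ℝ) : |primKernel t x| ≤ 1 := by
  rcases le_total 0 x with h | h
  · rw [primKernel_of_nonneg h, abs_neg, indicator_apply]; split_ifs <;> simp
  · rw [primKernel_of_nonpos h, indicator_apply]; split_ifs <;> simp

lemma abs_le_abs_of_primKernel_ne_zero {t x : ℝ} (h : primKernel t x ≠ 0) : |t| ≤ |x| := by
  rcases le_total 0 x with hx | hx
  · rw [primKernel_of_nonneg hx, neg_ne_zero] at h
    have := mem_of_indicator_ne_zero h
    rw [abs_of_nonneg this.1, abs_of_nonneg hx]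
    exact this.2.le
  · rw [primKernel_of_nonpos hx] at h
    have := mem_of_indicator_ne_zero h
    rw [abs_of_neg this.2, abs_of_nonpos hx]
    linarith [this.1]

lemma integral_primKernel_mul (x : ℝ) (g : ℝ → ℂ) :
    ∫ t, (primKernel t x : ℂ) * g t = -∫ t in (0 : ℝ)..x, g t := by
  rcases le_total 0 x with h | h
  · rw [intervalIntegral.integral_of_le h, ← integral_Ico_eq_integral_Ioc,
      ← integral_indicator measurableSet_Ico, ← integral_neg]
    refine integral_congr_ae (Eventually.of_forall fun t => ?_)
    simp only [primKernel_of_nonneg h, indicator_apply]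
    split_ifs <;> simp
  · rw [intervalIntegral.integral_of_ge h, neg_neg, ← integral_Ico_eq_integral_Ioc,
      ← integral_indicator measurableSet_Ico]
    refine integral_congr_ae (Eventually.of_forall fun t => ?_)
    simp only [primKernel_of_nonpos h, indicator_apply]
    split_ifs <;> simp

lemma integrable_primKernel (x : ℝ) : Integrable fun t => primKernel t x := by
  rcases le_total 0 x with h | h
  · simp only [primKernel_of_nonneg h]
    exact ((integrable_indicator_iff measurableSet_Ico).2
      (continuous_one.integrableOn_Icc.mono_set Ico_subset_Icc_self)).neg
  · simp only [primKernel_of_nonpos h]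
    exact (integrable_indicator_iff measurableSet_Ico).2
      (continuous_one.integrableOn_Icc.mono_set Ico_subset_Icc_self)

lemma integral_abs_primKernel (x : ℝ) : ∫ t, |primKernel t x| = |x| := by
  rcases le_total 0 x with h | h
  · have : ∀ t, |primKernel t x| = indicator (Ico 0 x) 1 t := fun t => by
      rw [primKernel_of_nonneg h, abs_neg, indicator_apply]; split_ifs <;> simp
    simp only [this]
    rw [integral_indicator_one measurableSet_Ico]
    simp [h, abs_of_nonneg]
  · have : ∀ t, |primKernel t x| = indicator (Ico x 0) 1 t := fun t => by
      rw [primKernel_of_nonpos h, indicator_apply]; split_ifs <;> simp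
    simp only [this]
    rw [integral_indicator_one measurableSet_Ico]
    simp [h, abs_of_nonpos]

/-- The product is the indicator of the overlap of the intervals from 0 to x and from 0 to y; the
signs agree where both are nonzero. Against functions of mean zero the terms |x| and |y| drop out,
leaving the kernel -|x - y|/2. -/
lemma integral_primKernel_mul_primKernel (x y : ℝ) :
    ∫ t, primKernel t x * primKernel t y = (|x| + |y| - |x - y|) / 2 := by
  rcases le_total 0 x with hx | hx <;> rcases le_total 0 y with hy | hy
  · have : ∀ t, primKernel t x * primKernel t y = indicator (Ico 0 (min x y)) 1 t := fun t => by
      simp only [primKernel_of_nonneg hx, primKernel_of_nonneg hy, indicator_apply, mem_Ico,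
        lt_min_iff]
      by_cases h1 : 0 ≤ t <;> by_cases h2 : t < x <;> by_cases h3 : t < y <;> simp [h1, h2, h3]
    simp only [this]
    rw [integral_indicator_one measurableSet_Ico]
    simp only [Measure.real, Real.volume_Ico, sub_zero]
    rw [ENNReal.toReal_ofReal (le_min hx hy), abs_of_nonneg hx, abs_of_nonneg hy]
    rcases le_total x y with h | h
    · rw [min_eq_left h, abs_of_nonpos (by linarith)]; ring
    · rw [min_eq_right h, abs_of_nonneg (by linarith)]; ring
  · have : ∀ t, primKernel t x * primKernel t y = 0 := fun t => by
      simp only [primKernel_of_nonneg hx, primKernel_of_nonpos hy, indicator_apply, mem_Ico]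
      by_cases h1 : 0 ≤ t
      · simp [h1, not_lt.2 h1]
      · simp [h1]
    simp only [this, integral_zero]
    rw [abs_of_nonneg hx, abs_of_nonpos hy, abs_of_nonneg (by linarith)]; ring
  · have : ∀ t, primKernel t x * primKernel t y = 0 := fun t => by
      simp only [primKernel_of_nonneg hy, primKernel_of_nonpos hx, indicator_apply, mem_Ico]
      by_cases h1 : 0 ≤ t
      · simp [h1, not_lt.2 h1]
      · simp [h1]
    simp only [this, integral_zero]
    rw [abs_of_nonpos hx, abs_of_nonneg hy, abs_of_nonpos (by linarith)]; ring
  · have : ∀ t, primKernel t x * primKernel t y = indicator (Ico (max x y) 0) 1 t := fun t => by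
      simp only [primKernel_of_nonpos hx, primKernel_of_nonpos hy, indicator_apply, mem_Ico,
        max_le_iff]
      by_cases h1 : t < 0 <;> by_cases h2 : x ≤ t <;> by_cases h3 : y ≤ t <;> simp [h1, h2, h3]
    simp only [this]
    rw [integral_indicator_one measurableSet_Ico]
    simp only [Measure.real, Real.volume_Ico, zero_sub]
    rw [ENNReal.toReal_ofReal (neg_nonneg.2 (max_le hx hy)), abs_of_nonpos hx, abs_of_nonpos hy]
    rcases le_total x y with h | h
    · rw [max_eq_right h, abs_of_nonpos (by linarith)]; ring
    · rw [max_eq_left h, abs_of_nonneg (by linarith)]; ring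

/-- The last summand does not depend on y. Convolution of sign/2 with a function of mean zero is
therefore its primitive. -/
lemma half_sign_sub {t y : ℝ} (h : y ≠ t) :
    Real.sign (t - y) / 2 = primKernel t y + (if 0 ≤ t then 1 / 2 else -(1 / 2)) := by
  unfold primKernel
  rcases lt_or_gt_of_ne h with h1 | h1
  · rw [Real.sign_of_pos (by linarith)]
    by_cases h2 : 0 ≤ t
    · rw [if_neg (fun h => by linarith [h.2]), if_neg (fun h => by linarith [h.2]), if_pos h2]
      norm_num
    · rw [if_pos ⟨h1.le, not_le.1 h2⟩, if_neg (fun h => h2 h.1), if_neg h2]; norm_num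
  · rw [Real.sign_of_neg (by linarith)]
    by_cases h2 : 0 ≤ t
    · rw [if_neg (fun h => by linarith [h.1]), if_pos ⟨h2, h1⟩, if_pos h2]; norm_num
    · rw [if_neg (fun h => by linarith [h.1]), if_neg (fun h => h2 h.1), if_neg h2]; norm_num

/-- The primitive of a function of mean zero that vanishes at infinity. -/
def prim (F : ℝ → ℂ) (t : ℝ) : ℂ := ∫ y, (primKernel t y : ℂ) * F y

/-! ### Bounds, quadratic form and Fourier transform of the primitive. -/

section Prim

variable {F : ℝ → ℂ}

lemma norm_primKernel_complex_le (t x : ℝ) : ‖(primKernel t x : ℂ)‖ ≤ 1 := by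
  rw [Complex.norm_real]; exact abs_primKernel_le t x

lemma aestronglyMeasurable_primKernel :
    AEStronglyMeasurable (fun p : ℝ × ℝ => (primKernel p.1 p.2 : ℂ)) (volume.prod volume) :=
  (Complex.measurable_ofReal.comp measurable_primKernel).aestronglyMeasurable

lemma integrable_primKernel_mul (hF : Integrable F) (t : ℝ) :
    Integrable fun y => (primKernel t y : ℂ) * F y := by
  refine hF.bdd_mul (c := 1) ?_ (Eventually.of_forall fun y => norm_primKernel_complex_le t y)
  exact (Complex.measurable_ofReal.comp
    (measurable_primKernel.comp (measurable_const.prodMk measurable_id))).aestronglyMeasurable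

/-- The kernel vanishes unless |t| ≤ |y|, so the weight at t may be moved under the integral as the
weight at y: the primitive decays as fast as F has moments. -/
lemma weight_rpow_mul_norm_prim_le {b : ℝ} (hb : 0 ≤ b) (hF : Integrable F)
    (hFw : Integrable fun y => weight y ^ b * ‖F y‖) (t : ℝ) :
    weight t ^ b * ‖prim F t‖ ≤ ∫ y, weight y ^ b * ‖F y‖ := by
  have h1 : ‖prim F t‖ ≤ ∫ y, ‖(primKernel t y : ℂ) * F y‖ := norm_integral_le_integral_norm _
  calc weight t ^ b * ‖prim F t‖ ≤ weight t ^ b * ∫ y, ‖(primKernel t y : ℂ) * F y‖ :=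
        mul_le_mul_of_nonneg_left h1 (weight_rpow_pos b t).le
    _ = ∫ y, weight t ^ b * ‖(primKernel t y : ℂ) * F y‖ := (integral_const_mul _ _).symm
    _ ≤ _ := by
        refine integral_mono ((integrable_primKernel_mul hF t).norm.const_mul _) hFw fun y => ?_
        simp only [norm_mul, Complex.norm_real, Real.norm_eq_abs]
        by_cases h : primKernel t y = 0
        · rw [h, abs_zero, zero_mul, mul_zero]
          exact mul_nonneg (weight_rpow_pos b y).le (norm_nonneg _)
        · have h2 : weight t ^ b ≤ weight y ^ b :=
            Real.rpow_le_rpow (weight_pos t).le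
              (weight_mono (abs_le_abs_of_primKernel_ne_zero h)) hb
          have h3 := abs_primKernel_le t y
          have h4 := norm_nonneg (F y)
          have h5 : |primKernel t y| * ‖F y‖ ≤ ‖F y‖ := mul_le_of_le_one_left h4 h3
          exact mul_le_mul h2 h5 (mul_nonneg (abs_nonneg _) h4) (weight_rpow_pos b y).le

lemma norm_prim_le (hF : Integrable F) (t : ℝ) : ‖prim F t‖ ≤ ∫ y, ‖F y‖ := by
  simpa using weight_rpow_mul_norm_prim_le le_rfl hF (by simpa using hF.norm) t

lemma integrable_primKernel_prod (hF : Integrable F) (hF1 : Integrable fun y => |y| * ‖F y‖) :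
    Integrable (fun p : ℝ × ℝ => (primKernel p.1 p.2 : ℂ) * F p.2) (volume.prod volume) := by
  have hm : AEStronglyMeasurable (fun p : ℝ × ℝ => (primKernel p.1 p.2 : ℂ) * F p.2)
      (volume.prod volume) := aestronglyMeasurable_primKernel.mul hF.1.comp_snd
  refine (integrable_prod_iff' hm).2 ⟨Eventually.of_forall fun y =>
    (integrable_primKernel y).ofReal.mul_const (F y), ?_⟩
  refine hF1.congr (Eventually.of_forall fun y => ?_)
  simp only [norm_mul, Complex.norm_real, Real.norm_eq_abs]
  rw [integral_mul_const, integral_abs_primKernel]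

lemma integrable_prim (hF : Integrable F) (hF1 : Integrable fun y => |y| * ‖F y‖) :
    Integrable (prim F) :=
  (integrable_primKernel_prod hF hF1).integral_prod_left

lemma integrable_norm_prim_sq (hF : Integrable F) (hF1 : Integrable fun y => |y| * ‖F y‖) :
    Integrable fun t => ‖prim F t‖ ^ 2 := by
  have h := (integrable_prim hF hF1).norm
  refine (h.bdd_mul (c := ∫ y, ‖F y‖) h.1 (Eventually.of_forall fun t => ?_)).congr
    (Eventually.of_forall fun t => (sq _).symm)
  rw [norm_norm]; exact norm_prim_le hF t

lemma integral_conj_eq_zero (h0 : ∫ y, F y = 0) : ∫ y, (starRingEnd ℂ) (F y) = 0 := by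
  rw [integral_conj, h0, map_zero]

lemma integrable_abs_sub_mul (hF : Integrable F) (hF1 : Integrable fun y => |y| * ‖F y‖) :
    Integrable (fun p : ℝ × ℝ => ((|p.1 - p.2| : ℝ) : ℂ) * ((starRingEnd ℂ) (F p.1) * F p.2))
      (volume.prod volume) := by
  have h1 : Integrable (fun p : ℝ × ℝ => (|p.1| * ‖F p.1‖) * ‖F p.2‖ +
      ‖F p.1‖ * (|p.2| * ‖F p.2‖)) (volume.prod volume) :=
    (hF1.mul_prod hF.norm).add (hF.norm.mul_prod hF1)
  refine Integrable.mono' h1 ?_ (Eventually.of_forall fun p => ?_)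
  · have hc : Continuous fun p : ℝ × ℝ => ((|p.1 - p.2| : ℝ) : ℂ) := by fun_prop
    exact hc.aestronglyMeasurable.mul ((integrable_conj hF).1.comp_fst.mul hF.1.comp_snd)
  · rw [norm_mul, norm_mul, RCLike.norm_conj, Complex.norm_real, Real.norm_eq_abs, abs_abs]
    have := abs_sub p.1 p.2
    calc |p.1 - p.2| * (‖F p.1‖ * ‖F p.2‖) ≤ (|p.1| + |p.2|) * (‖F p.1‖ * ‖F p.2‖) := by gcongr
      _ = _ := by ring

/-- The quadratic form with kernel `|x - y|` on functions of mean zero. -/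
lemma integral_abs_sub_mul (hF : Integrable F) (hF1 : Integrable fun y => |y| * ‖F y‖)
    (h0 : ∫ y, F y = 0) :
    ∫ p : ℝ × ℝ, ((|p.1 - p.2| : ℝ) : ℂ) * ((starRingEnd ℂ) (F p.1) * F p.2)
      ∂(volume.prod volume) = -2 * ((∫ t, ‖prim F t‖ ^ 2 : ℝ) : ℂ) := by
  have hI := integrable_abs_sub_mul hF hF1
  have hFa : Integrable fun y => ((|y| : ℝ) : ℂ) * F y := by
    refine Integrable.mono' hF1 ?_ (Eventually.of_forall fun y => ?_)
    · exact (by fun_prop : Continuous fun y : ℝ => ((|y| : ℝ) : ℂ)).aestronglyMeasurable.mul hF.1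
    · rw [norm_mul, Complex.norm_real, Real.norm_eq_abs, abs_abs]
  have hFs : ∀ x : ℝ, Integrable fun y => ((|x - y| : ℝ) : ℂ) * F y := fun x => by
    refine Integrable.mono' ((hF.norm.const_mul |x|).add hF1) ?_ (Eventually.of_forall fun y => ?_)
    · exact (by fun_prop : Continuous fun y : ℝ => ((|x - y| : ℝ) : ℂ)).aestronglyMeasurable.mul
        hF.1
    · rw [norm_mul, Complex.norm_real, Real.norm_eq_abs, abs_abs, Pi.add_apply, ← add_mul]
      have := abs_sub x y
      gcongr
  -- The overlap formula also contributes a multiple of |x| ∫ F, which is zero. The remaining |y|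
  -- term is constant in x and disappears below on integration against conj F.
  have hinner : ∀ x : ℝ, ∫ t, (primKernel t x : ℂ) * prim F t =
      ((∫ y, ((|y| : ℝ) : ℂ) * F y) - ∫ y, ((|x - y| : ℝ) : ℂ) * F y) / 2 := by
    intro x
    have h1 := integral_mul_integral_swap (μ := volume) (ν := volume)
      (a := fun t => (primKernel t x : ℂ)) (integrable_primKernel x).ofReal hF (M := fun t y => (primKernel t y : ℂ)) (C := 1)
      aestronglyMeasurable_primKernel norm_primKernel_complex_le
    have h2 : ∀ y, ∫ t, (primKernel t y : ℂ) * (primKernel t x : ℂ) =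
        (((|x| + |y| - |x - y|) / 2 : ℝ) : ℂ) := fun y => by
      rw [← integral_primKernel_mul_primKernel, ← integral_complex_ofReal]
      refine integral_congr_ae (Eventually.of_forall fun t => ?_)
      push_cast; ring
    simp only [h2] at h1
    refine h1.trans ?_
    have h3 : ∀ y, (((|x| + |y| - |x - y|) / 2 : ℝ) : ℂ) * F y =
        (1 / 2 : ℂ) * (((|x| : ℝ) : ℂ) * F y + ((((|y| : ℝ) : ℂ) * F y) -
          ((|x - y| : ℝ) : ℂ) * F y)) := fun y => by push_cast; ring
    simp only [h3]
    rw [integral_const_mul]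
    have e1 := integral_add (hF.const_mul ((|x| : ℝ) : ℂ)) (hFa.sub (hFs x))
    have e2 := integral_sub hFa (hFs x)
    simp only [Pi.sub_apply] at e1
    rw [e1, e2, integral_const_mul, h0]
    ring
  have hsq : ∀ t, ((‖prim F t‖ ^ 2 : ℝ) : ℂ) =
      prim F t * ∫ x, (primKernel t x : ℂ) * (starRingEnd ℂ) (F x) := fun t => by
    rw [Complex.ofReal_pow, ← Complex.mul_conj']
    congr 1
    rw [prim, ← integral_conj]
    simp only [map_mul, Complex.conj_ofReal]
  have hH : Integrable fun x => (∫ y, ((|x - y| : ℝ) : ℂ) * F y) * (starRingEnd ℂ) (F x) := by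
    refine hI.integral_prod_left.congr (Eventually.of_forall fun x => ?_)
    simp only
    rw [← integral_mul_const]
    refine integral_congr_ae (Eventually.of_forall fun y => ?_)
    simp only; ring
  have hmain : ((∫ t, ‖prim F t‖ ^ 2 : ℝ) : ℂ) =
      -(1 / 2 : ℂ) * ∫ x, (∫ y, ((|x - y| : ℝ) : ℂ) * F y) * (starRingEnd ℂ) (F x) := by
    rw [← integral_complex_ofReal]
    simp only [hsq]
    rw [integral_mul_integral_swap (M := fun t y => (primKernel t y : ℂ)) (C := 1)
      (integrable_prim hF hF1) (integrable_conj hF) aestronglyMeasurable_primKernel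
      norm_primKernel_complex_le]
    simp only [hinner]
    have h3 : ∀ x, ((∫ y, ((|y| : ℝ) : ℂ) * F y) - ∫ y, ((|x - y| : ℝ) : ℂ) * F y) / 2 *
        (starRingEnd ℂ) (F x) = ((∫ y, ((|y| : ℝ) : ℂ) * F y) / 2) * (starRingEnd ℂ) (F x) -
        (1 / 2 : ℂ) * ((∫ y, ((|x - y| : ℝ) : ℂ) * F y) * (starRingEnd ℂ) (F x)) := fun x => by
      ring
    simp only [h3]
    rw [integral_sub ((integrable_conj hF).const_mul _) (hH.const_mul _), integral_const_mul,
      integral_const_mul, integral_conj_eq_zero h0]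
    ring
  rw [hmain, integral_prod _ hI]
  have h4 : ∀ x, ∫ y, ((|x - y| : ℝ) : ℂ) * ((starRingEnd ℂ) (F x) * F y) =
      (∫ y, ((|x - y| : ℝ) : ℂ) * F y) * (starRingEnd ℂ) (F x) := fun x => by
    rw [← integral_mul_const]
    refine integral_congr_ae (Eventually.of_forall fun y => ?_)
    simp only; ring
  simp only [h4]
  ring

/-- The Fourier transform of the primitive. -/
lemma fourierIntegral_prim (hF : Integrable F) (hF1 : Integrable fun y => |y| * ‖F y‖)
    (h0 : ∫ y, F y = 0) {η : ℝ} (hη : η ≠ 0) :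
    Complex.I * η * fourierIntegral (prim F) η = fourierIntegral F η := by
  have h1 : Integrable (Function.uncurry fun t y : ℝ =>
      planeWave (-η) t * ((primKernel t y : ℂ) * F y)) (volume.prod volume) :=
    (integrable_primKernel_prod hF hF1).bdd_mul (c := 1)
      ((continuous_planeWave (-η)).comp continuous_fst).aestronglyMeasurable
      (Eventually.of_forall fun p => (norm_planeWave _ _).le)
  have h2 : fourierIntegral (prim F) η =
      ∫ y, (∫ t, (primKernel t y : ℂ) * planeWave (-η) t) * F y := by
    calc fourierIntegral (prim F) η
        = ∫ t, ∫ y, planeWave (-η) t * ((primKernel t y : ℂ) * F y) := by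
          refine integral_congr_ae (Eventually.of_forall fun t => ?_)
          simp only [prim]
          rw [integral_const_mul]
      _ = _ := by
          rw [integral_integral_swap h1]
          refine integral_congr_ae (Eventually.of_forall fun y => ?_)
          simp only
          rw [← integral_mul_const]
          refine integral_congr_ae (Eventually.of_forall fun t => ?_)
          simp only; ring
  have hη' : Complex.I * (-η : ℝ) ≠ 0 :=
    mul_ne_zero Complex.I_ne_zero (by exact_mod_cast neg_ne_zero.2 hη)
  -- An elementary exponential integral between 0 and y; its constant -1 is annihilated by the
  -- mean-zero condition.
  have h3 : ∀ y, Complex.I * η * ∫ t, (primKernel t y : ℂ) * planeWave (-η) t =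
      planeWave (-η) y - 1 := fun y => by
    rw [integral_primKernel_mul]
    simp only [planeWave]
    rw [integral_exp_mul_complex hη']
    have hη2 : (η : ℂ) ≠ 0 := by exact_mod_cast hη
    have := Complex.I_ne_zero
    push_cast
    field_simp
    simp
  rw [h2, ← integral_const_mul]
  have h4 : ∀ y, Complex.I * η * ((∫ t, (primKernel t y : ℂ) * planeWave (-η) t) * F y) =
      planeWave (-η) y * F y - F y := fun y => by
    rw [← mul_assoc, h3]; ring
  simp only [h4]
  rw [integral_sub (integrable_planeWave_mul hF _) hF, h0, sub_zero, fourierIntegral]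

end Prim

/-! ### The Hermitian part of the kernels -/

/-- The common Hermitian part of the kernels `G_{l ± 0i}`. -/
def hermKernel (l z : ℝ) : ℂ :=
  Complex.I / 2 * (Real.sign z : ℂ) * planeWave l z - kernelTilde l z

lemma measurable_sign : Measurable Real.sign := by
  unfold Real.sign
  exact Measurable.ite (measurableSet_lt measurable_id measurable_const) measurable_const
    (Measurable.ite (measurableSet_lt measurable_const measurable_id) measurable_const
      measurable_const)

lemma abs_sign_le (z : ℝ) : |Real.sign z| ≤ 1 := by
  rcases Real.sign_apply_eq z with h | h | h <;> simp [h]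

lemma norm_half_I_sign_le (z : ℝ) : ‖Complex.I / 2 * (Real.sign z : ℂ)‖ ≤ 1 := by
  rw [norm_mul, Complex.norm_real, Real.norm_eq_abs]
  have := abs_sign_le z
  simp only [norm_div, Complex.norm_I, Complex.norm_ofNat]
  linarith

lemma exists_isKernelBound_hermKernel {l : ℝ} (hl : 0 < l) :
    ∃ C, IsKernelBound (hermKernel l) C := by
  obtain ⟨C, h⟩ := exists_isKernelBound_kernelTilde hl
  refine ⟨C + 1, ⟨?_, by linarith [h.nonneg], fun z hz => ?_⟩⟩
  · exact (((Complex.measurable_ofReal.comp measurable_sign).const_mul _).mul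
      (continuous_planeWave l).measurable).sub h.measurable
  · rw [hermKernel]
    refine (norm_sub_le _ _).trans ?_
    rw [norm_mul, norm_planeWave, mul_one]
    have h1 := norm_half_I_sign_le z
    have h2 := h.norm_le z hz
    nlinarith [singularPart_nonneg z]

lemma hermKernel_neg {l z : ℝ} (hl : 0 < l) (hz : z ≠ 0) :
    hermKernel l (-z) = (starRingEnd ℂ) (hermKernel l z) := by
  have h : planeWave l (-z) = (starRingEnd ℂ) (planeWave l z) := by
    rw [← planeWave_neg]; simp [planeWave]
  rw [hermKernel, hermKernel, kernelTilde_neg hl hz, h, Real.sign_neg, map_sub, map_mul, map_mul,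
    map_div₀, Complex.conj_I, Complex.conj_ofReal, map_ofNat]
  push_cast
  ring

/-- The one-sided step is split into an odd part, common to both signs and Hermitian after
multiplication by i and the plane wave, and a constant that carries the sign. -/
lemma kernelJump_eq (σ : ℤˣ) {z : ℝ} (hz : z ≠ 0) :
    kernelJump σ z = Complex.I / 2 * (Real.sign z : ℂ) + ((σ : ℤ) : ℂ) * Complex.I / 2 := by
  rw [kernelJump]
  rcases lt_or_gt_of_ne hz with h | h
  · rw [Real.sign_of_neg h]
    rcases Int.units_eq_one_or σ with hσ | hσ
    · rw [indicator_of_notMem (by simp [hσ]; linarith)]; simp [hσ]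
    · rw [indicator_of_mem (by simp [hσ]; linarith)]; simp [hσ]; ring
  · rw [Real.sign_of_pos h]
    rcases Int.units_eq_one_or σ with hσ | hσ
    · rw [indicator_of_mem (by simp [hσ]; linarith)]; simp [hσ]
    · rw [indicator_of_notMem (by simp [hσ]; linarith)]; simp [hσ]; ring

section

variable {f : ℝ → ℂ} {l : ℝ}

lemma integral_planeWave_sub_mul (f : ℝ → ℂ) (l x : ℝ) :
    ∫ y, planeWave l (x - y) * f y = planeWave l x * fourierIntegral f l := by
  rw [fourierIntegral, ← integral_const_mul]
  refine integral_congr_ae (Eventually.of_forall fun y => ?_)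
  simp only [planeWave_sub_right, mul_assoc]

lemma integrable_planeWave_sub_mul (hf : Integrable f) (l x : ℝ) :
    Integrable fun y => planeWave l (x - y) * f y := by
  refine ((integrable_planeWave_mul hf (-l)).const_mul (planeWave l x)).congr
    (Eventually.of_forall fun y => ?_)
  simp only [planeWave_sub_right, mul_assoc]

lemma integral_kernel_mul (hl : 0 < l) (hf : Integrable f) (hf2 : Integrable fun y => ‖f y‖ ^ 2)
    (σ : ℤˣ) (x : ℝ) :
    ∫ y, kernel σ l (x - y) * f y = (∫ y, hermKernel l (x - y) * f y) +
      ((σ : ℤ) : ℂ) * Complex.I / 2 * (planeWave l x * fourierIntegral f l) := by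
  obtain ⟨C, hC⟩ := exists_isKernelBound_hermKernel hl
  rw [← integral_planeWave_sub_mul, ← integral_const_mul,
    ← integral_add (hC.integrable hf hf2 x) ((integrable_planeWave_sub_mul hf l x).const_mul _)]
  refine integral_congr_ae ?_
  filter_upwards [Measure.ae_ne volume x] with y hy
  rw [kernel_eq, kernelJump_eq σ (sub_ne_zero.2 hy.symm), hermKernel]
  ring

/-- Since the conjugated function has mean zero, the sign kernel acts on it as taking the primitive.
The non-decaying part of the convolution disappears; this is what makes the decay bootstrap
possible. -/
lemma integral_hermKernel_mul (hl : 0 < l) (hf : Integrable f)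
    (hf2 : Integrable fun y => ‖f y‖ ^ 2) (h0 : fourierIntegral f l = 0) (x : ℝ) :
    ∫ y, hermKernel l (x - y) * f y =
      Complex.I * planeWave l x * prim (fun y => planeWave (-l) y * f y) x -
        ∫ y, kernelTilde l (x - y) * f y := by
  obtain ⟨C, hC⟩ := exists_isKernelBound_kernelTilde hl
  have hF := integrable_planeWave_mul hf (-l)
  set c : ℂ := if 0 ≤ x then 1 / 2 else -(1 / 2) with hc
  have h1 : ∫ y, hermKernel l (x - y) * f y =
      ∫ y, (Complex.I * planeWave l x * ((primKernel x y : ℂ) * (planeWave (-l) y * f y)) +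
        Complex.I * planeWave l x * c * (planeWave (-l) y * f y)) - kernelTilde l (x - y) * f y := by
    refine integral_congr_ae ?_
    filter_upwards [Measure.ae_ne volume x] with y hy
    have h2 : (Real.sign (x - y) : ℂ) = 2 * ((primKernel x y : ℂ) + c) := by
      have h3 := congrArg (fun t : ℝ => (t : ℂ)) (half_sign_sub hy)
      have h4 : c = (((if 0 ≤ x then 1 / 2 else -(1 / 2) : ℝ)) : ℂ) := by
        rw [hc]; split_ifs <;> norm_num
      rw [h4]
      push_cast at h3 ⊢
      rw [← h3]; ring
    rw [hermKernel, h2, planeWave_sub_right]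
    ring
  have e1 := (integrable_primKernel_mul hF x).const_mul (Complex.I * planeWave l x)
  have e2 := hF.const_mul (Complex.I * planeWave l x * c)
  have e3 := hC.integrable hf hf2 x
  have h5 := integral_sub (e1.add e2) e3
  have h6 := integral_add e1 e2
  simp only [Pi.add_apply] at h5
  rw [h1, h5, h6, integral_const_mul, integral_const_mul, ← prim]
  rw [fourierIntegral] at h0
  rw [h0, mul_zero, add_zero]

/-- The Hermitian form of the kernel `hermKernel`. -/
def hermForm (l : ℝ) (f : ℝ → ℂ) (p : ℝ × ℝ) : ℂ :=
  (starRingEnd ℂ) (f p.1) * (hermKernel l (p.1 - p.2) * f p.2)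

lemma hermForm_swap (hl : 0 < l) (f : ℝ → ℂ) :
    ∀ᵐ p ∂((volume : Measure ℝ).prod volume),
      hermForm l f p.swap = (starRingEnd ℂ) (hermForm l f p) := by
  filter_upwards [ae_prod_ne] with p hp
  simp only [hermForm, Prod.fst_swap, Prod.snd_swap, map_mul, Complex.conj_conj]
  rw [← neg_sub p.1 p.2, hermKernel_neg hl (sub_ne_zero.2 hp)]
  ring

lemma integrable_hermForm (hl : 0 < l) (hf : Integrable f)
    (hf2 : Integrable fun y => ‖f y‖ ^ 2) :
    Integrable (hermForm l f) (volume.prod volume) := by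
  obtain ⟨C, hC⟩ := exists_isKernelBound_hermKernel hl
  exact hC.integrable_prod (integrable_conj hf) hf hf2

lemma integral_hermForm (hl : 0 < l) (hf : Integrable f)
    (hf2 : Integrable fun y => ‖f y‖ ^ 2) :
    ∫ p, hermForm l f p ∂(volume.prod volume) =
      ∫ x, (starRingEnd ℂ) (f x) * ∫ y, hermKernel l (x - y) * f y := by
  rw [integral_prod _ (integrable_hermForm hl hf hf2)]
  simp only [hermForm, integral_const_mul]

/-- If `conj f (G_{l ± 0i} * f)` is real, then the Fourier transform of `f` vanishes at `l`. -/
lemma fourierIntegral_eq_zero_of_im_eq_zero (hl : 0 < l) (hf : Integrable f)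
    (hf2 : Integrable fun y => ‖f y‖ ^ 2) (σ : ℤˣ)
    (hreal : ∀ᵐ x, ((starRingEnd ℂ) (f x) * ∫ y, kernel σ l (x - y) * f y).im = 0) :
    fourierIntegral f l = 0 := by
  have h1 : (∫ x, (starRingEnd ℂ) (f x) * ∫ y, kernel σ l (x - y) * f y).im = 0 := by
    rw [← Complex.conj_eq_iff_im, ← integral_conj]
    refine integral_congr_ae ?_
    filter_upwards [hreal] with x hx using Complex.conj_eq_iff_im.2 hx
  have e1 : Integrable fun x => (starRingEnd ℂ) (f x) * ∫ y, hermKernel l (x - y) * f y := by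
    refine (integrable_hermForm hl hf hf2).integral_prod_left.congr
      (Eventually.of_forall fun x => ?_)
    simp only [hermForm, integral_const_mul]
  -- The Hermitian part contributes a real number, and the remaining kernel ±(i/2) e^{il(x-y)}
  -- factorises into ±(i/2)|f̂(l)|². Comparison of imaginary parts isolates f̂(l).
  have h2 : ∫ x, (starRingEnd ℂ) (f x) * ∫ y, kernel σ l (x - y) * f y =
      (∫ p, hermForm l f p ∂(volume.prod volume)) + ((σ : ℤ) : ℂ) * Complex.I / 2 *
        ((‖fourierIntegral f l‖ ^ 2 : ℝ) : ℂ) := by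
    rw [integral_hermForm hl hf hf2, Complex.ofReal_pow, ← Complex.mul_conj', conj_fourierIntegral,
      ← mul_assoc, ← integral_const_mul,
      ← integral_add e1 ((integrable_planeWave_mul (integrable_conj hf) l).const_mul _)]
    refine integral_congr_ae (Eventually.of_forall fun x => ?_)
    simp only
    rw [integral_kernel_mul hl hf hf2]
    ring
  rw [h2, Complex.add_im, im_integral_eq_zero_of_hermitian (hermForm_swap hl f), zero_add] at h1
  have h3 : ‖fourierIntegral f l‖ ^ 2 = 0 := by
    generalize ‖fourierIntegral f l‖ ^ 2 = r at h1 ⊢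
    rcases Int.units_eq_one_or σ with hσ | hσ <;> simpa [hσ] using h1
  simpa using h3

/-- The Fourier representation of `z G̃(z)`, applied to the sesquilinear form. -/
lemma integral_mul_kernelTilde_form (hl : 0 < l) (hf : Integrable f) :
    Integrable (fun p : ℝ × ℝ => (((p.1 - p.2 : ℝ) : ℂ) * kernelTilde l (p.1 - p.2)) *
      ((starRingEnd ℂ) (f p.1) * f p.2)) (volume.prod volume) ∧
    2 * Real.pi * Complex.I * ∫ p : ℝ × ℝ, (((p.1 - p.2 : ℝ) : ℂ) * kernelTilde l (p.1 - p.2)) *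
      ((starRingEnd ℂ) (f p.1) * f p.2) ∂(volume.prod volume) =
      (((∫ ξ in Iic (0 : ℝ), ‖fourierIntegral f ξ‖ ^ 2 / (l - ξ) ^ 2) -
        ‖fourierIntegral f 0‖ ^ 2 / l : ℝ) : ℂ) := by
  set q : ℝ → ℂ := fun x =>
    ∫ ξ in Iic (0 : ℝ), Complex.exp (Complex.I * x * ξ) / ((ξ : ℂ) - l) ^ 2 with hq
  have hqc : Continuous q := continuous_integral_exp_div_sq hl
  have hr : IntegrableOn (fun ξ : ℝ => 1 / ((ξ : ℂ) - l) ^ 2) (Iic 0) := by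
    simpa using integrableOn_exp_div_sq hl 0
  have hq' : ∀ x y, q (x - y) = ∫ ξ in Iic (0 : ℝ),
      planeWave (-ξ) y * (planeWave ξ x * (1 / ((ξ : ℂ) - l) ^ 2)) := fun x y => by
    refine integral_congr_ae (Eventually.of_forall fun ξ => ?_)
    simp only
    have : Complex.exp (Complex.I * (x - y : ℝ) * ξ) = planeWave ξ x * planeWave (-ξ) y := by
      rw [← planeWave_sub_right, planeWave]; congr 1; ring
    rw [this]; ring
  have hqb : ∀ x, ‖q x‖ ≤ 1 / l := fun x => by
    rw [← integral_one_div_sq hl]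
    refine norm_integral_le_of_norm_le (integrableOn_one_div_sq hl) ?_
    refine (ae_restrict_iff' measurableSet_Iic).2 (Eventually.of_forall fun ξ h => le_of_eq ?_)
    rw [norm_div, norm_exp_I_mul_mul, norm_pow, norm_ofReal_sub_ofReal_of_le hl h]
  have hfc := integrable_conj hf
  have i1 : Integrable (fun p : ℝ × ℝ => q (p.1 - p.2) * ((starRingEnd ℂ) (f p.1) * f p.2))
      (volume.prod volume) :=
    integrable_prod_of_bounded hfc hf (M := fun x y => q (x - y))
      (hqc.comp (continuous_fst.sub continuous_snd)).aestronglyMeasurable (fun x y => hqb _)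
  have i2 : Integrable (fun p : ℝ × ℝ => (1 / l : ℂ) * ((starRingEnd ℂ) (f p.1) * f p.2))
      (volume.prod volume) := (hfc.mul_prod hf).const_mul _
  have hpi : (Real.pi : ℂ) ≠ 0 := by exact_mod_cast Real.pi_ne_zero
  have hI := Complex.I_ne_zero
  have e1 : (fun p : ℝ × ℝ => (1 / (2 * Real.pi * Complex.I)) *
        (q (p.1 - p.2) * ((starRingEnd ℂ) (f p.1) * f p.2) -
        (1 / l : ℂ) * ((starRingEnd ℂ) (f p.1) * f p.2))) =ᵐ[volume.prod volume]
      fun p => (((p.1 - p.2 : ℝ) : ℂ) * kernelTilde l (p.1 - p.2)) *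
      ((starRingEnd ℂ) (f p.1) * f p.2) := by
    filter_upwards [ae_prod_ne] with p hp
    have h1 := mul_kernelTilde hl (sub_ne_zero.2 hp)
    have h2 : q (p.1 - p.2) = 2 * Real.pi * Complex.I * (p.1 - p.2 : ℝ) *
        kernelTilde l (p.1 - p.2) + 1 / l := by rw [h1, hq]; ring
    rw [h2]
    field_simp
    ring
  refine ⟨((i1.sub i2).const_mul _).congr e1, ?_⟩
  rw [← integral_congr_ae e1, integral_const_mul, integral_sub i1 i2, ← mul_assoc,
    mul_one_div_cancel (mul_ne_zero (mul_ne_zero two_ne_zero hpi) hI), one_mul]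
  rw [Complex.ofReal_sub]
  congr 1
  · rw [integral_prod _ i1]
    have h1 : ∀ x, ∫ y, q (x - y) * ((starRingEnd ℂ) (f x) * f y) = (starRingEnd ℂ) (f x) *
        ∫ ξ in Iic (0 : ℝ), planeWave ξ x * ((1 / ((ξ : ℂ) - l) ^ 2) * fourierIntegral f ξ) := by
      intro x
      have h2 := integral_mul_integral_swap (μ := volume) (ν := volume.restrict (Iic (0 : ℝ)))
        (a := f) (b := fun ξ => planeWave ξ x * (1 / ((ξ : ℂ) - l) ^ 2))
        (M := fun y ξ => planeWave (-ξ) y) (C := 1) hf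
        (hr.bdd_mul (c := 1) (by
          have : Continuous fun ξ => planeWave ξ x := by unfold planeWave; fun_prop
          exact this.aestronglyMeasurable)
          (Eventually.of_forall fun ξ => (norm_planeWave _ _).le))
        (by
          have : Continuous fun p : ℝ × ℝ => planeWave (-p.2) p.1 := by unfold planeWave; fun_prop
          exact this.aestronglyMeasurable) (fun x y => (norm_planeWave _ _).le)
      simp only [← hq'] at h2
      calc _ = (starRingEnd ℂ) (f x) * ∫ y, f y * q (x - y) := by
            rw [← integral_const_mul]
            refine integral_congr_ae (Eventually.of_forall fun y => ?_)
            simp only; ring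
        _ = _ := by
            rw [h2]
            congr 1
            refine integral_congr_ae (Eventually.of_forall fun ξ => ?_)
            simp only [fourierIntegral]; ring
    simp only [h1]
    have hg : IntegrableOn (fun ξ : ℝ => (1 / ((ξ : ℂ) - l) ^ 2) * fourierIntegral f ξ) (Iic 0) :=
      hr.mul_bdd (c := ∫ y, ‖f y‖) (continuous_fourierIntegral hf).aestronglyMeasurable
        (Eventually.of_forall fun ξ => norm_fourierIntegral_le f ξ)
    rw [integral_mul_integral_swap (M := fun x ξ => planeWave ξ x) (C := 1) hfc hg
      (by
        have : Continuous fun p : ℝ × ℝ => planeWave p.2 p.1 := by unfold planeWave; fun_prop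
        exact this.aestronglyMeasurable) (fun x y => (norm_planeWave _ _).le),
      ← integral_complex_ofReal]
    refine integral_congr_ae (Eventually.of_forall fun ξ => ?_)
    simp only
    rw [← conj_fourierIntegral]
    push_cast
    rw [← Complex.conj_mul', ← neg_sub (l : ℂ) ξ, neg_sq]
    ring
  · rw [integral_const_mul, integral_prod_mul (fun x => (starRingEnd ℂ) (f x)) f, integral_conj, fourierIntegral_zero]
    push_cast
    rw [← Complex.conj_mul']
    ring

/-- The commutator identity that excludes embedded eigenvalues. -/
lemma integral_norm_prim_sq_le (hl : 0 < l) (hf : Integrable f)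
    (hf2 : Integrable fun y => ‖f y‖ ^ 2) (hf1 : Integrable fun y => |y| * ‖f y‖)
    (h0 : fourierIntegral f l = 0)
    (hreal : ∀ᵐ x, ((starRingEnd ℂ) (f x) * ∫ y, hermKernel l (x - y) * f y).im = 0) :
    2 * Real.pi * ∫ t, ‖prim (fun y => planeWave (-l) y * f y) t‖ ^ 2 ≤
      ∫ ξ in Iic (0 : ℝ), ‖fourierIntegral f ξ‖ ^ 2 / (l - ξ) ^ 2 := by
  obtain ⟨C, hC⟩ := exists_isKernelBound_hermKernel hl
  set F : ℝ → ℂ := fun y => planeWave (-l) y * f y with hF'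
  have hF : Integrable F := integrable_planeWave_mul hf (-l)
  have hFn : ∀ y, ‖F y‖ = ‖f y‖ := fun y => by rw [hF', norm_mul, norm_planeWave, one_mul]
  have hF1 : Integrable fun y => |y| * ‖F y‖ := by simpa only [hFn] using hf1
  have hxf : Integrable fun x : ℝ => (x : ℂ) * (starRingEnd ℂ) (f x) := by
    refine Integrable.mono' hf1 ?_ (Eventually.of_forall fun y => ?_)
    · exact Complex.continuous_ofReal.aestronglyMeasurable.mul (integrable_conj hf).1
    · rw [norm_mul, Complex.norm_real, Real.norm_eq_abs, RCLike.norm_conj]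
  have hxP : Integrable (fun p : ℝ × ℝ => (p.1 : ℂ) * hermForm l f p) (volume.prod volume) := by
    refine (hC.integrable_prod hxf hf hf2).congr (Eventually.of_forall fun p => ?_)
    simp only [hermForm]; ring
  obtain ⟨-, h1⟩ := integral_sub_mul_of_hermitian (hermForm_swap hl f) hxP
  -- Multiplication by the real coordinate preserves the pointwise reality in `hreal`, so the
  -- commutator with x has vanishing expectation.
  have h2 : (∫ p : ℝ × ℝ, (p.1 : ℂ) * hermForm l f p ∂(volume.prod volume)).im = 0 := by
    rw [integral_prod _ hxP, ← Complex.conj_eq_iff_im, ← integral_conj]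
    refine integral_congr_ae ?_
    filter_upwards [hreal] with x hx
    simp only [hermForm]
    rw [Complex.conj_eq_iff_im, integral_const_mul, integral_const_mul, Complex.im_ofReal_mul, hx,
      mul_zero]
  rw [h2, Complex.ofReal_zero, mul_zero] at h1
  obtain ⟨i2, e2⟩ := integral_mul_kernelTilde_form hl hf
  have h00 : ∫ y, F y = 0 := h0
  have i1 := integrable_abs_sub_mul hF hF1
  have e1 := integral_abs_sub_mul hF hF1 h00
  -- The factor x - y turns the sign into |x - y|, whose form is -2 times the squared norm of the
  -- primitive, and it makes the Fourier integral of the other part absolutely convergent.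
  have h3 : ∫ p : ℝ × ℝ, ((p.1 : ℂ) - p.2) * hermForm l f p ∂(volume.prod volume) =
      Complex.I / 2 * (∫ p : ℝ × ℝ, ((|p.1 - p.2| : ℝ) : ℂ) * ((starRingEnd ℂ) (F p.1) * F p.2)
        ∂(volume.prod volume)) - ∫ p : ℝ × ℝ, (((p.1 - p.2 : ℝ) : ℂ) * kernelTilde l (p.1 - p.2)) *
      ((starRingEnd ℂ) (f p.1) * f p.2) ∂(volume.prod volume) := by
    rw [← integral_const_mul, ← integral_sub (i1.const_mul _) i2]
    refine integral_congr_ae (Eventually.of_forall fun p => ?_)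
    have h4 : ((p.1 - p.2 : ℝ) : ℂ) * (Real.sign (p.1 - p.2) : ℂ) = ((|p.1 - p.2| : ℝ) : ℂ) := by
      rw [← Complex.ofReal_mul]
      congr 1
      rcases lt_trichotomy (p.1 - p.2) 0 with h | h | h
      · rw [Real.sign_of_neg h, abs_of_neg h]; ring
      · rw [h]; simp
      · rw [Real.sign_of_pos h, abs_of_pos h]; ring
    simp only [hermForm, hermKernel, hF', map_mul, ← planeWave_neg, neg_neg, ← h4]
    rw [planeWave_sub_right]
    push_cast
    ring
  rw [h1, e1] at h3
  set A : ℝ := ∫ t, ‖prim F t‖ ^ 2 with hA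
  set J : ℝ := ∫ ξ in Iic (0 : ℝ), ‖fourierIntegral f ξ‖ ^ 2 / (l - ξ) ^ 2 with hJ
  have h5 : ((2 * Real.pi * A : ℝ) : ℂ) = ((J - ‖fourierIntegral f 0‖ ^ 2 / l : ℝ) : ℂ) := by
    have h6 : ∀ T : ℂ, 0 = Complex.I / 2 * (-2 * (A : ℂ)) - T → T = -Complex.I * A := by
      intro T hT; linear_combination hT
    rw [← e2, h6 _ h3]
    push_cast
    linear_combination (2 * Real.pi * A : ℂ) * Complex.I_sq
  -- An exact identity; only the sign of its last term is needed.
  have h7 : 2 * Real.pi * A = J - ‖fourierIntegral f 0‖ ^ 2 / l := by exact_mod_cast h5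
  have : 0 ≤ ‖fourierIntegral f 0‖ ^ 2 / l := by positivity
  linarith

end

/-! ### Absence of embedded eigenvalues -/

section

variable {f : ℝ → ℂ} {l : ℝ}

/-- The Fourier transform of `f` divided by `ξ - l`, cut off to `(-R, 0]`. -/
def truncSymbol (l R : ℝ) (f : ℝ → ℂ) : ℝ → ℂ :=
  indicator (Ioc (-R) 0) fun ξ => fourierIntegral f ξ / ((ξ : ℂ) - l)

lemma continuousOn_fourierIntegral_div (hl : 0 < l) (hf : Integrable f) :
    ContinuousOn (fun ξ : ℝ => fourierIntegral f ξ / ((ξ : ℂ) - l)) (Iic 0) :=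
  (continuous_fourierIntegral hf).continuousOn.div (by fun_prop)
    fun _ h => ofReal_sub_ofReal_ne_zero hl h

lemma integrable_truncSymbol (hl : 0 < l) (R : ℝ) (hf : Integrable f) :
    Integrable (truncSymbol l R f) := by
  refine (integrable_indicator_iff measurableSet_Ioc).2 ?_
  exact (((continuousOn_fourierIntegral_div hl hf).mono Icc_subset_Iic_self).integrableOn_Icc
    (a := -R)).mono_set Ioc_subset_Icc_self

lemma norm_truncSymbol_sq (hl : 0 < l) (R : ℝ) (f : ℝ → ℂ) (ξ : ℝ) :
    ‖truncSymbol l R f ξ‖ ^ 2 =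
      indicator (Ioc (-R) 0) (fun ξ => ‖fourierIntegral f ξ‖ ^ 2 / (l - ξ) ^ 2) ξ := by
  rw [truncSymbol]
  by_cases h : ξ ∈ Ioc (-R) 0
  · rw [indicator_of_mem h, indicator_of_mem h, norm_div, norm_ofReal_sub_ofReal_of_le hl h.2,
      div_pow]
  · rw [indicator_of_notMem h, indicator_of_notMem h]; simp

lemma integrableOn_fourierIntegral_sq_div (hl : 0 < l) (hf : Integrable f) :
    IntegrableOn (fun ξ => ‖fourierIntegral f ξ‖ ^ 2 / (l - ξ) ^ 2) (Iic 0) := by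
  have h := (integrableOn_one_div_sq hl).bdd_mul (f := fun ξ => ‖fourierIntegral f ξ‖ ^ 2)
    (c := (∫ y, ‖f y‖) ^ 2) ((continuous_fourierIntegral hf).norm.pow 2).aestronglyMeasurable
    (Eventually.of_forall fun ξ => by
      rw [Real.norm_eq_abs, abs_of_nonneg (by positivity)]
      gcongr
      exact norm_fourierIntegral_le f ξ)
  exact h.congr (Eventually.of_forall fun ξ => by simp only; ring)

lemma integrable_norm_truncSymbol_sq (hl : 0 < l) (R : ℝ) (hf : Integrable f) :
    Integrable fun ξ => ‖truncSymbol l R f ξ‖ ^ 2 := by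
  simp only [norm_truncSymbol_sq hl]
  exact (integrable_indicator_iff measurableSet_Ioc).2
    ((integrableOn_fourierIntegral_sq_div hl hf).mono_set Ioc_subset_Iic_self)

/-- The truncated kernel is a Fourier multiplier with integrable, compactly supported symbol, so
Fubini applies directly and the Bessel inequality bounds the result in L². -/
lemma integral_kernelTrunc_mul (hl : 0 < l) {R : ℝ} (hR : 0 ≤ R) (hf : Integrable f) (x : ℝ) :
    ∫ y, kernelTrunc l R (x - y) * f y =
      (1 / (2 * Real.pi) : ℂ) * ∫ ξ, planeWave ξ x * truncSymbol l R f ξ := by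
  have h1 : ∀ y, kernelTrunc l R (x - y) = (1 / (2 * Real.pi) : ℂ) *
      ∫ ξ in Ioc (-R) 0, planeWave (-ξ) y * (planeWave ξ x / ((ξ : ℂ) - l)) := fun y => by
    rw [kernelTrunc, intervalIntegral.integral_of_le (by linarith)]
    congr 1
    refine integral_congr_ae (Eventually.of_forall fun ξ => ?_)
    simp only
    have : Complex.exp (Complex.I * (x - y : ℝ) * ξ) = planeWave ξ x * planeWave (-ξ) y := by
      rw [← planeWave_sub_right, planeWave]; congr 1; ring
    rw [this]; ring
  have hb : IntegrableOn (fun ξ : ℝ => planeWave ξ x / ((ξ : ℂ) - l)) (Ioc (-R) 0) := by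
    have hc : ContinuousOn (fun ξ : ℝ => planeWave ξ x / ((ξ : ℂ) - l)) (Icc (-R) 0) := by
      unfold planeWave
      exact ContinuousOn.div (by fun_prop) (by fun_prop)
        fun ξ h => ofReal_sub_ofReal_ne_zero hl h.2
    exact hc.integrableOn_Icc.mono_set Ioc_subset_Icc_self
  have h2 := integral_mul_integral_swap (μ := volume) (ν := volume.restrict (Ioc (-R) 0)) hf hb
    (M := fun y ξ => planeWave (-ξ) y) (C := 1)
    (by
      have : Continuous fun p : ℝ × ℝ => planeWave (-p.2) p.1 := by unfold planeWave; fun_prop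
      exact this.aestronglyMeasurable) (fun x y => (norm_planeWave _ _).le)
  calc _ = ∫ y, (1 / (2 * Real.pi) : ℂ) * (f y *
        ∫ ξ in Ioc (-R) 0, planeWave (-ξ) y * (planeWave ξ x / ((ξ : ℂ) - l))) := by
        refine integral_congr_ae (Eventually.of_forall fun y => ?_)
        simp only [h1]; ring
    _ = _ := by
        rw [integral_const_mul, h2, ← integral_indicator measurableSet_Ioc]
        congr 1
        refine integral_congr_ae (Eventually.of_forall fun ξ => ?_)
        simp only [truncSymbol]
        by_cases h : ξ ∈ Ioc (-R) 0
        · rw [indicator_of_mem h, indicator_of_mem h, ← fourierIntegral]; ring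
        · rw [indicator_of_notMem h, indicator_of_notMem h, mul_zero]

lemma tendsto_integral_kernelTrunc_mul (hl : 0 < l) (hf : Integrable f)
    (hf2 : Integrable fun y => ‖f y‖ ^ 2) (x : ℝ) :
    Tendsto (fun n : ℕ => ∫ y, kernelTrunc l n (x - y) * f y) atTop
      (𝓝 (∫ y, kernelTilde l (x - y) * f y)) := by
  obtain ⟨C, hC⟩ := exists_isKernelBound_kernelTrunc hl
  refine tendsto_integral_of_dominated_convergence _
    (fun n => ((hC n n.cast_nonneg).integrable hf hf2 x).1)
    ((IsKernelBound.integrable_dom hf hf2 x).1.const_mul C) (fun n => ?_) ?_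
  · filter_upwards [(hC n n.cast_nonneg).ae_norm_mul_le f x] with y hy
    rwa [norm_mul]
  · filter_upwards [Measure.ae_ne volume x] with y hy
    exact ((tendsto_kernelTrunc hl (sub_ne_zero.2 hy.symm)).comp
      tendsto_natCast_atTop_atTop).mul_const _

/-- The convolution is E minus its negative-frequency part, and the commutator estimate says that
the norm of E does not exceed that of this part. The statement is proved with frequencies cut off at
-n, where the error is (J - J_n)/2π. -/
lemma hermKernel_conv_eq_zero (hl : 0 < l) (hf : Integrable f)
    (hf2 : Integrable fun y => ‖f y‖ ^ 2) (hf1 : Integrable fun y => |y| * ‖f y‖)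
    (h0 : fourierIntegral f l = 0)
    (hreal : ∀ᵐ x, ((starRingEnd ℂ) (f x) * ∫ y, hermKernel l (x - y) * f y).im = 0) :
    ∀ᵐ x, ∫ y, hermKernel l (x - y) * f y = 0 := by
  have hineq := integral_norm_prim_sq_le hl hf hf2 hf1 h0 hreal
  set F : ℝ → ℂ := fun y => planeWave (-l) y * f y with hF'
  have hF : Integrable F := integrable_planeWave_mul hf (-l)
  have hFn : ∀ y, ‖F y‖ = ‖f y‖ := fun y => by rw [hF', norm_mul, norm_planeWave, one_mul]
  have hF1 : Integrable fun y => |y| * ‖F y‖ := by simpa only [hFn] using hf1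
  have h00 : ∫ y, F y = 0 := h0
  have hpi := Real.pi_pos
  set E : ℝ → ℂ := fun x => Complex.I * planeWave l x * prim F x with hE'
  have hE : Integrable E := by
    refine ((integrable_planeWave_mul (integrable_prim hF hF1) l).const_mul Complex.I).congr
      (Eventually.of_forall fun x => ?_)
    simp only [hE']; ring
  have hEn : ∀ x, ‖E x‖ = ‖prim F x‖ := fun x => by
    rw [hE', norm_mul, norm_mul, norm_planeWave, Complex.norm_I, one_mul, one_mul]
  have hE2 : Integrable fun x => ‖E x‖ ^ 2 := by
    simpa only [hEn] using integrable_norm_prim_sq hF hF1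
  -- The plane wave in E shifts the frequency by l, and the primitive divides by i(ξ - l), which is
  -- nonzero for ξ ≤ 0 < l.
  have hEft : ∀ ξ ≤ 0, fourierIntegral E ξ = fourierIntegral f ξ / ((ξ : ℂ) - l) := by
    intro ξ hξ
    have h1 : fourierIntegral E ξ = Complex.I * fourierIntegral (prim F) (ξ - l) := by
      rw [fourierIntegral, fourierIntegral, ← integral_const_mul]
      refine integral_congr_ae (Eventually.of_forall fun x => ?_)
      simp only [hE']
      rw [neg_sub, sub_eq_add_neg, planeWave_add]; ring
    have h2 : fourierIntegral F (ξ - l) = fourierIntegral f ξ := by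
      refine integral_congr_ae (Eventually.of_forall fun x => ?_)
      simp only [hF']
      rw [← mul_assoc, ← planeWave_add]
      congr 2; ring
    rw [eq_div_iff (ofReal_sub_ofReal_ne_zero hl hξ), h1, ← h2,
      ← fourierIntegral_prim hF hF1 h00 (by linarith)]
    push_cast; ring
  set J : ℝ := ∫ ξ in Iic (0 : ℝ), ‖fourierIntegral f ξ‖ ^ 2 / (l - ξ) ^ 2 with hJ
  set Jn : ℕ → ℝ := fun n => ∫ ξ, ‖truncSymbol l n f ξ‖ ^ 2 with hJn
  have hJlim : Tendsto Jn atTop (𝓝 J) := by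
    have h1 := intervalIntegral_tendsto_integral_Iic 0 (integrableOn_fourierIntegral_sq_div hl hf)
      (tendsto_neg_atTop_atBot.comp tendsto_natCast_atTop_atTop (α := ℕ))
    refine h1.congr fun n => ?_
    simp only [hJn, norm_truncSymbol_sq hl]
    rw [integral_indicator measurableSet_Ioc, intervalIntegral.integral_of_le (by simp)]
    rfl
  set A : ℕ → ℝ → ℂ := fun n x => ∫ y, kernelTrunc l n (x - y) * f y with hA
  set m : ℝ → ℂ := fun x => ∫ y, hermKernel l (x - y) * f y with hm
  have hlim : ∀ x, Tendsto (fun n => ‖E x - A n x‖ ^ 2) atTop (𝓝 (‖m x‖ ^ 2)) := fun x => by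
    have h1 : m x = E x - ∫ y, kernelTilde l (x - y) * f y :=
      integral_hermKernel_mul hl hf hf2 h0 x
    rw [h1]
    exact ((tendsto_const_nhds.sub (tendsto_integral_kernelTrunc_mul hl hf hf2 x)).norm).pow 2
  -- Expand the square: ‖E‖² ≤ J/2π by the commutator estimate, ‖A_n‖² ≤ J_n/2π by Bessel, and the
  -- cross term ⟨E, A_n⟩ equals J_n/2π because the transforms of E and A_n agree on (-n, 0].
  have hest : ∀ n, Integrable (fun x => ‖E x - A n x‖ ^ 2) ∧
      ∫ x, ‖E x - A n x‖ ^ 2 ≤ (J - Jn n) / (2 * Real.pi) := by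
    intro n
    have hg := integrable_truncSymbol hl n hf
    have hg2 := integrable_norm_truncSymbol_sq hl n hf
    obtain ⟨b1, b2⟩ := bessel_fourier hg hg2
    have hAn : ∀ x, A n x = (1 / (2 * Real.pi) : ℂ) * ∫ ξ, planeWave ξ x * truncSymbol l n f ξ :=
      fun x => integral_kernelTrunc_mul hl n.cast_nonneg hf x
    have hAsq : ∀ x, ‖A n x‖ ^ 2 =
        1 / (2 * Real.pi) ^ 2 * ‖∫ ξ, planeWave ξ x * truncSymbol l n f ξ‖ ^ 2 := fun x => by
      rw [hAn, norm_mul, mul_pow]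
      congr 1
      simp [abs_of_pos hpi, mul_pow]
    have hA2 : Integrable fun x => ‖A n x‖ ^ 2 := by
      simp only [hAsq]; exact b1.const_mul _
    have hA2le : ∫ x, ‖A n x‖ ^ 2 ≤ Jn n / (2 * Real.pi) := by
      simp only [hAsq]
      rw [integral_const_mul]
      calc _ ≤ 1 / (2 * Real.pi) ^ 2 * (2 * Real.pi * Jn n) := by gcongr
        _ = _ := by field_simp
    have hAc : Continuous (A n) := by
      have : A n = fun x => (1 / (2 * Real.pi) : ℂ) *
        ∫ ξ, planeWave ξ x * truncSymbol l n f ξ := funext hAn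
      rw [this]
      exact continuous_const.mul (continuous_integral_planeWave_mul hg)
    have hAb : ∃ c, ∀ x, ‖A n x‖ ≤ c := by
      obtain ⟨C, hC⟩ := exists_isKernelBound_kernelTrunc hl
      exact ⟨_, fun x => (hC n n.cast_nonneg).norm_integral_le hf hf2 x⟩
    obtain ⟨c, hc⟩ := hAb
    have hEA : Integrable fun x => E x * (starRingEnd ℂ) (A n x) :=
      hE.mul_bdd (c := c) (Complex.continuous_conj.comp hAc).aestronglyMeasurable
        (Eventually.of_forall fun x => by rw [RCLike.norm_conj]; exact hc x)
    have hcross : ∫ x, E x * (starRingEnd ℂ) (A n x) = ((Jn n / (2 * Real.pi) : ℝ) : ℂ) := by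
      have h1 : ∀ x, (starRingEnd ℂ) (A n x) = (1 / (2 * Real.pi) : ℂ) *
          ∫ ξ, planeWave (-ξ) x * (starRingEnd ℂ) (truncSymbol l n f ξ) := fun x => by
        rw [hAn, map_mul, ← integral_conj]
        simp only [map_mul, map_div₀, map_one, Complex.conj_ofReal, map_ofNat, planeWave_neg]
      have h2 := integral_mul_integral_swap (μ := volume) (ν := volume) hE (integrable_conj hg)
        (M := fun x ξ => planeWave (-ξ) x) (C := 1)
        (by
          have : Continuous fun p : ℝ × ℝ => planeWave (-p.2) p.1 := by unfold planeWave; fun_prop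
          exact this.aestronglyMeasurable) (fun x y => (norm_planeWave _ _).le)
      calc _ = ∫ x, (1 / (2 * Real.pi) : ℂ) * (E x *
            ∫ ξ, planeWave (-ξ) x * (starRingEnd ℂ) (truncSymbol l n f ξ)) := by
            refine integral_congr_ae (Eventually.of_forall fun x => ?_)
            simp only [h1]; ring
        _ = (1 / (2 * Real.pi) : ℂ) * ∫ ξ, ((‖truncSymbol l n f ξ‖ ^ 2 : ℝ) : ℂ) := by
            rw [integral_const_mul, h2]
            congr 1
            refine integral_congr_ae (Eventually.of_forall fun ξ => ?_)
            simp only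
            rw [← fourierIntegral, Complex.ofReal_pow, ← Complex.mul_conj', truncSymbol]
            by_cases h : ξ ∈ Ioc (-(n : ℝ)) 0
            · rw [indicator_of_mem h, hEft ξ h.2]
            · rw [indicator_of_notMem h, map_zero, mul_zero, mul_zero]
        _ = _ := by
            rw [integral_complex_ofReal]; push_cast; ring
    have hexp : ∀ x, ‖E x - A n x‖ ^ 2 =
        (‖E x‖ ^ 2 + ‖A n x‖ ^ 2) - 2 * (E x * (starRingEnd ℂ) (A n x)).re := fun x => by
      simp only [Complex.sq_norm]; exact Complex.normSq_sub _ _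
    have hre : Integrable fun x => (E x * (starRingEnd ℂ) (A n x)).re := hEA.re
    have hre2 : ∫ x, (E x * (starRingEnd ℂ) (A n x)).re = Jn n / (2 * Real.pi) := by
      have := integral_re hEA
      simp only [RCLike.re_to_complex] at this
      rw [this, hcross, Complex.ofReal_re]
    simp only [hexp]
    refine ⟨(hE2.add hA2).sub (hre.const_mul 2), ?_⟩
    have e1 := integral_sub (hE2.add hA2) (hre.const_mul 2)
    have e2 := integral_add hE2 hA2
    simp only [Pi.add_apply] at e1
    rw [e1, e2, integral_const_mul, hre2]
    have h5 : ∫ x, ‖E x‖ ^ 2 ≤ J / (2 * Real.pi) := by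
      simp only [hEn]
      rw [le_div_iff₀ (by positivity)]
      linarith
    rw [sub_div]
    linarith
  -- Fatou along a tail of the sequence, on which the error is already below ε.
  have hzero : ∀ ε : ℝ, 0 < ε → Integrable (fun x => ‖m x‖ ^ 2) ∧ ∫ x, ‖m x‖ ^ 2 ≤ ε := by
    intro ε hε
    have h1 : Tendsto (fun n => (J - Jn n) / (2 * Real.pi)) atTop (𝓝 0) := by
      simpa using (hJlim.const_sub J).div_const (2 * Real.pi)
    obtain ⟨N, hN⟩ := eventually_atTop.1 (h1.eventually (ge_mem_nhds hε))
    refine integrable_and_integral_le_of_tendsto (F := fun n x => ‖E x - A (n + N) x‖ ^ 2)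
      (fun n => (hest _).1) (fun n x => by positivity)
      (Eventually.of_forall fun x => (hlim x).comp (tendsto_add_atTop_nat N))
      (fun n => (hest _).2.trans (hN _ (Nat.le_add_left N n)))
  have hfin : ∫ x, ‖m x‖ ^ 2 = 0 :=
    le_antisymm (le_of_forall_pos_le_add fun ε hε => by simpa using (hzero ε hε).2)
      (integral_nonneg fun x => by positivity)
  have h6 := (integral_eq_zero_iff_of_nonneg (fun x => by positivity) (hzero 1 one_pos).1).1 hfin
  filter_upwards [h6] with x hx
  simpa using hx

end

/-! ### Uniqueness for the homogeneous Jost equation -/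

section

variable {u : ℝ → ℝ} {s : ℝ} {m : ℝ → ℂ} {a b C : ℝ}

lemma weight_rpow_mul_norm_le (hC : ∀ x, ‖m x‖ ≤ C * weight x ^ (-a)) (x : ℝ) :
    weight x ^ b * ‖(u x : ℂ) * m x‖ ≤ C * (weight x ^ (b - a) * ‖u x‖) := by
  rw [norm_mul, Complex.norm_real, sub_eq_add_neg, Real.rpow_add (weight_pos x)]
  have h1 := weight_rpow_pos b x
  calc weight x ^ b * (‖u x‖ * ‖m x‖) ≤ weight x ^ b * (‖u x‖ * (C * weight x ^ (-a))) := by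
        gcongr; exact hC x
    _ = _ := by ring

lemma integrable_weight_mul_potential (hu : MemWeightedLp u 2 s)
    (hm : AEStronglyMeasurable m volume)
    (hC : ∀ x, ‖m x‖ ≤ C * weight x ^ (-a)) (hb : b - a < s - 1 / 2) :
    Integrable (fun x => weight x ^ b * ‖(u x : ℂ) * m x‖) ∧
    Integrable fun x => (weight x ^ b * ‖(u x : ℂ) * m x‖) ^ 2 := by
  have hum : AEStronglyMeasurable (fun x => (u x : ℂ) * m x) volume :=
    (Complex.continuous_ofReal.comp_aestronglyMeasurable hu.aestronglyMeasurable).mul hm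
  have hw : AEStronglyMeasurable (fun x => weight x ^ b * ‖(u x : ℂ) * m x‖) volume :=
    (continuous_weight_rpow b).aestronglyMeasurable.mul hum.norm
  have h0 : ∀ x, 0 ≤ weight x ^ b * ‖(u x : ℂ) * m x‖ := fun x =>
    mul_nonneg (weight_rpow_pos b x).le (norm_nonneg _)
  constructor
  · refine Integrable.mono' ((hu.integrable_weight_mul hb).const_mul C) hw
      (Eventually.of_forall fun x => ?_)
    rw [Real.norm_eq_abs, abs_of_nonneg (h0 x)]
    exact weight_rpow_mul_norm_le hC x
  · refine Integrable.mono' ((hu.integrable_sq (b := b - a) (by linarith)).const_mul (C ^ 2))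
      (hw.pow 2) (Eventually.of_forall fun x => ?_)
    rw [Real.norm_eq_abs, abs_of_nonneg (sq_nonneg _), ← mul_pow]
    exact pow_le_pow_left₀ (h0 x) (weight_rpow_mul_norm_le hC x) 2

/-- One step of the decay bootstrap for solutions of the homogeneous equation. -/
lemma exists_decay_step {l : ℝ} (hl : 0 < l) (hu : MemWeightedLp u 2 s)
    (hm : AEStronglyMeasurable m volume) (hf : Integrable fun y => (u y : ℂ) * m y)
    (heq : ∀ x, m x = Complex.I * planeWave l x *
      prim (fun y => planeWave (-l) y * ((u y : ℂ) * m y)) x -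
        ∫ y, kernelTilde l (x - y) * ((u y : ℂ) * m y))
    (hC : ∀ x, ‖m x‖ ≤ C * weight x ^ (-a)) (hb0 : 0 ≤ b) (hb1 : b ≤ 1)
    (hb : b - a < s - 1 / 2) : ∃ C', ∀ x, ‖m x‖ ≤ C' * weight x ^ (-b) := by
  obtain ⟨K, hK⟩ := exists_isKernelBound_weight_mul_kernelTilde hl
  obtain ⟨i1, i2⟩ := integrable_weight_mul_potential hu hm hC hb
  set f : ℝ → ℂ := fun y => (u y : ℂ) * m y with hf'
  set h : ℝ → ℂ := fun y => ((weight y ^ b : ℝ) : ℂ) * f y with hh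
  have hhn : ∀ y, ‖h y‖ = weight y ^ b * ‖f y‖ := fun y => by
    rw [hh, norm_mul, Complex.norm_real, Real.norm_eq_abs, abs_of_pos (weight_rpow_pos b y)]
  have hhm : AEStronglyMeasurable h volume :=
    (Complex.continuous_ofReal.comp (continuous_weight_rpow b)).aestronglyMeasurable.mul hf.1
  have hh1 : Integrable h := by
    refine (integrable_norm_iff hhm).1 ?_
    simpa only [hhn] using i1
  have hh2 : Integrable fun y => ‖h y‖ ^ 2 := by simpa only [hhn] using i2
  refine ⟨(∫ y, weight y ^ b * ‖f y‖) + K * convBound h, fun x => ?_⟩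
  have hwx := weight_rpow_pos b x
  rw [Real.rpow_neg (weight_pos x).le, ← div_eq_mul_inv, le_div_iff₀ hwx, mul_comm]
  have hF := integrable_planeWave_mul hf (-l)
  have p1 : weight x ^ b * ‖prim (fun y => planeWave (-l) y * f y) x‖ ≤
      ∫ y, weight y ^ b * ‖f y‖ := by
    have hFn : ∀ y, ‖planeWave (-l) y * f y‖ = ‖f y‖ := fun y => by
      rw [norm_mul, norm_planeWave, one_mul]
    have := weight_rpow_mul_norm_prim_le hb0 hF (by simpa only [hFn] using i1) x
    simpa only [hFn] using this
  have p2 : weight x ^ b * ‖∫ y, kernelTilde l (x - y) * f y‖ ≤ K * convBound h := by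
    rw [← abs_of_pos hwx, ← Real.norm_eq_abs, ← Complex.norm_real, ← norm_mul,
      ← integral_const_mul]
    have hKi := (hK.integrable hh1 hh2 x).norm
    simp only [norm_mul _ (h _)] at hKi
    refine (norm_integral_le_of_norm_le hKi (Eventually.of_forall fun y => ?_)).trans
      (hK.integral_norm_le hh1 hh2 x)
    · rw [norm_mul, norm_mul (kernelTilde l (x - y)) (f y),
        norm_mul (weight (x - y) : ℂ) (kernelTilde l (x - y)), hhn, Complex.norm_real,
        Complex.norm_real, Real.norm_eq_abs, Real.norm_eq_abs, abs_of_pos hwx,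
        abs_of_pos (weight_pos _)]
      -- Submultiplicativity of the weight. The kernel can absorb only one power of w(x - y), hence
      -- the restriction b ≤ 1.
      have h1 : weight x ^ b ≤ weight (x - y) * weight y ^ b := by
        calc weight x ^ b ≤ (weight (x - y) * weight y) ^ b :=
              Real.rpow_le_rpow (weight_pos x).le (weight_le_mul x y) hb0
          _ = weight (x - y) ^ b * weight y ^ b :=
              Real.mul_rpow (weight_pos _).le (weight_pos _).le
          _ ≤ weight (x - y) ^ (1 : ℝ) * weight y ^ b := by
              have := weight_rpow_pos b y
              gcongr
              exact one_le_weight _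
          _ = _ := by rw [Real.rpow_one]
      calc weight x ^ b * (‖kernelTilde l (x - y)‖ * ‖f y‖) ≤
            (weight (x - y) * weight y ^ b) * (‖kernelTilde l (x - y)‖ * ‖f y‖) := by gcongr
        _ = _ := by ring
  have p3 : ‖m x‖ ≤ ‖prim (fun y => planeWave (-l) y * f y) x‖ +
      ‖∫ y, kernelTilde l (x - y) * f y‖ := by
    rw [heq x]
    refine (norm_sub_le _ _).trans (le_of_eq ?_)
    rw [norm_mul, norm_mul, norm_planeWave, Complex.norm_I, one_mul, one_mul]
  nlinarith [mul_le_mul_of_nonneg_left p3 hwx.le]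

/-- Absence of embedded eigenvalues. Because u is real, conj(u m) m is real: this gives first the
vanishing of the Fourier transform of u m at l, then, after the decay bootstrap, the vanishing of m
itself. -/
theorem eq_zero_of_homogeneous {s₁ l : ℝ} (hs₁ : 1 / 2 < s₁) (hs : s₁ < s) (hl : 0 < l)
    (hu : MemWeightedLp u 2 s) (σ : ℤˣ) (hm : AEStronglyMeasurable m volume)
    (hC : ∀ x, ‖m x‖ ≤ C * weight x ^ (s - s₁))
    (heq : ∀ x, m x = ∫ y, kernel σ l (x - y) * ((u y : ℂ) * m y)) : ∀ x, m x = 0 := by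
  have hC' : ∀ x, ‖m x‖ ≤ C * weight x ^ (-(-(s - s₁))) := by simpa using hC
  have hum : AEStronglyMeasurable (fun x => (u x : ℂ) * m x) volume :=
    (Complex.continuous_ofReal.comp_aestronglyMeasurable hu.aestronglyMeasurable).mul hm
  obtain ⟨i1, i2⟩ := integrable_weight_mul_potential (b := 0) hu hm hC' (by linarith)
  simp only [Real.rpow_zero, one_mul] at i1 i2
  have hf : Integrable fun y => (u y : ℂ) * m y := (integrable_norm_iff hum).1 i1
  have hcm : ∀ x, ((starRingEnd ℂ) ((u x : ℂ) * m x) * m x).im = 0 := fun x => by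
    rw [map_mul, Complex.conj_ofReal, mul_assoc, Complex.conj_mul', ← Complex.ofReal_pow,
      ← Complex.ofReal_mul, Complex.ofReal_im]
  have h0 : fourierIntegral (fun y => (u y : ℂ) * m y) l = 0 := by
    refine fourierIntegral_eq_zero_of_im_eq_zero hl hf i2 σ (Eventually.of_forall fun x => ?_)
    rw [← heq x]; exact hcm x
  have heq1 : ∀ x, m x = ∫ y, hermKernel l (x - y) * ((u y : ℂ) * m y) := fun x => by
    have := integral_kernel_mul hl hf i2 σ x
    rw [h0, mul_zero, mul_zero, add_zero] at this
    rw [heq x]; exact this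
  have heq2 : ∀ x, m x = _ := fun x => (heq1 x).trans (integral_hermKernel_mul hl hf i2 h0 x)
  -- Each step may gain any exponent below s - 1/2; half of it is taken. The initial step, from
  -- growth w^{s-s₁} to boundedness, is allowed because s₁ > 1/2. Decay is capped at exponent 1,
  -- which gives the first moment of u m.
  set δ : ℝ := (s - 1 / 2) / 2 with hδ
  have hδ0 : 0 < δ := by rw [hδ]; linarith
  have hdecay : ∀ n : ℕ, ∃ K, ∀ x, ‖m x‖ ≤ K * weight x ^ (-(min (n * δ) 1)) := by
    intro n
    induction n with
    | zero =>
      refine exists_decay_step hl hu hm hf heq2 hC' (by simp) (by simp) ?_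
      simp only [Nat.cast_zero, zero_mul, zero_le_one, inf_of_le_left]
      linarith
    | succ n ih =>
      obtain ⟨K, hK⟩ := ih
      refine exists_decay_step hl hu hm hf heq2 hK (by positivity) (min_le_right _ _) ?_
      push_cast
      have h1 : min ((n + 1) * δ) 1 ≤ min (n * δ) 1 + δ := by
        rw [← min_add_add_right]
        exact min_le_min (by linarith) (by linarith)
      linarith
  obtain ⟨n, hn⟩ := exists_nat_ge (1 / δ)
  obtain ⟨K, hK⟩ := hdecay n
  rw [div_le_iff₀ hδ0] at hn
  rw [min_eq_right hn] at hK
  obtain ⟨j1, -⟩ := integrable_weight_mul_potential (b := 1) hu hm hK (by linarith)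
  have hf1 : Integrable fun y => |y| * ‖(u y : ℂ) * m y‖ := by
    refine Integrable.mono' j1 (continuous_abs.aestronglyMeasurable.mul hum.norm)
      (Eventually.of_forall fun y => ?_)
    rw [Real.rpow_one, norm_mul, Real.norm_eq_abs, abs_abs, norm_norm]
    refine mul_le_mul_of_nonneg_right ?_ (norm_nonneg _)
    rw [weight]; linarith
  have hae := hermKernel_conv_eq_zero hl hf i2 hf1 h0 (Eventually.of_forall fun x => by
    rw [← heq1 x]; exact hcm x)
  intro x
  rw [heq x]
  -- Vanishing almost everywhere is upgraded to vanishing everywhere by the integral equation.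
  refine (integral_congr_ae (g := fun _ => (0 : ℂ)) ?_).trans (integral_zero _ _)
  filter_upwards [hae] with y hy
  rw [heq1 y, hy, mul_zero, mul_zero]

end

open scoped BoundedContinuousFunction

/-! ### Compact convolution operators on bounded continuous functions -/

/-- A criterion for compactness of operators on bounded continuous functions: equicontinuity and
uniform decay at infinity. -/
lemma isCompactOperator_of_equicontinuous_of_decay (S : (ℝ →ᵇ ℂ) →L[ℂ] (ℝ →ᵇ ℂ))
    (hequi : ∀ x : ℝ, ∀ ε > 0, ∀ᶠ x' in 𝓝 x, ∀ φ : ℝ →ᵇ ℂ, ‖φ‖ ≤ 1 → ‖S φ x' - S φ x‖ ≤ ε)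
    (hdecay : ∀ ε > 0, ∀ᶠ x in cocompact ℝ, ∀ φ : ℝ →ᵇ ℂ, ‖φ‖ ≤ 1 → ‖S φ x‖ ≤ ε) :
    IsCompactOperator S := by
  refine (isCompactOperator_iff_isCompact_closure_image_closedBall (S : (ℝ →ᵇ ℂ) →ₗ[ℂ] (ℝ →ᵇ ℂ))
    one_pos).2 ?_
  refine isCompact_iff_totallyBounded_isComplete.2
    ⟨TotallyBounded.closure ?_, isClosed_closure.isComplete⟩
  refine Metric.totallyBounded_iff.2 fun ε hε => ?_
  have hε4 : 0 < ε / 8 := by positivity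
  -- Off K all images are small; on K they are determined up to ε/8 by their values at the finitely
  -- many points of t. Evaluation at t has bounded image in a finite-dimensional space, so a finite
  -- net exists there. Three errors of ε/8 add up to less than ε.
  obtain ⟨K, hK, hKd⟩ := mem_cocompact.1 (hdecay (ε / 8) hε4)
  obtain ⟨t, -, ht⟩ := hK.elim_nhds_subcover _ fun x _ => hequi x (ε / 8) hε4
  set A : Set (ℝ →ᵇ ℂ) := S '' Metric.closedBall 0 1 with hA
  set e : (ℝ →ᵇ ℂ) → (t → ℂ) := fun ψ i => ψ i with he
  have hb : Bornology.IsBounded (e '' A) := by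
    refine (Metric.isBounded_closedBall (x := (0 : t → ℂ)) (r := ‖S‖)).subset ?_
    rintro _ ⟨_, ⟨φ, hφ, rfl⟩, rfl⟩
    rw [mem_closedBall_zero_iff] at hφ ⊢
    refine (pi_norm_le_iff_of_nonneg (norm_nonneg _)).2 fun i => ?_
    refine ((S φ).norm_coe_le_norm i).trans ((S.le_opNorm φ).trans ?_)
    exact mul_le_of_le_one_right (norm_nonneg _) hφ
  obtain ⟨T, hTA, hTf, hT⟩ := exists_subset_image_finite_and.1
    (Metric.finite_approx_of_totallyBounded (hb.isCompact_closure.totallyBounded.subset subset_closure) (ε / 8) hε4)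
  refine ⟨T, hTf, fun ψ hψ => ?_⟩
  obtain ⟨_, ⟨ψ', hψ', rfl⟩, hd⟩ := mem_iUnion₂.1 (hT (mem_image_of_mem e hψ))
  refine mem_iUnion₂.2 ⟨ψ', hψ', ?_⟩
  obtain ⟨φ, hφ, rfl⟩ := hψ
  obtain ⟨φ', hφ', rfl⟩ := hTA hψ'
  rw [mem_closedBall_zero_iff] at hφ hφ'
  refine lt_of_le_of_lt ((BoundedContinuousFunction.dist_le (C := 3 * (ε / 8)) (by positivity)).2
    fun x => ?_) (by linarith)
  change dist (S φ x) (S φ' x) ≤ 3 * (ε / 8)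
  by_cases hx : x ∈ K
  · obtain ⟨i, hi, hxi⟩ := mem_iUnion₂.1 (ht hx)
    have h1 : ‖S φ x - S φ i‖ ≤ ε / 8 := hxi φ hφ
    have h2 : ‖S φ' x - S φ' i‖ ≤ ε / 8 := hxi φ' hφ'
    have h3 : dist (S φ i) (S φ' i) < ε / 8 :=
      lt_of_le_of_lt (dist_le_pi_dist (e (S φ)) (e (S φ')) ⟨i, hi⟩) hd
    rw [← dist_eq_norm] at h1 h2
    rw [dist_comm] at h2
    have h4 := dist_triangle4 (S φ x) (S φ i) (S φ' i) (S φ' x)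
    linarith
  · have h1 : ‖S φ x‖ ≤ ε / 8 := hKd hx φ hφ
    have h2 : ‖S φ' x‖ ≤ ε / 8 := hKd hx φ' hφ'
    rw [dist_eq_norm]
    have := norm_sub_le (S φ x) (S φ' x)
    linarith

/-- The modulus of continuity of the convolution with `N` after multiplication with `v`. -/
def convModulus (N v : ℝ → ℂ) (x x' : ℝ) : ℝ := ∫ y, ‖(N (x' - y) - N (x - y)) * v y‖

section Conv

variable {N v φ : ℝ → ℂ} {C B : ℝ}

lemma integrable_mul_bounded (hN : IsKernelBound N C) (hv : Integrable v)
    (hv2 : Integrable fun y => ‖v y‖ ^ 2) (hφ : AEStronglyMeasurable φ volume)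
    (hB : ∀ᵐ y, ‖φ y‖ ≤ B) (x : ℝ) : Integrable fun y => N (x - y) * (v y * φ y) := by
  refine ((hN.integrable hv hv2 x).mul_bdd hφ hB).congr (Eventually.of_forall fun y => ?_)
  simp only [mul_assoc]

lemma norm_integral_mul_bounded_le (hN : IsKernelBound N C) (hv : Integrable v)
    (hv2 : Integrable fun y => ‖v y‖ ^ 2) (hB : ∀ᵐ y, ‖φ y‖ ≤ B) (x : ℝ) :
    ‖∫ y, N (x - y) * (v y * φ y)‖ ≤ C * convBound v * B := by
  have hB0 : 0 ≤ B := by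
    obtain ⟨y, hy⟩ := hB.exists
    exact (norm_nonneg _).trans hy
  refine (norm_integral_le_of_norm_le ((hN.integrable hv hv2 x).norm.mul_const B) ?_).trans ?_
  · filter_upwards [hB] with y hy
    rw [← mul_assoc, norm_mul]
    gcongr
  · rw [integral_mul_const]
    gcongr
    simpa only [norm_mul] using hN.integral_norm_le hv hv2 x

lemma norm_integral_sub_integral_le (hN : IsKernelBound N C) (hv : Integrable v)
    (hv2 : Integrable fun y => ‖v y‖ ^ 2) (hφ : AEStronglyMeasurable φ volume)
    (hB : ∀ᵐ y, ‖φ y‖ ≤ B) (x x' : ℝ) :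
    ‖(∫ y, N (x' - y) * (v y * φ y)) - ∫ y, N (x - y) * (v y * φ y)‖ ≤
      convModulus N v x x' * B := by
  rw [← integral_sub (integrable_mul_bounded hN hv hv2 hφ hB x')
    (integrable_mul_bounded hN hv hv2 hφ hB x), convModulus, ← integral_mul_const]
  have h : Integrable fun y => (N (x' - y) - N (x - y)) * v y := by
    refine ((hN.integrable hv hv2 x').sub (hN.integrable hv hv2 x)).congr
      (Eventually.of_forall fun y => ?_)
    simp only [Pi.sub_apply, sub_mul]
  refine norm_integral_le_of_norm_le (h.norm.mul_const B) ?_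
  filter_upwards [hB] with y hy
  rw [← sub_mul, ← mul_assoc, norm_mul]
  gcongr

lemma continuous_integral_mul_bounded (hN : IsKernelBound N C) (hv : Integrable v)
    (hv2 : Integrable fun y => ‖v y‖ ^ 2)
    (hD : ∀ x, Tendsto (convModulus N v x) (𝓝 x) (𝓝 0))
    (hφ : AEStronglyMeasurable φ volume) (hB : ∀ᵐ y, ‖φ y‖ ≤ B) :
    Continuous fun x => ∫ y, N (x - y) * (v y * φ y) := by
  refine continuous_iff_continuousAt.2 fun x => tendsto_iff_norm_sub_tendsto_zero.2 ?_
  refine squeeze_zero (fun _ => norm_nonneg _)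
    (norm_integral_sub_integral_le hN hv hv2 hφ hB x) ?_
  simpa using (hD x).mul_const B

/-- The modulus `convModulus` controls the oscillation of the convolution uniformly over the unit
ball, and the factor ρ supplies the uniform decay at infinity. -/
lemma exists_compact_convolution_operator (hN : IsKernelBound N C) (hv : Integrable v)
    (hv2 : Integrable fun y => ‖v y‖ ^ 2)
    (hD : ∀ x, Tendsto (convModulus N v x) (𝓝 x) (𝓝 0)) (ρ : ℝ →ᵇ ℂ)
    (hρ : Tendsto ρ (cocompact ℝ) (𝓝 0)) :
    ∃ S : (ℝ →ᵇ ℂ) →L[ℂ] (ℝ →ᵇ ℂ),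
      (∀ φ x, S φ x = ρ x * ∫ y, N (x - y) * (v y * φ y)) ∧ IsCompactOperator S := by
  set M : ℝ := C * convBound v with hM
  have hφB : ∀ φ : ℝ →ᵇ ℂ, ∀ᵐ y, ‖φ y‖ ≤ ‖φ‖ := fun φ =>
    Eventually.of_forall fun y => φ.norm_coe_le_norm y
  have hφm : ∀ φ : ℝ →ᵇ ℂ, AEStronglyMeasurable φ volume := fun φ =>
    φ.continuous.aestronglyMeasurable
  have hM0 : 0 ≤ M := by
    have := norm_integral_mul_bounded_le (φ := fun _ => 0) (B := 1) hN hv hv2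
      (Eventually.of_forall fun y => by simp) 0
    exact (norm_nonneg _).trans (this.trans_eq (mul_one _))
  have hconv : ∀ φ : ℝ →ᵇ ℂ, ∀ x, ‖∫ y, N (x - y) * (v y * φ y)‖ ≤ M * ‖φ‖ := fun φ x =>
    norm_integral_mul_bounded_le hN hv hv2 (hφB φ) x
  let S₀ : (ℝ →ᵇ ℂ) →ₗ[ℂ] (ℝ →ᵇ ℂ) :=
    { toFun := fun φ => ρ * BoundedContinuousFunction.ofNormedAddCommGroup
        (fun x => ∫ y, N (x - y) * (v y * φ y))
        (continuous_integral_mul_bounded hN hv hv2 hD (hφm φ) (hφB φ)) (M * ‖φ‖) (hconv φ)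
      map_add' := fun φ ψ => by
        ext x
        have h := integral_add (integrable_mul_bounded hN hv hv2 (hφm φ) (hφB φ) x)
          (integrable_mul_bounded hN hv hv2 (hφm ψ) (hφB ψ) x)
        simp only [BoundedContinuousFunction.coe_mul, BoundedContinuousFunction.coe_add,
          Pi.mul_apply, Pi.add_apply, BoundedContinuousFunction.coe_ofNormedAddCommGroup, mul_add]
        rw [h, mul_add]
      map_smul' := fun c φ => by
        ext x
        simp only [BoundedContinuousFunction.coe_mul, BoundedContinuousFunction.coe_smul,
          Pi.mul_apply, BoundedContinuousFunction.coe_ofNormedAddCommGroup, RingHom.id_apply,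
          smul_eq_mul]
        have e : ∀ y, N (x - y) * (v y * (c * φ y)) = c * (N (x - y) * (v y * φ y)) :=
          fun y => by ring
        simp only [e, integral_const_mul]
        ring }
  have hS₀ : ∀ φ x, S₀ φ x = ρ x * ∫ y, N (x - y) * (v y * φ y) := fun φ x => rfl
  have hb : ∀ φ, ‖S₀ φ‖ ≤ ‖ρ‖ * M * ‖φ‖ := fun φ => by
    refine (BoundedContinuousFunction.norm_le (by positivity)).2 fun x => ?_
    rw [hS₀, norm_mul, mul_assoc]
    exact mul_le_mul (ρ.norm_coe_le_norm x) (hconv φ x) (norm_nonneg _) (norm_nonneg _)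
  refine ⟨S₀.mkContinuous (‖ρ‖ * M) hb, hS₀, ?_⟩
  refine isCompactOperator_of_equicontinuous_of_decay _ (fun x ε hε => ?_) (fun ε hε => ?_)
  · have h1 : Tendsto (fun x' => ‖ρ x' - ρ x‖ * M + ‖ρ x‖ * convModulus N v x x') (𝓝 x)
        (𝓝 (‖ρ x - ρ x‖ * M + ‖ρ x‖ * 0)) :=
      (((ρ.continuous.tendsto x).sub_const _).norm.mul_const M).add ((hD x).const_mul _)
    rw [sub_self, norm_zero, zero_mul, mul_zero, add_zero] at h1
    filter_upwards [h1.eventually (ge_mem_nhds hε)] with x' hx' φ hφ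
    refine le_trans ?_ hx'
    change ‖S₀ φ x' - S₀ φ x‖ ≤ _
    rw [hS₀, hS₀]
    have e : ∀ a b c d : ℂ, a * b - c * d = (a - c) * b + c * (b - d) := fun a b c d => by ring
    rw [e]
    refine (norm_add_le _ _).trans ?_
    rw [norm_mul, norm_mul]
    have h2 : ‖∫ y, N (x' - y) * (v y * φ y)‖ ≤ M :=
      (hconv φ x').trans (mul_le_of_le_one_right hM0 hφ)
    have h3 := norm_integral_sub_integral_le hN hv hv2 (hφm φ)
      ((hφB φ).mono fun y hy => hy.trans hφ) x x'
    rw [mul_one] at h3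
    gcongr
  · have h1 : Tendsto (fun x => ‖ρ x‖ * M) (cocompact ℝ) (𝓝 0) := by
      simpa using hρ.norm.mul_const M
    filter_upwards [h1.eventually (ge_mem_nhds hε)] with x hx φ hφ
    refine le_trans ?_ hx
    change ‖S₀ φ x‖ ≤ _
    rw [hS₀, norm_mul]
    gcongr
    exact (hconv φ x).trans (mul_le_of_le_one_right hM0 hφ)

end Conv

/-! ### Continuity of the modulus for the conjugated Jost kernels -/

lemma tendsto_eLpNorm_translate {g : ℝ → ℂ} (hg : MemLp g 2 volume) (x : ℝ) :
    Tendsto (fun x' => eLpNorm (fun y => g (x' - y) - g (x - y)) 2 volume) (𝓝 x) (𝓝 0) := by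
  have hmp : ∀ z : ℝ, MeasurePreserving (fun y : ℝ => z - y) volume volume := fun z =>
    Measure.measurePreserving_sub_left volume z
  -- The reflections y ↦ z - y as a continuous family of measure-preserving maps; composition with
  -- such a family is continuous in L².
  let G : C(ℝ, C(ℝ, ℝ)) := (ContinuousMap.mk (fun p : ℝ × ℝ => p.1 - p.2)
    (continuous_fst.sub continuous_snd)).curry
  have hc : Continuous fun z : ℝ =>
      Lp.compMeasurePreserving (G z) (hmp z) (hg.toLp g) :=
    Continuous.compMeasurePreservingLp continuous_const G.continuous hmp (by simp)
  have h1 := tendsto_iff_edist_tendsto_0.1 (hc.tendsto x)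
  refine h1.congr fun x' => ?_
  have e : ∀ z, Lp.compMeasurePreserving (G z) (hmp z) (hg.toLp g) =
      (hg.comp_measurePreserving (hmp z)).toLp _ := fun z => rfl
  rw [e, e, Lp.edist_toLp_toLp]
  rfl

/-- Cauchy–Schwarz together with the continuity of translations in L². -/
lemma tendsto_convModulus_of_memLp {g v : ℝ → ℂ} (hg : MemLp g 2 volume) (hv : MemLp v 2 volume)
    (x : ℝ) : Tendsto (convModulus g v x) (𝓝 x) (𝓝 0) := by
  have hmp : ∀ z : ℝ, MeasurePreserving (fun y : ℝ => z - y) volume volume := fun z =>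
    Measure.measurePreserving_sub_left volume z
  have hd : ∀ x', AEStronglyMeasurable (fun y => g (x' - y) - g (x - y)) volume := fun x' =>
    (hg.comp_measurePreserving (hmp x')).1.sub (hg.comp_measurePreserving (hmp x)).1
  have h1 : Tendsto (fun x' => eLpNorm (fun y => g (x' - y) - g (x - y)) 2 volume *
      eLpNorm v 2 volume) (𝓝 x) (𝓝 0) := by
    have := ENNReal.Tendsto.mul_const (tendsto_eLpNorm_translate hg x) (Or.inr hv.2.ne)
    rwa [zero_mul] at this
  have h2 : ∀ x', convModulus g v x x' =
      (eLpNorm (fun y => (g (x' - y) - g (x - y)) * v y) 1 volume).toReal := fun x' => by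
    have hdv : AEStronglyMeasurable (fun y => (g (x' - y) - g (x - y)) * v y) volume :=
      (hd x').mul hv.1
    rw [convModulus, integral_norm_eq_lintegral_enorm hdv, eLpNorm_one_eq_lintegral_enorm]
  have h3 : Tendsto (fun x' => eLpNorm (fun y => (g (x' - y) - g (x - y)) * v y) 1 volume) (𝓝 x)
      (𝓝 0) := by
    refine tendsto_of_tendsto_of_tendsto_of_le_of_le tendsto_const_nhds h1 (fun _ => zero_le)
      fun x' => ?_
    have h5 := eLpNorm_smul_le_mul_eLpNorm (p := 2) (q := 2) (r := 1) hv.1 (hd x')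
    exact h5
  have h4 := (ENNReal.tendsto_toReal ENNReal.zero_ne_top).comp h3
  rw [ENNReal.toReal_zero] at h4
  exact h4.congr fun x' => (h2 x').symm

/-- The kernel `e^{-ilx} G_{l ± 0i}(x)`. -/
def twistedKernel (σ : ℤˣ) (l x : ℝ) : ℂ := planeWave (-l) x * kernel σ l x

lemma twistedKernel_eq (σ : ℤˣ) (l x : ℝ) :
    twistedKernel σ l x = kernelJump σ x - planeWave (-l) x * kernelTilde l x := by
  rw [twistedKernel, kernel_eq]
  linear_combination kernelJump σ x * planeWave_neg_mul_self l x

lemma exists_isKernelBound_twistedKernel {l : ℝ} (hl : 0 < l) :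
    ∃ C, ∀ σ, IsKernelBound (twistedKernel σ l) C := by
  obtain ⟨C, h⟩ := exists_isKernelBound_kernel hl
  refine ⟨C, fun σ => ⟨(continuous_planeWave (-l)).measurable.mul (h σ).measurable, (h σ).nonneg,
    fun z hz => ?_⟩⟩
  rw [twistedKernel, norm_mul, norm_planeWave, one_mul]
  exact (h σ).norm_le z hz

/-- The kernel is bounded by a multiple of w⁻¹ plus the local singularity, and both are square
integrable. -/
lemma memLp_planeWave_mul_kernelTilde {l : ℝ} (hl : 0 < l) :
    MemLp (fun x => planeWave (-l) x * kernelTilde l x) 2 volume := by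
  obtain ⟨C, h⟩ := exists_isKernelBound_weight_mul_kernelTilde hl
  have hm : AEStronglyMeasurable (fun x => planeWave (-l) x * kernelTilde l x) volume :=
    ((continuous_planeWave (-l)).measurable.mul (measurable_kernelTilde hl)).aestronglyMeasurable
  refine (memLp_two_iff_integrable_sq_norm hm).2 ?_
  refine Integrable.mono' (((integrable_weight_rpow (c := -2) (by norm_num)).add
    integrable_singularPart_sq).const_mul (2 * C ^ 2)) (hm.norm.pow 2) ?_
  filter_upwards [Measure.ae_ne volume 0] with x hx
  have h1 := h.norm_le x hx
  have hw := weight_pos x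
  have hw1 := one_le_weight x
  have hs := singularPart_nonneg x
  rw [norm_mul, Complex.norm_real, Real.norm_eq_abs, abs_of_pos hw] at h1
  rw [norm_mul, norm_planeWave, one_mul, Real.norm_eq_abs, abs_of_nonneg (by positivity),
    Pi.add_apply, Real.rpow_neg hw.le, Real.rpow_ofNat]
  have hi : (weight x)⁻¹ ≤ 1 := inv_le_one_of_one_le₀ hw1
  have h2 : ‖kernelTilde l x‖ ≤ C * ((weight x)⁻¹ + singularPart x) := by
    have h3 : ‖kernelTilde l x‖ ≤ (weight x)⁻¹ * (C * (1 + singularPart x)) := by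
      rw [inv_mul_eq_div, le_div_iff₀ hw, mul_comm]; exact h1
    refine h3.trans ?_
    have := mul_le_mul_of_nonneg_left (mul_le_of_le_one_left hs hi) h.nonneg
    linarith
  have h4 : ‖kernelTilde l x‖ ^ 2 ≤ (C * ((weight x)⁻¹ + singularPart x)) ^ 2 :=
    pow_le_pow_left₀ (norm_nonneg _) h2 2
  refine h4.trans ?_
  rw [mul_pow, mul_comm 2, mul_assoc, ← inv_pow]
  refine mul_le_mul_of_nonneg_left ?_ (sq_nonneg C)
  nlinarith [sq_nonneg ((weight x)⁻¹ - singularPart x)]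

/-- The jump is not in L², but it is bounded and locally constant off the origin: dominated
convergence applies, the exceptional y = x being a null set. -/
lemma tendsto_convModulus_kernelJump (σ : ℤˣ) {v : ℝ → ℂ} (hv : Integrable v) (x : ℝ) :
    Tendsto (convModulus (kernelJump σ) v x) (𝓝 x) (𝓝 0) := by
  have hm : ∀ x', AEStronglyMeasurable
      (fun y => ‖(kernelJump σ (x' - y) - kernelJump σ (x - y)) * v y‖) volume := fun x' =>
    ((((measurable_kernelJump σ).comp (measurable_const.sub measurable_id)).sub
      ((measurable_kernelJump σ).comp
        (measurable_const.sub measurable_id))).aestronglyMeasurable.mul hv.1).norm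
  have h := tendsto_integral_filter_of_dominated_convergence (μ := volume) (l := 𝓝 x)
    (F := fun x' y => ‖(kernelJump σ (x' - y) - kernelJump σ (x - y)) * v y‖) (f := fun _ => 0)
    (fun y => 2 * ‖v y‖) (Eventually.of_forall hm) ?_ (hv.norm.const_mul 2) ?_
  · rw [integral_zero] at h
    exact h
  · refine Eventually.of_forall fun x' => Eventually.of_forall fun y => ?_
    rw [norm_norm, norm_mul]
    gcongr
    refine (norm_sub_le _ _).trans ?_
    linarith [norm_kernelJump_le σ (x' - y), norm_kernelJump_le σ (x - y)]
  · filter_upwards [Measure.ae_ne volume x] with y hy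
    refine Tendsto.congr' ?_ tendsto_const_nhds
    have h1 : ∀ᶠ x' in 𝓝 x, Real.sign (x' - y) = Real.sign (x - y) ∧ x' - y ≠ 0 := by
      rcases lt_or_gt_of_ne hy with h | h
      · filter_upwards [lt_mem_nhds h] with x' hx'
        rw [Real.sign_of_pos (sub_pos.2 hx'), Real.sign_of_pos (sub_pos.2 h)]
        exact ⟨rfl, (sub_pos.2 hx').ne'⟩
      · filter_upwards [gt_mem_nhds h] with x' hx'
        rw [Real.sign_of_neg (sub_neg.2 hx'), Real.sign_of_neg (sub_neg.2 h)]
        exact ⟨rfl, (sub_neg.2 hx').ne⟩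
    filter_upwards [h1] with x' hx'
    rw [kernelJump_eq σ hx'.2, kernelJump_eq σ (sub_ne_zero.2 hy.symm), hx'.1]
    simp

lemma tendsto_convModulus_twistedKernel (σ : ℤˣ) {l : ℝ} (hl : 0 < l) {v : ℝ → ℂ}
    (hv : Integrable v) (hv2 : Integrable fun y => ‖v y‖ ^ 2) (x : ℝ) :
    Tendsto (convModulus (twistedKernel σ l) v x) (𝓝 x) (𝓝 0) := by
  have hκ := memLp_planeWave_mul_kernelTilde hl
  have hvL : MemLp v 2 volume := (memLp_two_iff_integrable_sq_norm hv.1).2 hv2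
  have h1 := (tendsto_convModulus_kernelJump σ hv x).add (tendsto_convModulus_of_memLp hκ hvL x)
  rw [add_zero] at h1
  refine squeeze_zero (fun x' => integral_nonneg fun y => norm_nonneg _) (fun x' => ?_) h1
  have hmp : ∀ z : ℝ, MeasurePreserving (fun y : ℝ => z - y) volume volume := fun z =>
    Measure.measurePreserving_sub_left volume z
  have i1 : Integrable fun y => (kernelJump σ (x' - y) - kernelJump σ (x - y)) * v y := by
    refine hv.bdd_mul (c := 2) ?_ (Eventually.of_forall fun y => ?_)
    · exact (((measurable_kernelJump σ).comp (measurable_const.sub measurable_id)).sub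
        ((measurable_kernelJump σ).comp (measurable_const.sub measurable_id))).aestronglyMeasurable
    · refine (norm_sub_le _ _).trans ?_
      linarith [norm_kernelJump_le σ (x' - y), norm_kernelJump_le σ (x - y)]
  have i2 : Integrable fun y => (planeWave (-l) (x' - y) * kernelTilde l (x' - y) -
      planeWave (-l) (x - y) * kernelTilde l (x - y)) * v y :=
    ((hκ.comp_measurePreserving (hmp x')).sub
      (hκ.comp_measurePreserving (hmp x))).integrable_mul hvL
  simp only [convModulus]
  rw [← integral_add i1.norm i2.norm]
  refine integral_mono_of_nonneg (Eventually.of_forall fun y => norm_nonneg _)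
    (i1.norm.add i2.norm) (Eventually.of_forall fun y => ?_)
  simp only [twistedKernel_eq]
  refine le_trans (le_of_eq ?_) (norm_sub_le _ _)
  congr 1
  ring

/-! ### Local Hölder continuity on the half line -/

section LocHolder

variable {E F G : Type*} [NormedAddCommGroup E] [NormedAddCommGroup F] [NormedAddCommGroup G]
  {γ : ℝ}

/-- Hölder continuity of exponent `γ` on the compact subintervals of `(0, ∞)`. -/
def LocHolder (γ : ℝ) (f : ℝ → E) : Prop :=
  ∀ a b : ℝ, 0 < a → ∃ C : ℝ, 0 ≤ C ∧
    ∀ t ∈ Icc a b, ∀ t' ∈ Icc a b, ‖f t - f t'‖ ≤ C * |t - t'| ^ γ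

namespace LocHolder

lemma continuousOn {f : ℝ → E} (hf : LocHolder γ f) (hγ : 0 < γ) : ContinuousOn f (Ioi 0) := by
  intro t ht
  have ht' : 0 < t := ht
  obtain ⟨C, -, hC⟩ := hf (t / 2) (2 * t) (by positivity)
  refine ContinuousAt.continuousWithinAt (tendsto_iff_norm_sub_tendsto_zero.2 ?_)
  have hlim : Tendsto (fun t' => C * |t' - t| ^ γ) (𝓝 t) (𝓝 0) := by
    have : ContinuousAt (fun t' => C * |t' - t| ^ γ) t :=
      (((continuous_id.sub continuous_const).abs).rpow_const
        (fun _ => Or.inr hγ.le)).continuousAt.const_mul C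
    simpa [ContinuousAt, Real.zero_rpow hγ.ne'] using this
  refine squeeze_zero' (Eventually.of_forall fun _ => norm_nonneg _) ?_ hlim
  filter_upwards [Icc_mem_nhds (show t / 2 < t by linarith) (show t < 2 * t by linarith)]
    with t' h' using hC t' h' t ⟨by linarith, by linarith⟩

lemma exists_bound {f : ℝ → E} (hf : LocHolder γ f) (hγ : 0 < γ) {a : ℝ} (b : ℝ) (ha : 0 < a) :
    ∃ B, 0 ≤ B ∧ ∀ t ∈ Icc a b, ‖f t‖ ≤ B := by
  obtain ⟨B, hB⟩ := isCompact_Icc.exists_bound_of_continuousOn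
    ((hf.continuousOn hγ).mono fun t (ht : t ∈ Icc a b) => ha.trans_le ht.1)
  exact ⟨max B 0, le_max_right _ _, fun t ht => (hB t ht).trans (le_max_left _ _)⟩

lemma of_norm_sub_le {f : ℝ → E} {C : ℝ} (h0 : 0 ≤ C)
    (h : ∀ t t' : ℝ, ‖f t - f t'‖ ≤ C * |t - t'| ^ γ) : LocHolder γ f :=
  fun _ _ _ => ⟨C, h0, fun t _ t' _ => h t t'⟩

/-- A C¹ function is Lipschitz on [a, b], and |t - t'| ≤ |b - a|^{1-γ} |t - t'|^γ there. -/
lemma of_hasDerivAt [NormedSpace ℝ E] {f f' : ℝ → E} (hγ : γ ≤ 1)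
    (h : ∀ t, 0 < t → HasDerivAt f (f' t) t) (hc : ContinuousOn f' (Ioi 0)) : LocHolder γ f := by
  intro a b ha
  obtain ⟨B, hB⟩ := isCompact_Icc.exists_bound_of_continuousOn
    (hc.mono fun t (ht : t ∈ Icc a b) => ha.trans_le ht.1)
  refine ⟨max B 0 * |b - a| ^ (1 - γ), by positivity, fun t ht t' ht' => ?_⟩
  have h1 := (convex_Icc a b).norm_image_sub_le_of_norm_hasDerivWithin_le
    (fun x hx => (h x (ha.trans_le hx.1)).hasDerivWithinAt)
    (fun x hx => (hB x hx).trans (le_max_left B 0)) ht' ht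
  refine h1.trans ?_
  rw [mul_assoc, Real.norm_eq_abs]
  refine mul_le_mul_of_nonneg_left ?_ (le_max_right _ _)
  rcases (abs_nonneg (t - t')).eq_or_lt with h2 | h2
  · rw [← h2]; positivity
  · have h3 : |t - t'| ≤ |b - a| := by
      rw [abs_le, abs_of_nonneg (by linarith [ht.1, ht.2])]
      constructor <;> linarith [ht.1, ht.2, ht'.1, ht'.2]
    calc |t - t'| = |t - t'| ^ (1 - γ) * |t - t'| ^ γ := by
          rw [← Real.rpow_add h2, sub_add_cancel, Real.rpow_one]
      _ ≤ _ := by gcongr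

lemma bilinear {𝕜 : Type*} [NontriviallyNormedField 𝕜] [NormedSpace 𝕜 E] [NormedSpace 𝕜 F]
    [NormedSpace 𝕜 G] (L : E →L[𝕜] F →L[𝕜] G) {f : ℝ → E} {g : ℝ → F} (hγ : 0 < γ)
    (hf : LocHolder γ f) (hg : LocHolder γ g) : LocHolder γ fun t => L (f t) (g t) := by
  intro a b ha
  obtain ⟨C, hC0, hC⟩ := hf a b ha
  obtain ⟨D, hD0, hD⟩ := hg a b ha
  obtain ⟨A, hA0, hA⟩ := hf.exists_bound hγ b ha
  obtain ⟨B, hB0, hB⟩ := hg.exists_bound hγ b ha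
  refine ⟨‖L‖ * (C * B + A * D), by positivity, fun t ht t' ht' => ?_⟩
  have e : L (f t) (g t) - L (f t') (g t') = L (f t - f t') (g t) + L (f t') (g t - g t') := by
    simp
  rw [e]
  refine (norm_add_le _ _).trans ?_
  calc ‖L (f t - f t') (g t)‖ + ‖L (f t') (g t - g t')‖
      ≤ ‖L‖ * ‖f t - f t'‖ * ‖g t‖ + ‖L‖ * ‖f t'‖ * ‖g t - g t'‖ :=
        add_le_add (L.le_opNorm₂ _ _) (L.le_opNorm₂ _ _)
    _ ≤ ‖L‖ * (C * |t - t'| ^ γ) * B + ‖L‖ * A * (D * |t - t'| ^ γ) := by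
        gcongr
        exacts [hC t ht t' ht', hB t ht, hA t' ht', hD t ht t' ht']
    _ = _ := by ring

lemma const (c : E) : LocHolder γ fun _ => c := fun a b _ => ⟨0, le_rfl, by simp⟩

lemma clm_comp {𝕜 : Type*} [NontriviallyNormedField 𝕜] [NormedSpace 𝕜 E] [NormedSpace 𝕜 F]
    (L : E →L[𝕜] F) {f : ℝ → E} (hf : LocHolder γ f) : LocHolder γ fun t => L (f t) := by
  intro a b ha
  obtain ⟨C, hC0, hC⟩ := hf a b ha
  refine ⟨‖L‖ * C, by positivity, fun t ht t' ht' => ?_⟩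
  rw [← map_sub, mul_assoc]
  exact (L.le_opNorm _).trans (mul_le_mul_of_nonneg_left (hC t ht t' ht') (norm_nonneg _))

end LocHolder

end LocHolder

/-! ### Differentiability of the resolvent -/

section Resolvent

variable {Y : Type*} [NormedAddCommGroup Y] [NormedSpace ℂ Y]

/-- `(1 - S)⁻¹ p`, if `1 - S` is invertible. -/
def resolventApply (S : Y →L[ℂ] Y) (p : Y) : Y := Ring.inverse (1 - S) p

lemma resolventApply_smul (S : Y →L[ℂ] Y) (c : ℂ) (p : Y) :
    resolventApply S (c • p) = c • resolventApply S p := map_smul _ c p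

lemma resolventApply_eq_iff {S : Y →L[ℂ] Y} (h : IsUnit (1 - S)) {p n : Y} :
    n = resolventApply S p ↔ n = p + S n := by
  have h1 : ∀ y, Ring.inverse (1 - S) ((1 - S) y) = y := fun y =>
    DFunLike.congr_fun (Ring.inverse_mul_cancel _ h) y
  have h2 : ∀ y, (1 - S) (Ring.inverse (1 - S) y) = y := fun y =>
    DFunLike.congr_fun (Ring.mul_inverse_cancel _ h) y
  have h3 : n = p + S n ↔ (1 - S) n = p := by
    rw [← sub_eq_iff_eq_add]; rfl
  rw [h3]
  constructor
  · rintro rfl; exact h2 p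
  · rintro rfl; exact (h1 n).symm

lemma hasDerivAt_clm_comp {W : Type*} [NormedAddCommGroup W] [NormedSpace ℂ W] (J : Y →L[ℂ] W)
    {f : ℝ → Y} {f' : Y} {l : ℝ} (h : HasDerivAt f f' l) :
    HasDerivAt (fun t => J (f t)) (J f') l :=
  (J.restrictScalars ℝ).hasFDerivAt.comp_hasDerivAt l h

variable [CompleteSpace Y]

/-- The Fredholm alternative at the spectral value 1. -/
lemma isUnit_one_sub_of_compact {S : Y →L[ℂ] Y} (hS : IsCompactOperator S)
    (h : ∀ n, S n = n → n = 0) : IsUnit (1 - S) := by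
  rcases hS.hasEigenvalue_or_mem_resolventSet (one_ne_zero (α := ℂ)) with h1 | h1
  · obtain ⟨n, hn⟩ := h1.exists_hasEigenvector
    exact absurd (h n (by simpa using hn.apply_eq_smul)) hn.2
  · simpa [resolventSet] using h1

lemma hasDerivAt_inverse_one_sub {S : ℝ → Y →L[ℂ] Y} {D : Y →L[ℂ] Y} {l : ℝ}
    (hS : HasDerivAt S D l) (h : IsUnit (1 - S l)) :
    HasDerivAt (fun t => Ring.inverse (1 - S t))
      (Ring.inverse (1 - S l) * D * Ring.inverse (1 - S l)) l := by
  obtain ⟨x, hx⟩ := h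
  have h1 : HasDerivAt (fun t => 1 - S t) (-D) l := by simpa using hS.const_sub 1
  have h2 := hasFDerivAt_ringInverse (𝕜 := ℝ) x
  rw [hx] at h2
  have h3 := h2.comp_hasDerivAt l h1
  rw [← hx, Ring.inverse_unit]
  refine h3.congr_deriv ?_
  simp

theorem hasDerivAt_resolventApply {S : ℝ → Y →L[ℂ] Y} {D : Y →L[ℂ] Y} {l : ℝ}
    (hS : HasDerivAt S D l) (h : IsUnit (1 - S l)) (p : Y) :
    HasDerivAt (fun t => resolventApply (S t) p)
      (resolventApply (S l) (D (resolventApply (S l) p))) l :=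
  ((ContinuousLinearMap.apply ℂ Y p).restrictScalars ℝ).hasFDerivAt.comp_hasDerivAt l
    (hasDerivAt_inverse_one_sub hS h)

/-- The inverse of 1 - S is itself C¹, hence locally Hölder for every exponent up to 1; D is the
only factor that limits the regularity. -/
theorem locHolder_deriv_resolventApply {S D : ℝ → Y →L[ℂ] Y} {γ : ℝ} (h0 : 0 < γ) (h1 : γ ≤ 1)
    (hS : ∀ l, 0 < l → HasDerivAt S (D l) l) (h : ∀ l, 0 < l → IsUnit (1 - S l))
    (hD : LocHolder γ D) (p : Y) :
    LocHolder γ fun l => resolventApply (S l) (D l (resolventApply (S l) p)) := by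
  have hR : ∀ l, 0 < l → HasDerivAt (fun t => Ring.inverse (1 - S t))
      (Ring.inverse (1 - S l) * D l * Ring.inverse (1 - S l)) l := fun l hl =>
    hasDerivAt_inverse_one_sub (hS l hl) (h l hl)
  have hRc : ContinuousOn (fun t => Ring.inverse (1 - S t)) (Ioi 0) := fun l hl =>
    (hR l hl).continuousAt.continuousWithinAt
  have hRH : LocHolder γ fun t => Ring.inverse (1 - S t) :=
    LocHolder.of_hasDerivAt h1 hR ((hRc.mul (hD.continuousOn h0)).mul hRc)
  have hA := fun {f : ℝ → Y →L[ℂ] Y} {g : ℝ → Y} (hf : LocHolder γ f) (hg : LocHolder γ g) =>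
    LocHolder.bilinear (ContinuousLinearMap.id ℂ (Y →L[ℂ] Y)) h0 hf hg
  exact hA hRH (hA hD (hA hRH (LocHolder.const p)))

/-- Differentiation of an operator-valued function whose increments are known after testing with a
separating family of functionals. -/
lemma hasDerivAt_of_separating {ι : Type*} {S D : ℝ → Y →L[ℂ] Y} (hD : ContinuousOn D (Ioi 0))
    (ev : ι → Y →L[ℂ] ℂ) (hev : ∀ y z, (∀ i, ev i y = ev i z) → y = z)
    (h : ∀ l μ, 0 < l → 0 < μ → ∀ y i,
      ev i (S l y) - ev i (S μ y) = ∫ t in μ..l, ev i (D t y)) {l : ℝ} (hl : 0 < l) :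
    HasDerivAt S (D l) l := by
  have hDi : ∀ t, 0 < t → IntervalIntegrable D volume l t := fun t ht =>
    (hD.mono fun τ hτ => (lt_min hl ht).trans_le hτ.1).intervalIntegrable
  have key : ∀ t, 0 < t → S t = S l + ∫ τ in l..t, D τ := by
    intro t ht
    rw [← sub_eq_iff_eq_add']
    refine ContinuousLinearMap.ext fun y => hev _ _ fun i => ?_
    -- The operator-valued integral of D exists by norm continuity and commutes with the
    -- functionals, so the tested identities determine S; the fundamental theorem of calculus then
    -- gives the derivative in operator norm.
    have h2 := ((ev i).comp (ContinuousLinearMap.apply ℂ Y y)).intervalIntegral_comp_comm (hDi t ht)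
    have h3 := h t l ht hl y i
    rw [← map_sub] at h3
    exact h3.trans h2
  have hd := (intervalIntegral.integral_hasDerivAt_right (hDi l hl)
    (hD.stronglyMeasurableAtFilter isOpen_Ioi l hl) (hD.continuousAt (Ioi_mem_nhds hl))).const_add
    (S l)
  exact hd.congr_of_eventuallyEq (eventually_of_mem (Ioi_mem_nhds hl) key)

end Resolvent

/-! ### The derivative of the twisted convolution operator -/

lemma norm_planeWave_sub_le {γ : ℝ} (h0 : 0 ≤ γ) (h1 : γ ≤ 1) (t t' x : ℝ) :
    ‖planeWave t x - planeWave t' x‖ ≤ 2 * |t - t'| ^ γ * weight x ^ γ := by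
  have e : planeWave t x - planeWave t' x =
      planeWave t' x * (Complex.exp (Complex.I * ((t - t') * x : ℝ)) - 1) := by
    have : planeWave t x = planeWave t' x * planeWave (t - t') x := by
      rw [← planeWave_add]; congr 1; ring
    rw [this, mul_sub, mul_one]
    simp [planeWave, mul_assoc]
  rw [e, norm_mul, norm_planeWave, one_mul]
  refine (norm_exp_I_mul_sub_one_le_rpow h0 h1 _).trans ?_
  rw [abs_mul, Real.mul_rpow (abs_nonneg _) (abs_nonneg _), mul_assoc]
  gcongr
  rw [weight]; linarith [abs_nonneg x]

/-- The function `x ↦ w(x)^{-r} e^{-itx}`. -/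
def weightedWave {r : ℝ} (hr : 0 ≤ r) (t : ℝ) : ℝ →ᵇ ℂ :=
  BoundedContinuousFunction.ofNormedAddCommGroup
    (fun x => ((weight x ^ (-r) : ℝ) : ℂ) * planeWave (-t) x)
    ((Complex.continuous_ofReal.comp (continuous_weight_rpow (-r))).mul (continuous_planeWave (-t)))
    1 fun x => by
      rw [norm_mul, norm_planeWave, mul_one, Complex.norm_real, Real.norm_eq_abs,
        abs_of_pos (weight_rpow_pos _ _)]
      exact Real.rpow_le_one_of_one_le_of_nonpos (one_le_weight x) (neg_nonpos.2 hr)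

lemma weightedWave_apply {r : ℝ} (hr : 0 ≤ r) (t x : ℝ) :
    weightedWave hr t x = ((weight x ^ (-r) : ℝ) : ℂ) * planeWave (-t) x := rfl

lemma tendsto_weightedWave {r : ℝ} (hr : 0 < r) (t : ℝ) :
    Tendsto (weightedWave hr.le t) (cocompact ℝ) (𝓝 0) := by
  refine tendsto_zero_iff_norm_tendsto_zero.2 ?_
  have h1 : Tendsto weight (cocompact ℝ) atTop :=
    tendsto_atTop_add_const_left _ _ (tendsto_norm_cocompact_atTop (E := ℝ))
  refine ((tendsto_rpow_neg_atTop hr).comp h1).congr fun x => ?_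
  rw [weightedWave_apply, norm_mul, norm_planeWave, mul_one, Complex.norm_real, Real.norm_eq_abs,
    abs_of_pos (weight_rpow_pos _ _), Function.comp_apply]

/-- A Hölder estimate for plane waves costs a factor w^γ, which w^{-r} absorbs when γ ≤ r. -/
lemma locHolder_weightedWave {r γ : ℝ} (hr : 0 ≤ r) (h0 : 0 ≤ γ) (h1 : γ ≤ 1) (hγ : γ ≤ r) :
    LocHolder γ (weightedWave hr) := by
  refine LocHolder.of_norm_sub_le (C := 2) (by norm_num) fun t t' => ?_
  refine (BoundedContinuousFunction.norm_le (by positivity)).2 fun x => ?_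
  rw [BoundedContinuousFunction.sub_apply, weightedWave_apply, weightedWave_apply, ← mul_sub,
    norm_mul, Complex.norm_real, Real.norm_eq_abs, abs_of_pos (weight_rpow_pos _ _)]
  have h2 := norm_planeWave_sub_le h0 h1 (-t) (-t') x
  have h3 : |-t - -t'| = |t - t'| := by rw [← abs_neg]; congr 1; ring
  rw [h3] at h2
  calc weight x ^ (-r) * ‖planeWave (-t) x - planeWave (-t') x‖
      ≤ weight x ^ (-r) * (2 * |t - t'| ^ γ * weight x ^ r) := by
        gcongr
        · exact (weight_rpow_pos _ _).le
        · exact h2.trans (mul_le_mul_of_nonneg_left (weight_rpow_le_rpow hγ x) (by positivity))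
    _ = 2 * |t - t'| ^ γ := by
        have : weight x ^ (-r) * weight x ^ r = 1 := by
          rw [← Real.rpow_add (weight_pos x), neg_add_cancel, Real.rpow_zero]
        linear_combination (2 * |t - t'| ^ γ) * this

section Deriv

variable {v : ℝ → ℂ} {r γ : ℝ}

lemma integrable_planeWave_mul_bounded (hv : Integrable v) (t : ℝ) (φ : ℝ →ᵇ ℂ) :
    Integrable fun y => planeWave t y * (v y * φ y) :=
  (hv.mul_bdd φ.continuous.aestronglyMeasurable
    (Eventually.of_forall φ.norm_coe_le_norm)).bdd_mul (c := 1)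
    (continuous_planeWave t).aestronglyMeasurable
    (Eventually.of_forall fun y => (norm_planeWave t y).le)

/-- The functional `φ ↦ ∫ e^{ity} v(y) φ(y) dy`. -/
def waveFunctional (hv : Integrable v) (t : ℝ) : (ℝ →ᵇ ℂ) →L[ℂ] ℂ :=
  LinearMap.mkContinuous
    { toFun := fun φ => ∫ y, planeWave t y * (v y * φ y)
      map_add' := fun φ ψ => by
        rw [← integral_add (integrable_planeWave_mul_bounded hv t φ)
          (integrable_planeWave_mul_bounded hv t ψ)]
        congr 1; ext y
        rw [BoundedContinuousFunction.add_apply]; ring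
      map_smul' := fun c φ => by
        rw [RingHom.id_apply, smul_eq_mul, ← integral_const_mul]
        congr 1; ext y
        rw [BoundedContinuousFunction.smul_apply, smul_eq_mul]; ring }
    (∫ y, ‖v y‖) fun φ => by
      refine (norm_integral_le_of_norm_le (hv.norm.mul_const ‖φ‖)
        (Eventually.of_forall fun y => ?_)).trans_eq (integral_mul_const _ _)
      rw [norm_mul, norm_planeWave, one_mul, norm_mul]
      gcongr
      exact φ.norm_coe_le_norm y

lemma waveFunctional_apply (hv : Integrable v) (t : ℝ) (φ : ℝ →ᵇ ℂ) :
    waveFunctional hv t φ = ∫ y, planeWave t y * (v y * φ y) := rfl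

/-- Here the cost w^γ is paid by the additional moment of v. -/
lemma locHolder_waveFunctional (hv : Integrable v) (h0 : 0 ≤ γ) (h1 : γ ≤ 1)
    (hvγ : Integrable fun y => weight y ^ γ * ‖v y‖) : LocHolder γ (waveFunctional hv) := by
  have hI : 0 ≤ ∫ y, weight y ^ γ * ‖v y‖ := integral_nonneg fun y =>
    mul_nonneg (weight_rpow_pos _ _).le (norm_nonneg _)
  refine LocHolder.of_norm_sub_le (C := 2 * ∫ y, weight y ^ γ * ‖v y‖) (by positivity)
    fun t t' => ContinuousLinearMap.opNorm_le_bound _ (by positivity) fun φ => ?_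
  rw [sub_apply, waveFunctional_apply, waveFunctional_apply,
    ← integral_sub (integrable_planeWave_mul_bounded hv t φ)
      (integrable_planeWave_mul_bounded hv t' φ)]
  refine (norm_integral_le_of_norm_le (hvγ.const_mul (2 * |t - t'| ^ γ * ‖φ‖))
    (Eventually.of_forall fun y => ?_)).trans_eq ?_
  · rw [← sub_mul, norm_mul, norm_mul]
    calc ‖planeWave t y - planeWave t' y‖ * (‖v y‖ * ‖φ y‖)
        ≤ (2 * |t - t'| ^ γ * weight y ^ γ) * (‖v y‖ * ‖φ‖) := by
          gcongr
          · exact mul_nonneg (by positivity) (weight_rpow_pos _ _).le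
          · exact norm_planeWave_sub_le h0 h1 t t' y
          · exact φ.norm_coe_le_norm y
      _ = _ := by ring
  · rw [integral_const_mul]; ring

/-- The derivative of the twisted convolution operator with respect to the spectral parameter. -/
def operatorDeriv (hr : 0 ≤ r) (hv : Integrable v) (t : ℝ) : (ℝ →ᵇ ℂ) →L[ℂ] (ℝ →ᵇ ℂ) :=
  (-(1 / (2 * Real.pi * t)) : ℂ) • (waveFunctional hv t).smulRight (weightedWave hr t)

lemma operatorDeriv_apply (hr : 0 ≤ r) (hv : Integrable v) (t : ℝ) (φ : ℝ →ᵇ ℂ) :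
    operatorDeriv hr hv t φ =
      (-(1 / (2 * Real.pi * t) : ℂ) * ∫ y, planeWave t y * (v y * φ y)) • weightedWave hr t := by
  rw [mul_smul]; rfl

lemma locHolder_operatorDeriv (hr : 0 ≤ r) (hv : Integrable v) (h0 : 0 < γ) (h1 : γ ≤ 1)
    (hγ : γ ≤ r) (hvγ : Integrable fun y => weight y ^ γ * ‖v y‖) :
    LocHolder γ (operatorDeriv hr hv) := by
  have hc : LocHolder γ fun t : ℝ => (-(1 / (2 * Real.pi * t)) : ℂ) := by
    have hne : ∀ t : ℝ, 0 < t → (2 * Real.pi * t : ℂ) ≠ 0 := fun t ht => by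
      exact_mod_cast (by positivity : (2 * Real.pi * t : ℝ) ≠ 0)
    refine LocHolder.of_hasDerivAt (f' := fun t : ℝ => (2 * Real.pi) / (2 * Real.pi * t : ℂ) ^ 2)
      h1 (fun t ht => ?_) ?_
    · have hid : HasDerivAt (fun t : ℝ => (2 * Real.pi * t : ℂ)) (2 * Real.pi * 1) t :=
        (Complex.ofRealCLM.hasDerivAt (x := t)).const_mul _
      have := (hid.inv (hne t ht)).neg
      simp only [one_div]
      refine this.congr_deriv ?_
      rw [mul_one, neg_div, neg_neg]
    · exact ContinuousOn.div (by fun_prop) (by fun_prop) fun t ht => pow_ne_zero _ (hne t ht)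
  exact LocHolder.bilinear (ContinuousLinearMap.lsmul ℂ ℂ) h0 hc
    (LocHolder.bilinear (ContinuousLinearMap.smulRightL ℂ (ℝ →ᵇ ℂ) (ℝ →ᵇ ℂ)) h0
      (locHolder_waveFunctional hv h0.le h1 hvγ) (locHolder_weightedWave hr h0.le h1 hγ))

lemma twistedKernel_sub {σ : ℤˣ} {l μ x : ℝ} (hl : 0 < l) (hμ : 0 < μ) (hx : x ≠ 0) :
    twistedKernel σ l x - twistedKernel σ μ x =
      (-(1 / (2 * Real.pi)) : ℂ) * ∫ t in μ..l, planeWave (-t) x / t := by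
  rw [twistedKernel_eq, twistedKernel_eq]
  linear_combination -planeWave_mul_kernelTilde_sub hl hμ hx

/-- Fubini in t and y, after which e^{-it(x-y)} separates into a function of x and one of y: this is
the source of the rank-one derivative. -/
lemma integral_twistedKernel_sub (hv : Integrable v) (hv2 : Integrable fun y => ‖v y‖ ^ 2)
    (σ : ℤˣ) {l μ : ℝ} (hl : 0 < l) (hμ : 0 < μ) (φ : ℝ →ᵇ ℂ) (x : ℝ) :
    (∫ y, twistedKernel σ l (x - y) * (v y * φ y)) -
        ∫ y, twistedKernel σ μ (x - y) * (v y * φ y) =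
      ∫ t in μ..l, (-(1 / (2 * Real.pi * t)) : ℂ) * planeWave (-t) x *
        ∫ y, planeWave t y * (v y * φ y) := by
  have hφB : ∀ᵐ y, ‖φ y‖ ≤ ‖φ‖ := Eventually.of_forall φ.norm_coe_le_norm
  have hφm : AEStronglyMeasurable φ volume := φ.continuous.aestronglyMeasurable
  obtain ⟨C, hC⟩ := exists_isKernelBound_twistedKernel hl
  obtain ⟨C', hC'⟩ := exists_isKernelBound_twistedKernel hμ
  rw [← integral_sub (integrable_mul_bounded (hC σ) hv hv2 hφm hφB x)
    (integrable_mul_bounded (hC' σ) hv hv2 hφm hφB x)]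
  set f : ℝ → ℝ → ℂ := fun t y =>
    (-(1 / (2 * Real.pi)) : ℂ) * (planeWave (-t) (x - y) / t) * (v y * φ y) with hf
  have hpos : ∀ t ∈ uIoc μ l, min μ l < t := fun t ht => ht.1
  have hmin : 0 < min μ l := lt_min hμ hl
  -- On the interval of integration t exceeds min μ l > 0, so the factor 1/t is bounded.
  have hint : Integrable (Function.uncurry f) ((volume.restrict (uIoc μ l)).prod volume) := by
    have h1 : Integrable (fun _ : ℝ => (1 : ℂ)) (volume.restrict (uIoc μ l)) := by
      refine integrableOn_const ?_
      simp [uIoc]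
    have h2 := h1.mul_prod (hv.mul_bdd hφm hφB)
    simp only [one_mul] at h2
    refine h2.bdd_mul (c := 1 / (2 * Real.pi) * (1 / min μ l)) ?_ ?_
    · refine (Measurable.const_mul (Measurable.div ?_ ?_) _).aestronglyMeasurable
      · have : Continuous fun p : ℝ × ℝ => planeWave (-p.1) (x - p.2) := by
          unfold planeWave; fun_prop
        exact this.measurable
      · exact Complex.measurable_ofReal.comp measurable_fst
    · have h3 : ∀ᵐ p : ℝ × ℝ ∂((volume.restrict (uIoc μ l)).prod volume), p.1 ∈ uIoc μ l :=
        Measure.quasiMeasurePreserving_fst.ae (ae_restrict_mem measurableSet_uIoc)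
      filter_upwards [h3] with p hp
      have hp' := hpos _ hp
      have hp0 := hmin.trans hp'
      rw [norm_mul, norm_div, norm_planeWave, norm_neg, norm_div, norm_one, norm_mul,
        Complex.norm_real, Complex.norm_real, Real.norm_eq_abs, Real.norm_eq_abs,
        abs_of_pos Real.pi_pos, abs_of_pos hp0, Complex.norm_ofNat]
      gcongr
  have hswap := intervalIntegral_integral_swap hint
  have hR : ∀ t : ℝ, (∫ y, f t y) = (-(1 / (2 * Real.pi * t)) : ℂ) * planeWave (-t) x *
        ∫ y, planeWave t y * (v y * φ y) := fun t => by
    rw [← integral_const_mul]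
    congr 1; ext y
    simp only [hf, planeWave_sub_right, neg_neg]
    ring
  simp only [← hR]
  rw [hswap]
  refine integral_congr_ae ?_
  filter_upwards [Measure.ae_ne volume x] with y hy
  rw [← sub_mul, twistedKernel_sub hl hμ (sub_ne_zero.2 hy.symm), hf,
    ← intervalIntegral.integral_const_mul, ← intervalIntegral.integral_mul_const]

/-- Point evaluations serve as the separating family: a pointwise integral formula for the
increments and norm continuity of the rank-one operators suffice for differentiability in operator
norm. -/
theorem hasDerivAt_twistedOperator (hr : 0 ≤ r) (hv : Integrable v)
    (hv2 : Integrable fun y => ‖v y‖ ^ 2) (h0 : 0 < γ) (h1 : γ ≤ 1)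
    (hγ : γ ≤ r) (hvγ : Integrable fun y => weight y ^ γ * ‖v y‖) (σ : ℤˣ)
    {S : ℝ → (ℝ →ᵇ ℂ) →L[ℂ] (ℝ →ᵇ ℂ)}
    (hS : ∀ l, 0 < l → ∀ φ x, S l φ x =
      weightedWave hr 0 x * ∫ y, twistedKernel σ l (x - y) * (v y * φ y))
    {l : ℝ} (hl : 0 < l) : HasDerivAt S (operatorDeriv hr hv l) l := by
  have hDc := (locHolder_operatorDeriv hr hv h0 h1 hγ hvγ).continuousOn h0
  refine hasDerivAt_of_separating hDc (BoundedContinuousFunction.evalCLM ℂ)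
    (fun y z h => BoundedContinuousFunction.ext h) (fun t μ ht hμ φ x => ?_) hl
  change S t φ x - S μ φ x = ∫ τ in μ..t, operatorDeriv hr hv τ φ x
  rw [hS t ht, hS μ hμ, ← mul_sub, integral_twistedKernel_sub hv hv2 σ ht hμ,
    ← intervalIntegral.integral_const_mul]
  congr 1; ext τ
  rw [operatorDeriv_apply, BoundedContinuousFunction.smul_apply, smul_eq_mul,
    weightedWave_apply, weightedWave_apply, neg_zero, planeWave]
  simp only [Complex.ofReal_zero, mul_zero, zero_mul, Complex.exp_zero]
  ring

end Deriv

lemma LocHolder.isC1HolderLoc {E : Type*} [NormedAddCommGroup E] [NormedSpace ℝ E] {γ : ℝ≥0}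
    {F F' : ℝ → E} (hF : ∀ l, 0 < l → HasDerivAt F (F' l) l) (hF' : LocHolder γ F') :
    IsC1HolderLoc γ F (Ioi 0) := by
  refine ⟨fun l hl => (hF l hl).differentiableAt, fun K hK hKc => ?_⟩
  rcases K.eq_empty_or_nonempty with rfl | hne
  · exact ⟨0, fun x hx => hx.elim⟩
  obtain ⟨a, haK, ha⟩ := hKc.exists_isMinOn hne continuousOn_id
  obtain ⟨b, hb⟩ := hKc.bddAbove
  -- The left endpoint is the minimum of K, which lies in K and is therefore positive; on the right
  -- any upper bound will do.
  obtain ⟨C, hC0, hC⟩ := hF' a b (hK haK)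
  refine ⟨C.toNNReal, fun x hx y hy => ?_⟩
  rw [(hF x (hK hx)).deriv, (hF y (hK hy)).deriv, edist_dist, edist_dist,
    ← ENNReal.ofReal, ENNReal.ofReal_rpow_of_nonneg dist_nonneg γ.coe_nonneg,
    ← ENNReal.ofReal_mul hC0, dist_eq_norm, Real.dist_eq]
  exact ENNReal.ofReal_le_ofReal (hC x ⟨ha hx, hb hx⟩ y ⟨ha hy, hb hy⟩)

/-! ### Weighted bounded functions -/

namespace WeightedLp

variable {p : ℝ≥0∞} {r : ℝ}

lemma ext_ae {f g : WeightedLp p r} (h : f =ᵐ[volume] g) : f = g :=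
  Subtype.ext (AEEqFun.ext h)

lemma ae_norm_weight_mul_le (f : WeightedLp ∞ (-r)) :
    ∃ B, ∀ᵐ x, ‖((weight x ^ (-r) : ℝ) : ℂ) * f x‖ ≤ B := by
  refine ⟨(eLpNorm (fun x => (weight x ^ (-r)) • f x) ∞ volume).toReal, ?_⟩
  have h : ∀ᵐ x, ‖(weight x ^ (-r)) • f x‖ₑ ≤ eLpNorm (fun x => (weight x ^ (-r)) • f x) ∞ volume := by
    rw [eLpNorm_exponent_top]
    exact ae_le_eLpNormEssSup
  filter_upwards [h] with x hx
  have h2 := ENNReal.toReal_mono f.memLp.2.ne hx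
  rwa [toReal_enorm, Complex.real_smul] at h2

end WeightedLp

lemma conjWaveMul_conjWaveMul_neg {p : ℝ≥0∞} {r : ℝ} (l : ℝ) (f : WeightedLp p r) :
    conjWaveMul l (conjWaveMul (-l) f) = f := by
  refine WeightedLp.ext_ae ?_
  filter_upwards [coeFn_conjWaveMul l (conjWaveMul (-l) f), coeFn_conjWaveMul (-l) f] with x h1 h2
  rw [h1, h2, ← planeWave_neg, ← planeWave_neg, neg_neg, ← mul_assoc, planeWave_neg_mul_self,
    one_mul]

/-- Multiplication of a bounded continuous function with `w^r`. -/
def ofBounded (r : ℝ) (ψ : ℝ →ᵇ ℂ) : WeightedLp ∞ (-r) :=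
  ⟨AEEqFun.mk (fun x => ((weight x ^ r : ℝ) : ℂ) * ψ x)
    ((Complex.continuous_ofReal.comp (continuous_weight_rpow r)).mul
      ψ.continuous).aestronglyMeasurable, by
    refine (memLp_congr_ae ?_).2 (memLp_top_of_bound ψ.continuous.aestronglyMeasurable ‖ψ‖
      (Eventually.of_forall ψ.norm_coe_le_norm))
    filter_upwards [AEEqFun.coeFn_mk (μ := volume) (fun x => ((weight x ^ r : ℝ) : ℂ) * ψ x)
      ((Complex.continuous_ofReal.comp (continuous_weight_rpow r)).mul
      ψ.continuous).aestronglyMeasurable] with x hx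
    rw [hx, Complex.real_smul, ← mul_assoc, ← Complex.ofReal_mul, ← Real.rpow_add (weight_pos x),
      neg_add_cancel, Real.rpow_zero, Complex.ofReal_one, one_mul]⟩

lemma coeFn_ofBounded (r : ℝ) (ψ : ℝ →ᵇ ℂ) :
    ofBounded r ψ =ᵐ[volume] fun x => ((weight x ^ r : ℝ) : ℂ) * ψ x :=
  AEEqFun.coeFn_mk _ _

lemma norm_ofBounded_le (r : ℝ) (ψ : ℝ →ᵇ ℂ) : ‖ofBounded r ψ‖ ≤ ‖ψ‖ := by
  rw [WeightedLp.norm_eq, eLpNorm_exponent_top]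
  refine ENNReal.toReal_le_of_le_ofReal (norm_nonneg _) (eLpNormEssSup_le_of_ae_bound ?_)
  filter_upwards [coeFn_ofBounded r ψ] with x hx
  rw [hx, Complex.real_smul, ← mul_assoc, ← Complex.ofReal_mul, ← Real.rpow_add (weight_pos x),
    neg_add_cancel, Real.rpow_zero, Complex.ofReal_one, one_mul]
  exact ψ.norm_coe_le_norm x

/-- `ofBounded` as a continuous linear map. -/
def ofBoundedCLM (r : ℝ) : (ℝ →ᵇ ℂ) →L[ℂ] WeightedLp ∞ (-r) :=
  LinearMap.mkContinuous
    { toFun := ofBounded r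
      map_add' := fun φ ψ => WeightedLp.ext_ae <| by
        filter_upwards [coeFn_ofBounded r (φ + ψ), coeFn_ofBounded r φ, coeFn_ofBounded r ψ,
          AEEqFun.coeFn_add (ofBounded r φ).toAEEqFun (ofBounded r ψ).toAEEqFun] with x h1 h2 h3 h4
        have h5 : (ofBounded r φ + ofBounded r ψ : WeightedLp ∞ (-r)) x =
          ofBounded r φ x + ofBounded r ψ x := h4
        rw [h1, h5, h2, h3, BoundedContinuousFunction.add_apply, mul_add]
      map_smul' := fun c ψ => WeightedLp.ext_ae <| by
        filter_upwards [coeFn_ofBounded r (c • ψ), coeFn_ofBounded r ψ,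
          AEEqFun.coeFn_smul c (ofBounded r ψ).toAEEqFun] with x h1 h2 h3
        have h4 : (c • ofBounded r ψ : WeightedLp ∞ (-r)) x = c • ofBounded r ψ x := h3
        rw [h1, RingHom.id_apply, h4, h2, BoundedContinuousFunction.smul_apply, smul_eq_mul,
          smul_eq_mul, mul_left_comm] }
    1 fun ψ => by rw [one_mul]; exact norm_ofBounded_le r ψ

/-! ### The Jost functions and the resolvent of the twisted operator -/

/-- The potential multiplied with `w^r`. -/
def weightedPotential (u : ℝ → ℝ) (r y : ℝ) : ℂ := (u y : ℂ) * ((weight y ^ r : ℝ) : ℂ)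

section Jost

variable {u : ℝ → ℝ} {r l : ℝ} {σ : ℤˣ}

/-- The conjugation identity behind the whole reduction: the plane wave passes through the
convolution and twists the kernel, while the weight is moved onto the potential. -/
lemma kernel_mul_potential (u : ℝ → ℝ) (r l : ℝ) (σ : ℤˣ) (x y : ℝ) (z : ℂ) :
    kernel σ l (x - y) * ((u y : ℂ) * (planeWave l y * ((weight y ^ r : ℝ) : ℂ) * z)) =
      planeWave l x * (twistedKernel σ l (x - y) * (weightedPotential u r y * z)) := by
  have h := planeWave_neg_mul_self l x
  rw [twistedKernel, planeWave_sub_right, neg_neg, weightedPotential]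
  linear_combination (-(kernel σ l (x - y) * ((u y : ℂ) * (planeWave l y *
    ((weight y ^ r : ℝ) : ℂ) * z)))) * h

lemma jostOp_eq {m φ : ℝ → ℂ}
    (h : ∀ᵐ y, m y = planeWave l y * ((weight y ^ r : ℝ) : ℂ) * φ y) (x : ℝ) :
    jostOp u σ l m x = planeWave l x *
      ∫ y, twistedKernel σ l (x - y) * (weightedPotential u r y * φ y) := by
  rw [jostOp, convolution_eq_swap, ← integral_const_mul]
  refine integral_congr_ae ?_
  filter_upwards [h] with y hy
  rw [ContinuousLinearMap.mul_apply', hy, kernel_mul_potential]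

/-- The properties of the twisted convolution operator on bounded continuous functions. -/
structure IsTwistedOperator (u : ℝ → ℝ) {r : ℝ} (hr : 0 ≤ r) (σ : ℤˣ) (l : ℝ)
    (S : (ℝ →ᵇ ℂ) →L[ℂ] (ℝ →ᵇ ℂ)) : Prop where
  apply : ∀ φ x, S φ x = weightedWave hr 0 x *
    ∫ y, twistedKernel σ l (x - y) * (weightedPotential u r y * φ y)
  isUnit : IsUnit (1 - S)

end Jost

/-! ### Integrability of the weighted potential. -/

section Potential

variable {u : ℝ → ℝ} {s r b : ℝ}

lemma norm_weightedPotential (u : ℝ → ℝ) (r y : ℝ) :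
    ‖weightedPotential u r y‖ = weight y ^ r * ‖u y‖ := by
  rw [weightedPotential, norm_mul, Complex.norm_real, Complex.norm_real, mul_comm,
    Real.norm_eq_abs (weight y ^ r), abs_of_pos (weight_rpow_pos _ _)]

lemma aestronglyMeasurable_weightedPotential (hu : MemWeightedLp u 2 s) (r : ℝ) :
    AEStronglyMeasurable (weightedPotential u r) volume :=
  (Complex.continuous_ofReal.comp_aestronglyMeasurable hu.aestronglyMeasurable).mul
    (Complex.continuous_ofReal.comp (continuous_weight_rpow r)).aestronglyMeasurable

lemma integrable_weight_mul_weightedPotential (hu : MemWeightedLp u 2 s) (h : b + r < s - 1 / 2) :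
    Integrable fun y => weight y ^ b * ‖weightedPotential u r y‖ := by
  refine (hu.integrable_weight_mul h).congr (Eventually.of_forall fun y => ?_)
  simp only [norm_weightedPotential, Real.rpow_add (weight_pos y), mul_assoc]

lemma integrable_weightedPotential (hu : MemWeightedLp u 2 s) (h : r < s - 1 / 2) :
    Integrable (weightedPotential u r) := by
  refine (integrable_norm_iff (aestronglyMeasurable_weightedPotential hu r)).1 ?_
  simpa using integrable_weight_mul_weightedPotential (b := 0) hu (by simpa using h)

lemma integrable_weightedPotential_sq (hu : MemWeightedLp u 2 s) (h : r ≤ s) :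
    Integrable fun y => ‖weightedPotential u r y‖ ^ 2 := by
  simpa only [norm_weightedPotential] using hu.integrable_sq h

end Potential

section Jost

variable {u : ℝ → ℝ} {s s₁ l : ℝ} {σ : ℤˣ}

/-- Compactness reduces invertibility to injectivity, and a fixed point of S corresponds to a
solution of the homogeneous Jost equation with growth at most w^{s-s₁}. Compactness requires s > s₁,
so that w^{-(s-s₁)} tends to zero. -/
lemma exists_isTwistedOperator (hs₁ : 1 / 2 < s₁) (hs : s₁ < s) (hu : MemWeightedLp u 2 s)
    (σ : ℤˣ) (hl : 0 < l) : ∃ S, IsTwistedOperator u (sub_nonneg.2 hs.le) σ l S := by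
  obtain ⟨C, hC⟩ := exists_isKernelBound_twistedKernel hl
  have hv := integrable_weightedPotential (r := s - s₁) hu (by linarith)
  have hv2 := integrable_weightedPotential_sq (r := s - s₁) hu (by linarith)
  obtain ⟨S, hS, hcomp⟩ := exists_compact_convolution_operator (hC σ) hv hv2
    (tendsto_convModulus_twistedKernel σ hl hv hv2) (weightedWave (sub_nonneg.2 hs.le) 0)
    (tendsto_weightedWave (sub_pos.2 hs) 0)
  refine ⟨S, hS, isUnit_one_sub_of_compact hcomp fun n hn => ?_⟩
  have hne : ∀ x, ((weight x ^ (s - s₁) : ℝ) : ℂ) ≠ 0 := fun x => by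
    exact_mod_cast (weight_rpow_pos (s - s₁) x).ne'
  have hw : ∀ x, ((weight x ^ (s - s₁) : ℝ) : ℂ) * ((weight x ^ (-(s - s₁)) : ℝ) : ℂ) = 1 :=
    fun x => by
      rw [← Complex.ofReal_mul, ← Real.rpow_add (weight_pos x), add_neg_cancel, Real.rpow_zero,
        Complex.ofReal_one]
  set m : ℝ → ℂ := fun x => planeWave l x * ((weight x ^ (s - s₁) : ℝ) : ℂ) * n x with hm
  have hmc : Continuous m := ((continuous_planeWave l).mul
    (Complex.continuous_ofReal.comp (continuous_weight_rpow _))).mul n.continuous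
  have h0 : ∀ x, m x = 0 := by
    refine eq_zero_of_homogeneous (C := ‖n‖) hs₁ hs hl hu σ hmc.aestronglyMeasurable
      (fun x => ?_) fun x => ?_
    · rw [hm, norm_mul, norm_mul, norm_planeWave, one_mul, Complex.norm_real, Real.norm_eq_abs,
        abs_of_pos (weight_rpow_pos _ _), mul_comm]
      exact mul_le_mul_of_nonneg_right (n.norm_coe_le_norm x) (weight_rpow_pos _ _).le
    · simp only [hm, kernel_mul_potential]
      rw [integral_const_mul, mul_assoc]
      congr 1
      conv_lhs => rw [← hn, hS, weightedWave_apply]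
      rw [← mul_assoc, ← mul_assoc, hw, one_mul, neg_zero, planeWave]
      simp
  ext x
  have h1 := h0 x
  rw [hm] at h1
  have h2 : planeWave l x ≠ 0 := norm_ne_zero_iff.1 (by rw [norm_planeWave]; exact one_ne_zero)
  simpa [h2, hne x] using h1

lemma ae_eq_of_conjWaveMul_eq {r : ℝ} {m : WeightedLp ∞ (-r)} {n : ℝ →ᵇ ℂ}
    (h : conjWaveMul l m = ofBounded r n) :
    ∀ᵐ y, m y = planeWave l y * ((weight y ^ r : ℝ) : ℂ) * n y := by
  filter_upwards [coeFn_conjWaveMul l m, coeFn_ofBounded r n] with y h1 h2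
  rw [h, h2, ← planeWave_neg] at h1
  linear_combination (-(planeWave l y)) * h1 - m y * planeWave_neg_mul_self l y

/-- The Jost equation with inhomogeneity `e^{i(l-t)x}` in terms of the resolvent of the twisted
operator. -/
theorem jost_equation_iff {r : ℝ} {hr0 : 0 ≤ r} (hv : Integrable (weightedPotential u r))
    (hv2 : Integrable fun y => ‖weightedPotential u r y‖ ^ 2) (hl : 0 < l)
    {S : (ℝ →ᵇ ℂ) →L[ℂ] (ℝ →ᵇ ℂ)} (hS : IsTwistedOperator u hr0 σ l S) (t : ℝ)
    (m : WeightedLp ∞ (-r)) :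
    (∀ᵐ x, m x = planeWave (l - t) x + jostOp u σ l m x) ↔
      conjWaveMul l m = ofBounded r (resolventApply S (weightedWave hr0 t)) := by
  have hw : ∀ x, ((weight x ^ r : ℝ) : ℂ) * ((weight x ^ (-r) : ℝ) : ℂ) = 1 := fun x => by
    rw [← Complex.ofReal_mul, ← Real.rpow_add (weight_pos x), add_neg_cancel, Real.rpow_zero,
      Complex.ofReal_one]
  have hp0 : ∀ x, weightedWave hr0 0 x = ((weight x ^ (-r) : ℝ) : ℂ) := fun x => by
    rw [weightedWave_apply, neg_zero, planeWave]; simp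
  have hpt : ∀ x, planeWave (l - t) x = planeWave l x * planeWave (-t) x := fun x => by
    rw [← planeWave_add]; rfl
  have hpp := planeWave_neg_mul_self l
  constructor
  · intro h
    set ψ : ℝ → ℂ := fun x => planeWave (-l) x * (((weight x ^ (-r) : ℝ) : ℂ) * m x) with hψ
    obtain ⟨C, hC⟩ := exists_isKernelBound_twistedKernel hl
    have hD := tendsto_convModulus_twistedKernel σ hl hv hv2
    have hψm : AEStronglyMeasurable ψ volume :=
      (continuous_planeWave (-l)).aestronglyMeasurable.mul
        ((Complex.continuous_ofReal.comp (continuous_weight_rpow _)).aestronglyMeasurable.mul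
          m.toAEEqFun.aestronglyMeasurable)
    obtain ⟨B, hB⟩ := m.ae_norm_weight_mul_le
    have hψB : ∀ᵐ x, ‖ψ x‖ ≤ B := by
      filter_upwards [hB] with x hx
      rwa [hψ, norm_mul, norm_planeWave, one_mul]
    have hmψ : ∀ᵐ y, m y = planeWave l y * ((weight y ^ r : ℝ) : ℂ) * ψ y :=
      Eventually.of_forall fun y => by
        rw [hψ]
        linear_combination (-(m y)) * hw y - (((weight y ^ r : ℝ) : ℂ) *
          ((weight y ^ (-r) : ℝ) : ℂ) * m y) * hpp y
    -- The right-hand side of the equation is continuous and bounded even though ψ is only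
    -- measurable and essentially bounded. It provides the continuous representative on which S
    -- acts.
    set n : ℝ →ᵇ ℂ := weightedWave hr0 t + weightedWave hr0 0 *
      BoundedContinuousFunction.ofNormedAddCommGroup
        (fun x => ∫ y, twistedKernel σ l (x - y) * (weightedPotential u r y * ψ y))
        (continuous_integral_mul_bounded (hC σ) hv hv2 hD hψm hψB)
        (C * convBound (weightedPotential u r) * B)
        (norm_integral_mul_bounded_le (hC σ) hv hv2 hψB) with hn
    have hna : ∀ x, n x = weightedWave hr0 t x + weightedWave hr0 0 x *
        ∫ y, twistedKernel σ l (x - y) * (weightedPotential u r y * ψ y) := fun x => rfl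
    have hnψ : ∀ᵐ x, n x = ψ x := by
      filter_upwards [h] with x hx
      rw [hna, hψ]
      simp only
      rw [hx, jostOp_eq hmψ, hp0, weightedWave_apply, hpt]
      linear_combination (-(((weight x ^ (-r) : ℝ) : ℂ) * (planeWave (-t) x +
        ∫ y, twistedKernel σ l (x - y) * (weightedPotential u r y * ψ y)))) * hpp x
    have hSn : n = weightedWave hr0 t + S n := by
      ext x
      rw [hna, BoundedContinuousFunction.add_apply, hS.apply]
      congr 2
      refine integral_congr_ae ?_
      filter_upwards [hnψ] with y hy
      rw [hy]
    rw [← (resolventApply_eq_iff hS.isUnit).2 hSn]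
    refine WeightedLp.ext_ae ?_
    filter_upwards [coeFn_conjWaveMul l m, coeFn_ofBounded r n, hnψ] with x h1 h2 h3
    rw [h1, h2, h3, hψ, ← planeWave_neg]
    linear_combination (-(planeWave (-l) x * m x)) * hw x
  · intro h
    set n := resolventApply S (weightedWave hr0 t) with hn
    have hSn := (resolventApply_eq_iff hS.isUnit).1 hn
    have hmn := ae_eq_of_conjWaveMul_eq h
    filter_upwards [hmn] with x hx
    have h1 : n x = weightedWave hr0 t x + S n x := by
      conv_lhs => rw [hSn]
      rfl
    rw [hS.apply, hp0, weightedWave_apply] at h1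
    rw [jostOp_eq hmn, hx, h1, hpt]
    linear_combination (planeWave l x * (planeWave (-t) x + ∫ y, twistedKernel σ l (x - y) *
      (weightedPotential u r y * n y))) * hw x

lemma isJostOne_iff {r : ℝ} {hr0 : 0 ≤ r} (hv : Integrable (weightedPotential u r))
    (hv2 : Integrable fun y => ‖weightedPotential u r y‖ ^ 2) (hl : 0 < l)
    {S : (ℝ →ᵇ ℂ) →L[ℂ] (ℝ →ᵇ ℂ)} (hS : IsTwistedOperator u hr0 σ l S)
    (m : WeightedLp ∞ (-r)) :
    IsJostOne u σ l m ↔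
      conjWaveMul l m = ofBounded r (resolventApply S (weightedWave hr0 l)) := by
  rw [← jost_equation_iff hv hv2 hl hS l m, IsJostOne]
  simp [planeWave]

lemma isJostExp_iff {r : ℝ} {hr0 : 0 ≤ r} (hv : Integrable (weightedPotential u r))
    (hv2 : Integrable fun y => ‖weightedPotential u r y‖ ^ 2) (hl : 0 < l)
    {S : (ℝ →ᵇ ℂ) →L[ℂ] (ℝ →ᵇ ℂ)} (hS : IsTwistedOperator u hr0 σ l S)
    (m : WeightedLp ∞ (-r)) :
    IsJostExp u σ l m ↔
      conjWaveMul l m = ofBounded r (resolventApply S (weightedWave hr0 0)) := by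
  rw [← jost_equation_iff hv hv2 hl hS 0 m, IsJostExp, sub_zero]

/-- Multiplication by a unimodular function is a bijection; with the resolvent formula this yields
both existence and uniqueness of the Jost functions. -/
lemma existsUnique_conjWaveMul_eq {p : ℝ≥0∞} {r : ℝ} (l : ℝ) (f : WeightedLp p r) :
    ∃! m : WeightedLp p r, conjWaveMul l m = f := by
  refine ⟨conjWaveMul (-l) f, conjWaveMul_conjWaveMul_neg l f, ?_⟩
  rintro m rfl
  simpa using (conjWaveMul_conjWaveMul_neg (-l) m).symm

lemma ae_mul_eq_of_conjWaveMul_eq {r : ℝ} {m : WeightedLp ∞ (-r)} {n : ℝ →ᵇ ℂ}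
    (h : conjWaveMul l m = ofBounded r n) :
    (fun y => (u y : ℂ) * m y) =ᵐ[volume]
      fun y => planeWave l y * (weightedPotential u r y * n y) := by
  filter_upwards [ae_eq_of_conjWaveMul_eq h] with y hy
  rw [hy, weightedPotential]
  ring

end Jost

end BO

end

/-! ### The main theorem. -/

theorem lemma4p1 (s s₁ : ℝ) (hs₁ : 1 / 2 < s₁) (hs : s₁ < s)
    (u : ℝ → ℝ) (hu : BO.MemWeightedLp u 2 s) :
    -- existence and uniqueness of the Jost functions that the claim is about
    (∀ (σ : ℤˣ) (l : ℝ), 0 < l →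
      (∃! m : BO.WeightedLp ∞ (-(s - s₁)), BO.IsJostOne u σ l m) ∧
      (∃! m : BO.WeightedLp ∞ (-(s - s₁)), BO.IsJostExp u σ l m)) ∧
    -- regularity of the map and formula for its derivative
    ∀ m₁ mₑ : ℤˣ → ℝ → BO.WeightedLp ∞ (-(s - s₁)),
      (∀ (σ : ℤˣ) (l : ℝ), 0 < l → BO.IsJostOne u σ l (m₁ σ l)) →
      (∀ (σ : ℤˣ) (l : ℝ), 0 < l → BO.IsJostExp u σ l (mₑ σ l)) →
      ∃ γ : ℝ≥0, 0 < γ ∧ γ < 1 ∧ ∀ σ : ℤˣ,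
        BO.IsC1HolderLoc γ (fun l => BO.conjWaveMul l (mₑ σ l)) (Ioi 0) ∧
        ∀ l : ℝ, 0 < l →
          Integrable (fun y => (u y : ℂ) * mₑ σ l y) volume ∧
          HasDerivAt (fun l => BO.conjWaveMul l (mₑ σ l))
            ((-(1 / (2 * Real.pi * l) : ℂ) * ∫ y, (u y : ℂ) * mₑ σ l y) •
              BO.conjWaveMul l (m₁ σ l)) l := by
  have hr : 0 < s - s₁ := sub_pos.2 hs
  have hv := BO.integrable_weightedPotential (r := s - s₁) hu (by linarith)
  have hv2 := BO.integrable_weightedPotential_sq (r := s - s₁) hu (by linarith)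
  have hex : ∀ (σ : ℤˣ) (l : ℝ), ∃ S, 0 < l → BO.IsTwistedOperator u hr.le σ l S := fun σ l => by
    by_cases hl : 0 < l
    · obtain ⟨S, hS⟩ := BO.exists_isTwistedOperator hs₁ hs hu σ hl
      exact ⟨S, fun _ => hS⟩
    -- A dummy operator for l ≤ 0, so that S can be chosen as a function on all of ℝ.
    · exact ⟨0, fun h => absurd h hl⟩
  choose S hS using hex
  refine ⟨fun σ l hl => ⟨?_, ?_⟩, fun m₁ mₑ h₁ hₑ => ?_⟩
  · simp only [BO.isJostOne_iff hv hv2 hl (hS σ l hl)]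
    exact BO.existsUnique_conjWaveMul_eq l _
  · simp only [BO.isJostExp_iff hv hv2 hl (hS σ l hl)]
    exact BO.existsUnique_conjWaveMul_eq l _
  -- The bound γ < s - s₁ lets the weight absorb the variation of the plane waves, and γ < s₁ - 1/2
  -- keeps w^γ v integrable; the half makes all inequalities strict.
  set γ : ℝ := min (min (s - s₁) (s₁ - 1 / 2)) 1 / 2 with hγ
  have hγ0 : 0 < γ := half_pos (lt_min (lt_min hr (by linarith)) one_pos)
  have hmin : γ < min (min (s - s₁) (s₁ - 1 / 2)) 1 := half_lt_self (by linarith)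
  have hγr : γ < s - s₁ := hmin.trans_le ((min_le_left _ _).trans (min_le_left _ _))
  have hγs : γ < s₁ - 1 / 2 := hmin.trans_le ((min_le_left _ _).trans (min_le_right _ _))
  have hγ1 : γ < 1 := hmin.trans_le (min_le_right _ _)
  have hvγ := BO.integrable_weight_mul_weightedPotential (b := γ) (r := s - s₁) hu (by linarith)
  refine ⟨⟨γ, hγ0.le⟩, hγ0, hγ1, fun σ => ?_⟩
  set D := BO.operatorDeriv hr.le hv with hD
  set p := BO.weightedWave hr.le with hp
  have hSd : ∀ l, 0 < l → HasDerivAt (S σ) (D l) l := fun l hl =>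
    BO.hasDerivAt_twistedOperator hr.le hv hv2 hγ0 hγ1.le hγr.le hvγ σ
      (fun l hl => (hS σ l hl).apply) hl
  have hDH : BO.LocHolder γ D := BO.locHolder_operatorDeriv hr.le hv hγ0 hγ1.le hγr.le hvγ
  have hFe : ∀ l, 0 < l → BO.conjWaveMul l (mₑ σ l) =
      BO.ofBoundedCLM (s - s₁) (BO.resolventApply (S σ l) (p 0)) := fun l hl =>
    (BO.isJostExp_iff hv hv2 hl (hS σ l hl) _).1 (hₑ σ l hl)
  have hF1 : ∀ l, 0 < l → BO.conjWaveMul l (m₁ σ l) =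
      BO.ofBoundedCLM (s - s₁) (BO.resolventApply (S σ l) (p l)) := fun l hl =>
    (BO.isJostOne_iff hv hv2 hl (hS σ l hl) _).1 (h₁ σ l hl)
  have hder : ∀ l, 0 < l → HasDerivAt (fun l => BO.conjWaveMul l (mₑ σ l))
      (BO.ofBoundedCLM (s - s₁)
        (BO.resolventApply (S σ l) (D l (BO.resolventApply (S σ l) (p 0))))) l := fun l hl =>
    (BO.hasDerivAt_clm_comp (BO.ofBoundedCLM (s - s₁))
      (BO.hasDerivAt_resolventApply (hSd l hl) (hS σ l hl).isUnit (p 0))).congr_of_eventuallyEq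
      (eventually_of_mem (Ioi_mem_nhds hl) hFe)
  refine ⟨BO.LocHolder.isC1HolderLoc hder ?_, fun l hl => ⟨?_, ?_⟩⟩
  · exact BO.LocHolder.clm_comp (BO.ofBoundedCLM (s - s₁))
      (BO.locHolder_deriv_resolventApply hγ0 hγ1.le hSd (fun l hl => (hS σ l hl).isUnit) hDH (p 0))
  · exact (BO.integrable_planeWave_mul_bounded hv l _).congr
      (BO.ae_mul_eq_of_conjWaveMul_eq (hFe l hl)).symm
  -- The range of D l is spanned by p l, whose resolvent image is the conjugated m₁; the plane wave
  -- in the functional cancels the conjugation, leaving ∫ u mₑ.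
  · refine (hder l hl).congr_deriv ?_
    rw [hF1 l hl, integral_congr_ae (BO.ae_mul_eq_of_conjWaveMul_eq (hFe l hl)), hD,
      BO.operatorDeriv_apply, BO.resolventApply_smul, map_smul]
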